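/- Let $n\ge 2$ and let $\mathbb R^n$ have the basis $k,l,m_1,\dots,m_{n-2}$ and the Minkowski product $\eta=\omega^1\otimes\omega^2+\omega^2\otimes\omega^1+\sum_{i\ge 3}\omega^i\otimes\omega^i$, where $\omega^1,\dots,\omega^n$ is the dual basis. Let $GN\subset GL(n,\mathbb R)$ be the group of all invertible $f$ with $f(k)\in\mathbb Rk$, with $\eta(f(w),f(\tilde w))=\eta(w,\tilde w)$ for all $w,\tilde w\in\{k\}^\perp$, and with $\eta(f(k),f(z))=\eta(k,z)$ for all $z\in\mathbb R^n$. Let $Sim(n-2)=\{f\in O(1,n-1): f(k)\in\mathbb Rk\}$. Let $M$ be a smooth (Hausdorff) manifold of dimension $n$. For a Lie subgroup $G\subset GL(n,\mathbb R)$, a $G$-structure $P\to M$ is a smooth principal $G$-subbundle of the frame bundle, whose fibre $P_x$ consists of linear isomorphisms $u:\mathbb R^n\to T_xM$. The null distribution $\lambda$ of a $GN$-structure $P$ is given by $\lambda_x=u(\mathbb Rk)$ for any $u\in P_x$. A Lorentzian metric $g$ belongs to $P$ if there is a $Sim(n-2)$-structure $Q\subset P$ with $g(u(v),u(w))=\eta(v,w)$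 for all $u\in Q$ and $v,w\in\mathbb R^n$. A smooth vector field $X$ on $M$ is an infinitesimal automorphism of $P$ if its (local) flow $\phi_t$ preserves $P$, that is, $d\phi_t\circ u\in P_{\phi_t(x)}$ for all $u\in P_x$ whenever $\phi_t(x)$ is defined; $aut(P)$ denotes the set of these fields. Let $(M,g)$ be Lorentzian and let $\lambda$ be a smooth null distribution, i.e. a smooth field of lines that are null for $g$. A bilinear form on $T_xM$ is of type III with respect to $\lambda$ if it lies in $\lambda^*_x\otimes\Lambda^*_x+\Lambda^*_x\otimes\lambda^*_x$, where $\lambda^*_x$ and $\Lambda^*_x$ are the annihilators in $T_x^*M$ of $\lambda_x^\perp$ and of $\lambda_x$ respectively. A smooth vector field $X$ on $M$ is an algebra-preserving nil-Killing field with respect to $(M,g,\lambda)$ if $\mathcal L_Xg$ is everywhere of type III with respect to $\lambda$ and $[X,\lambda]\subset\lambda$, the latter meaning that $[X,Y]$ is a section of $\lambda$ for each local smooth section $Y$ of $\lambda$. The set of these fields is denoted $\mathfrak g_{(g,\lambda)}$. 1. Let $P\to M$ be a $GN$-structure with null distribution $\lambda$ and let $g$ be a Lorentzian metric belonging to $P$.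 Then a smooth vector field $X$ on $M$ is an infinitesimal automorphism of $P$ if and only if it is an algebra-preserving nil-Killing field with respect to $(M,g,\lambda)$. 2. Let $g$ be a Lorentzian metric on $M$ with a smooth null distribution $\lambda$. The frames $(X,Y,Z_1,\dots,Z_{n-2})$ of the tangent spaces of $M$ with $X\in\lambda$, $g(X,Y)=1$, $Z_i\in\lambda^\perp$ and $g(Z_i,Z_j)=\delta_{ij}$ form a $GN$-structure $P(M,g,\lambda)$, to which $g$ belongs. The set $\mathfrak g_{(g,\lambda)}$ is a Lie subalgebra of the real Lie algebra of smooth vector fields on $M$, and $$\mathfrak g_{(g,\lambda)}=aut[P(M,g,\lambda)].$$ -/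

import Mathlib

open Set Bundle VectorField
open scoped Manifold ContDiff Topology

noncomputable section

namespace NilKilling

/-! ## The linear model: Minkowski space of dimension `n = m + 2` with null basis `k, l, m₁, …, mₘ` -/

/-- `ℝⁿ` with `n = m + 2`; coordinate `0` belongs to `k`, coordinate `1` to `l`, and coordinate
`i + 2` to the `i`-th spacelike basis vector. -/
abbrev Vec (m : ℕ) : Type := Fin (m + 2) → ℝ

/-- The null vector `k`. -/
def kvec (m : ℕ) : Vec m := Pi.single 0 1

/-- The Minkowski product `ω¹ ⊗ ω² + ω² ⊗ ω¹ + ω³ ⊗ ω³ + ⋯ + ωⁿ ⊗ ωⁿ`. -/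
def eta {m : ℕ} (v w : Vec m) : ℝ :=
  v 0 * w 1 + v 1 * w 0 + ∑ i : Fin m, v i.succ.succ * w i.succ.succ

lemma eta_smul_left {m : ℕ} (c : ℝ) (v w : Vec m) : eta (c • v) w = c * eta v w := by
  simp only [eta, Pi.smul_apply, smul_eq_mul, mul_add, Finset.mul_sum, mul_assoc]

/-- The general linear group of `ℝⁿ`, as linear automorphisms. -/
abbrev GLVec (m : ℕ) : Type := Vec m ≃ₗ[ℝ] Vec m

lemma kvec_ne_zero (m : ℕ) : kvec m ≠ 0 := fun h => by
  simpa [kvec] using congrFun h 0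

lemma ne_zero_of_map_kvec {m : ℕ} {f : GLVec m} {c : ℝ} (h : f (kvec m) = c • kvec m) :
    c ≠ 0 := by
  rintro rfl
  rw [zero_smul] at h
  exact kvec_ne_zero m ((map_eq_zero_iff f f.injective).1 h)

lemma inv_map_kvec {m : ℕ} {f : GLVec m} {c : ℝ} (h : f (kvec m) = c • kvec m) :
    f⁻¹ (kvec m) = c⁻¹ • kvec m := by
  apply f.injective
  have h1 : f (f⁻¹ (kvec m)) = kvec m := f.apply_symm_apply _
  rw [h1, map_smul, h, smul_smul, inv_mul_cancel₀ (ne_zero_of_map_kvec h), one_smul]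

/-- The group `GN`: linear automorphisms `f` of `ℝⁿ` with `f k ∈ ℝ k`, preserving `η` on `k^⊥`,
and with `η (f k, f z) = η (k, z)` for all `z`. -/
def GN (m : ℕ) : Subgroup (GLVec m) where
  carrier := {f | (∃ c : ℝ, f (kvec m) = c • kvec m) ∧
    (∀ w w' : Vec m, eta (kvec m) w = 0 → eta (kvec m) w' = 0 → eta (f w) (f w') = eta w w') ∧
    (∀ z : Vec m, eta (f (kvec m)) (f z) = eta (kvec m) z)}
  one_mem' := ⟨⟨1, by simp⟩, fun _ _ _ _ => rfl, fun _ => rfl⟩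
  mul_mem' := by
    rintro f g ⟨⟨c, hf⟩, hf2, hf3⟩ ⟨⟨d, hg⟩, hg2, hg3⟩
    have key : ∀ w, d * eta (kvec m) (g w) = eta (kvec m) w := fun w => by
      rw [← eta_smul_left, ← hg, hg3]
    have hd : d ≠ 0 := ne_zero_of_map_kvec hg
    have perp : ∀ w, eta (kvec m) w = 0 → eta (kvec m) (g w) = 0 := fun w hw => by
      have := key w
      rw [hw] at this
      exact (mul_eq_zero.1 this).resolve_left hd
    refine ⟨⟨d * c, ?_⟩, ?_, ?_⟩
    · rw [LinearEquiv.mul_apply, hg, map_smul, hf, smul_smul]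
    · intro w w' hw hw'
      rw [LinearEquiv.mul_apply, LinearEquiv.mul_apply, hf2 _ _ (perp w hw) (perp w' hw'),
        hg2 _ _ hw hw']
    · intro z
      rw [LinearEquiv.mul_apply, LinearEquiv.mul_apply, hg, map_smul, eta_smul_left, hf3, key]
  inv_mem' := by
    rintro f ⟨⟨c, hf⟩, hf2, hf3⟩
    have hc : c ≠ 0 := ne_zero_of_map_kvec hf
    have happ : ∀ w, f (f⁻¹ w) = w := fun w => f.apply_symm_apply w
    have key : ∀ w, eta (kvec m) (f⁻¹ w) = c * eta (kvec m) w := fun w => by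
      rw [← hf3, happ, hf, eta_smul_left]
    refine ⟨⟨c⁻¹, inv_map_kvec hf⟩, ?_, ?_⟩
    · intro w w' hw hw'
      rw [← hf2 _ _ (by rw [key, hw, mul_zero]) (by rw [key, hw', mul_zero]), happ, happ]
    · intro z
      rw [inv_map_kvec hf, eta_smul_left, key, inv_mul_cancel_left₀ hc]

/-- The group `Sim(n - 2)`: linear isometries `f` of Minkowski space with `f k ∈ ℝ k`. -/
def Sim (m : ℕ) : Subgroup (GLVec m) where
  carrier := {f | (∀ v w : Vec m, eta (f v) (f w) = eta v w) ∧ ∃ c : ℝ, f (kvec m) = c • kvec m}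
  one_mem' := ⟨fun _ _ => rfl, 1, by simp⟩
  mul_mem' := by
    rintro f g ⟨hf, c, hfc⟩ ⟨hg, d, hgd⟩
    refine ⟨fun v w => ?_, d * c, ?_⟩
    · rw [LinearEquiv.mul_apply, LinearEquiv.mul_apply, hf, hg]
    · rw [LinearEquiv.mul_apply, hgd, map_smul, hfc, smul_smul]
  inv_mem' := by
    rintro f ⟨hf, c, hfc⟩
    have happ : ∀ w, f (f⁻¹ w) = w := fun w => f.apply_symm_apply w
    exact ⟨fun v w => by rw [← hf, happ, happ], c⁻¹, inv_map_kvec hfc⟩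

/-! ## Manifolds of dimension `n = m + 2` -/

/-- The model space of an `n`-dimensional manifold, `n = m + 2`. -/
abbrev Mod (m : ℕ) : Type := EuclideanSpace ℝ (Fin (m + 2))

variable {m : ℕ} {M : Type*} [TopologicalSpace M] [ChartedSpace (Mod m) M]

/-- The tangent space at `x`. -/
abbrev Tan (m : ℕ) {M : Type*} [TopologicalSpace M] [ChartedSpace (Mod m) M] (x : M) : Type :=
  TangentSpace (𝓡 (m + 2)) x

/-- The vector field `Y` (not necessarily smooth elsewhere) is smooth on the set `U`. -/
def SmoothFieldOn [IsManifold (𝓡 (m + 2)) ∞ M] (Y : ∀ x : M, Tan m x) (U : Set M) : Prop :=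
  ContMDiffOn (𝓡 (m + 2)) (𝓡 (m + 2)).tangent ∞
    (fun x => (⟨x, Y x⟩ : TangentBundle (𝓡 (m + 2)) M)) U

/-- The vector field `Y` is differentiable at `x`. -/
abbrev FieldDiffAt [IsManifold (𝓡 (m + 2)) ∞ M] (Y : ∀ x : M, TangentSpace (𝓡 (m + 2)) x)
    (x : M) : Prop :=
  MDifferentiableAt (𝓡 (m + 2)) ((𝓡 (m + 2)).prod 𝓘(ℝ, Mod m))
    (fun y => TotalSpace.mk' (Mod m) y (Y y)) x

/-- The smooth vector fields on `M`. -/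
abbrev Fields (m : ℕ) (M : Type*) [TopologicalSpace M] [ChartedSpace (Mod m) M]
    [IsManifold (𝓡 (m + 2)) ∞ M] : Type _ :=
  ContMDiffSection (𝓡 (m + 2)) (Mod m) ∞ (fun x : M => TangentSpace (𝓡 (m + 2)) x)

section LieAlgebraOfFields

variable [IsManifold (𝓡 (m + 2)) ∞ M]

lemma two_le_infty : (minSmoothness ℝ 2 : WithTop ℕ∞) ≤ ∞ := by
  rw [minSmoothness_of_isRCLikeNormedField]
  exact WithTop.coe_le_coe.2 (le_top : (2 : ℕ∞) ≤ ⊤)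

lemma three_le_infty : (minSmoothness ℝ 3 : WithTop ℕ∞) ≤ ∞ := by
  rw [minSmoothness_of_isRCLikeNormedField]
  exact WithTop.coe_le_coe.2 (le_top : (3 : ℕ∞) ≤ ⊤)

instance : IsManifold (𝓡 (m + 2)) (minSmoothness ℝ 2) M := IsManifold.of_le two_le_infty

instance : IsManifold (𝓡 (m + 2)) (minSmoothness ℝ 3) M := IsManifold.of_le three_le_infty

/-- The Lie bracket of smooth vector fields. -/
instance : Bracket (Fields m M) (Fields m M) where
  bracket X Y := ⟨mlieBracket (𝓡 (m + 2)) X Y,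
    have : IsManifold (𝓡 (m + 2)) (((⊤ : ℕ∞) : WithTop ℕ∞) + 1) M :=
      inferInstanceAs (IsManifold (𝓡 (m + 2)) ∞ M)
    ContDiff.mlieBracket_vectorField (m := ⊤) (n := ⊤) X.contMDiff Y.contMDiff (by simp)⟩

lemma coe_bracket (X Y : Fields m M) : ⇑⁅X, Y⁆ = mlieBracket (𝓡 (m + 2)) X Y := rfl

instance : LieRing (Fields m M) where
  add_lie X Y Z := by
    ext1 x
    exact mlieBracket_add_left X.mdifferentiableAt Y.mdifferentiableAt
  lie_add X Y Z := by
    ext1 x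
    exact mlieBracket_add_right Y.mdifferentiableAt Z.mdifferentiableAt
  lie_self X := by
    ext1 x
    rw [coe_bracket, mlieBracket_self]
    rfl
  leibniz_lie X Y Z := by
    ext1 x
    exact leibniz_identity_mlieBracket_apply
      (X.contMDiff.contMDiffAt.of_le two_le_infty)
      (Y.contMDiff.contMDiffAt.of_le two_le_infty)
      (Z.contMDiff.contMDiffAt.of_le two_le_infty)

instance : LieAlgebra ℝ (Fields m M) where
  lie_smul c X Y := by
    ext1 x
    exact mlieBracket_const_smul_right Y.mdifferentiableAt

end LieAlgebraOfFields

/-! ## `G`-structures, automorphisms and infinitesimal automorphisms -/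

/-- The linear frames at `x`, as linear isomorphisms `ℝⁿ → T_x M`. -/
abbrev Frame (m : ℕ) {M : Type*} [TopologicalSpace M] [ChartedSpace (Mod m) M] (x : M) : Type :=
  Vec m ≃ₗ[ℝ] Tan m x

/-- A `G`-structure on `M`: a smooth principal subbundle with group `G` of the frame bundle, that
is, in each fibre of the frame bundle one orbit of the right action `u ↦ u ∘ a` of `G`, such that
near each point there is a smooth local section. -/
@[ext]
structure GStructure (G : Subgroup (GLVec m)) (M : Type*) [TopologicalSpace M]
    [ChartedSpace (Mod m) M] [IsManifold (𝓡 (m + 2)) ∞ M] where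
  fiber : ∀ x : M, Set (Frame m x)
  right_mem : ∀ (x : M), ∀ u ∈ fiber x, ∀ a ∈ G, a.trans u ∈ fiber x
  transitive : ∀ (x : M), ∀ u ∈ fiber x, ∀ v ∈ fiber x, ∃ a ∈ G, v = a.trans u
  exists_local_section : ∀ p : M, ∃ U : Set M, IsOpen U ∧ p ∈ U ∧
    ∃ s : ∀ x : M, Frame m x, (∀ x ∈ U, s x ∈ fiber x) ∧
      ∀ v : Vec m, SmoothFieldOn (fun x => s x v) U

/-- `φ`, restricted to the (open) set `D ⊆ ℝ × M`, is a local flow of the vector field `X`: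
`D` contains `[0, t] × {x}` whenever it contains `(t, x)`, the map `φ` is smooth on `D`,
`φ₀ = id`, and `t ↦ φ_t x` is an integral curve of `X`. -/
structure IsLocalFlow [IsManifold (𝓡 (m + 2)) ∞ M] (X : Fields m M) (D : Set (ℝ × M))
    (φ : ℝ → M → M) : Prop where
  isOpen : IsOpen D
  segment : ∀ t x, (t, x) ∈ D → ∀ s ∈ uIcc 0 t, (s, x) ∈ D
  smooth : ContMDiffOn (𝓘(ℝ, ℝ).prod (𝓡 (m + 2))) (𝓡 (m + 2)) ∞ (fun p : ℝ × M => φ p.1 p.2) D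
  zero : ∀ x, (0, x) ∈ D → φ 0 x = x
  integral : ∀ x, IsMIntegralCurveOn (fun t => φ t x) X {t | (t, x) ∈ D}

namespace GStructure

variable [IsManifold (𝓡 (m + 2)) ∞ M] {G : Subgroup (GLVec m)}

/-- The map `f` acts on frames at the points of `U` by its derivative, and maps `P` over `U`
into `P`. -/
def PreservedOn (P : GStructure G M) (f : M → M) (U : Set M) : Prop :=
  ∀ x ∈ U, ∀ u ∈ P.fiber x, ∃ v ∈ P.fiber (f x),
    ∀ z : Vec m, v z = mfderiv (𝓡 (m + 2)) (𝓡 (m + 2)) f x (u z)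

/-- `X` is an infinitesimal automorphism of `P`: the diffeomorphisms `φ_t` (between open subsets of
`M`) of each local flow of `X` preserve `P`. -/
def IsInfinitesimalAutomorphism (P : GStructure G M) (X : Fields m M) : Prop :=
  ∀ (D : Set (ℝ × M)) (φ : ℝ → M → M), IsLocalFlow X D φ →
    ∀ t : ℝ, P.PreservedOn (φ t) {x | (t, x) ∈ D}

/-- The set `aut(P)` of infinitesimal automorphisms. -/
def aut (P : GStructure G M) : Set (Fields m M) := {X | P.IsInfinitesimalAutomorphism X}

end GStructure

/-- A `GN`-structure. -/
abbrev GNStructure (m : ℕ) (M : Type*) [TopologicalSpace M] [ChartedSpace (Mod m) M]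
    [IsManifold (𝓡 (m + 2)) ∞ M] : Type _ := GStructure (GN m) M

/-- The null distribution of a `GN`-structure: at `x` it is the line `u (ℝ k)`, for any `u` in the
fibre over `x`. -/
def GNStructure.nullDistribution [IsManifold (𝓡 (m + 2)) ∞ M] (P : GNStructure m M) (x : M) :
    Submodule ℝ (Tan m x) :=
  Submodule.span ℝ {v | ∃ u ∈ P.fiber x, v = u (kvec m)}

/-! ## Lorentzian metrics -/

/-- A smooth Lorentzian metric on `M`: a smooth symmetric bilinear form on the tangent bundle, at
each point isometric to the Minkowski product `η`. -/
structure LorentzianMetric (m : ℕ) (M : Type*) [TopologicalSpace M] [ChartedSpace (Mod m) M]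
    [IsManifold (𝓡 (m + 2)) ∞ M] where
  val : ∀ x : M, TangentSpace (𝓡 (m + 2)) x →L[ℝ] TangentSpace (𝓡 (m + 2)) x →L[ℝ] ℝ
  symm : ∀ (x : M) (v w : Tan m x), val x v w = val x w v
  signature : ∀ x : M, ∃ u : Frame m x, ∀ v w : Vec m, val x (u v) (u w) = eta v w
  contMDiff : ContMDiff (𝓡 (m + 2)) ((𝓡 (m + 2)).prod 𝓘(ℝ, Mod m →L[ℝ] Mod m →L[ℝ] ℝ)) ∞
    (fun x => TotalSpace.mk' (Mod m →L[ℝ] Mod m →L[ℝ] ℝ)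
      (E := fun x : M => TangentSpace (𝓡 (m + 2)) x →L[ℝ] TangentSpace (𝓡 (m + 2)) x →L[ℝ] ℝ)
      x (val x))

/-- A (smooth) null distribution of the metric `g`: a smooth field of null lines. -/
structure NullDistribution [IsManifold (𝓡 (m + 2)) ∞ M] (g : LorentzianMetric m M) where
  line : ∀ x : M, Submodule ℝ (Tan m x)
  finrank_eq_one : ∀ x : M, Module.finrank ℝ (line x) = 1
  smooth : ∀ p : M, ∃ U : Set M, IsOpen U ∧ p ∈ U ∧
    ∃ Y : ∀ x : M, Tan m x, SmoothFieldOn Y U ∧ ∀ x ∈ U, line x = Submodule.span ℝ {Y x}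
  null : ∀ (x : M), ∀ v ∈ line x, g.val x v v = 0

namespace LorentzianMetric

variable [IsManifold (𝓡 (m + 2)) ∞ M] (g : LorentzianMetric m M)

/-- The metric `g` belongs to the `GN`-structure `P`: it is the metric determined by some
`Sim(n - 2)`-structure `Q ⊆ P`, i.e. the elements of `Q` are null frames of `g`. -/
def BelongsTo (P : GNStructure m M) : Prop :=
  ∃ Q : GStructure (Sim m) M, ∀ x : M, Q.fiber x ⊆ P.fiber x ∧
    ∀ u ∈ Q.fiber x, ∀ v w : Vec m, g.val x (u v) (u w) = eta v w

/-- The `g`-orthogonal complement of a subspace of a tangent space. -/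
def perp (x : M) (L : Submodule ℝ (Tan m x)) : Submodule ℝ (Tan m x) where
  carrier := {w | ∀ v ∈ L, g.val x v w = 0}
  add_mem' := fun {a b} ha hb v hv => by rw [map_add, ha v hv, hb v hv, add_zero]
  zero_mem' := fun v _ => map_zero _
  smul_mem' := fun c a ha v hv => by rw [map_smul, ha v hv, smul_zero]

/-- The fibre at `x` of the `GN`-structure `P(M, g, λ)`: frames `(X, Y, Z₁, …, Zₘ)` with `X ∈ λ`,
`g(X, Y) = 1`, and `Zᵢ ∈ λ^⊥` whose classes in `λ^⊥ / λ` are orthonormal. -/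
def adaptedFrames (line : ∀ x : M, Submodule ℝ (Tan m x)) (x : M) : Set (Frame m x) :=
  {u | u (kvec m) ∈ line x ∧
    g.val x (u (kvec m)) (u (Pi.single 1 1)) = 1 ∧
    (∀ i : Fin m, u (Pi.single i.succ.succ 1) ∈ g.perp x (line x)) ∧
    ∀ i j : Fin m, g.val x (u (Pi.single i.succ.succ 1)) (u (Pi.single j.succ.succ 1)) =
      if i = j then 1 else 0}

/-- `X(g(Y, Z)) - g([X, Y], Z) - g(Y, [X, Z])` at the point `x`. -/
def lieDerivAux (X : ∀ x : M, Tan m x) (x : M)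
    (Y Z : ∀ x : M, TangentSpace (𝓡 (m + 2)) x) : ℝ :=
  mvfderiv (𝓡 (m + 2)) (fun y => g.val y (Y y) (Z y)) x (X x)
    - g.val x (mlieBracket (𝓡 (m + 2)) X Y x) (Z x)
    - g.val x (Y x) (mlieBracket (𝓡 (m + 2)) X Z x)

lemma mdifferentiableAt_apply {Y Z : ∀ x : M, TangentSpace (𝓡 (m + 2)) x} {x : M}
    (hY : FieldDiffAt Y x) (hZ : FieldDiffAt Z x) :
    MDifferentiableAt (𝓡 (m + 2)) 𝓘(ℝ, ℝ) (fun y => g.val y (Y y) (Z y)) x := by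
  have : MDifferentiableAt (𝓡 (m + 2)) ((𝓡 (m + 2)).prod 𝓘(ℝ))
      (fun y => TotalSpace.mk' ℝ (E := Bundle.Trivial M ℝ) y (g.val y (Y y) (Z y))) x := by
    apply MDifferentiableAt.clm_bundle_apply₂ (F₁ := Mod m) (F₂ := Mod m)
    · exact (g.contMDiff.contMDiffAt (x := x)).mdifferentiableAt (by simp)
    · exact hY
    · exact hZ
  simp only [mdifferentiableAt_totalSpace] at this
  exact this.2

lemma tensorial_lieDerivAux_left (X : ∀ x : M, Tan m x) (x : M)
    (Z : ∀ x : M, TangentSpace (𝓡 (m + 2)) x) (hZ : FieldDiffAt Z x) :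
    TensorialAt (𝓡 (m + 2)) (Mod m) (fun Y => g.lieDerivAux X x Y Z) x where
  smul {f Y} hf hY := by
    have h1 : (fun y => g.val y ((f • Y) y) (Z y)) = f * fun y => g.val y (Y y) (Z y) := by
      ext y
      simp
    simp only [lieDerivAux]
    rw [h1, mvfderiv_mul hf (g.mdifferentiableAt_apply hY hZ), mlieBracket_smul_right hf hY]
    simp
    ring
  add {Y Y'} hY hY' := by
    have h1 : (fun y => g.val y ((Y + Y') y) (Z y)) =
        (fun y => g.val y (Y y) (Z y)) + fun y => g.val y (Y' y) (Z y) := by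
      ext y
      simp
    simp only [lieDerivAux]
    rw [h1, mvfderiv_add (g.mdifferentiableAt_apply hY hZ) (g.mdifferentiableAt_apply hY' hZ),
      mlieBracket_add_right hY hY']
    simp
    ring

lemma lieDerivAux_symm (X : ∀ x : M, Tan m x) (x : M)
    (Y Z : ∀ x : M, TangentSpace (𝓡 (m + 2)) x) :
    g.lieDerivAux X x Y Z = g.lieDerivAux X x Z Y := by
  have h1 : (fun y => g.val y (Y y) (Z y)) = fun y => g.val y (Z y) (Y y) :=
    funext fun y => g.symm _ _ _
  simp only [lieDerivAux]
  rw [h1, g.symm x (mlieBracket _ X Y x), g.symm x (Y x)]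
  ring

lemma tensorial_lieDerivAux_right (X : ∀ x : M, Tan m x) (x : M)
    (Y : ∀ x : M, TangentSpace (𝓡 (m + 2)) x) (hY : FieldDiffAt Y x) :
    TensorialAt (𝓡 (m + 2)) (Mod m) (fun Z => g.lieDerivAux X x Y Z) x := by
  simpa only [g.lieDerivAux_symm X x Y] using g.tensorial_lieDerivAux_left X x Y hY

/-- The Lie derivative `L_X g` at `x`: the bilinear form on `T_x M` with
`(L_X g)(Y, Z) = X(g(Y, Z)) - g([X, Y], Z) - g(Y, [X, Z])` for vector fields `Y`, `Z`. -/
def lieDeriv (X : ∀ x : M, Tan m x) (x : M) :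
    TangentSpace (𝓡 (m + 2)) x →L[ℝ] TangentSpace (𝓡 (m + 2)) x →L[ℝ] ℝ :=
  TensorialAt.mkHom₂ (I := 𝓡 (m + 2)) (F := Mod m) (F' := Mod m) (g.lieDerivAux X x) x
    (g.tensorial_lieDerivAux_left X x) (g.tensorial_lieDerivAux_right X x)

lemma lieDeriv_apply (X : ∀ x : M, Tan m x) (x : M)
    {Y Z : ∀ x : M, TangentSpace (𝓡 (m + 2)) x}
    (hY : FieldDiffAt Y x) (hZ : FieldDiffAt Z x) :
    g.lieDeriv X x (Y x) (Z x) = g.lieDerivAux X x Y Z :=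
  TensorialAt.mkHom₂_apply (g.tensorial_lieDerivAux_left X x) (g.tensorial_lieDerivAux_right X x)
    hY hZ

/-- A bilinear form on `T_x M` is of type III with respect to the line `L` if it has boost order
`-1`, i.e. it lies in `λ* ⊗ Λ* + Λ* ⊗ λ*`, where `λ*` is the annihilator of `Λ = L^⊥` and `Λ*` is
the annihilator of `L`. -/
def IsTypeIII (x : M) (L : Submodule ℝ (Tan m x))
    (B : TangentSpace (𝓡 (m + 2)) x →L[ℝ] TangentSpace (𝓡 (m + 2)) x →L[ℝ] ℝ) : Prop :=
  B ∈ Submodule.span ℝ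
    {T | ∃ α β : TangentSpace (𝓡 (m + 2)) x →L[ℝ] ℝ,
      (∀ w ∈ g.perp x L, α w = 0) ∧ (∀ v ∈ L, β v = 0) ∧
      (T = α.smulRight β ∨ T = β.smulRight α)}

/-- `X` is nil-Killing with respect to `(M, g, λ)`: `L_X g` is of type III with respect to `λ`. -/
def IsNilKilling (line : ∀ x : M, Submodule ℝ (Tan m x)) (X : Fields m M) : Prop :=
  ∀ x : M, g.IsTypeIII x (line x) (g.lieDeriv X x)

end LorentzianMetric

/-- `[X, λ] ⊆ λ`: the bracket of `X` with any local smooth section of `λ` is a section of `λ`. -/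
def PreservesLine [IsManifold (𝓡 (m + 2)) ∞ M] (line : ∀ x : M, Submodule ℝ (Tan m x))
    (X : Fields m M) : Prop :=
  ∀ (U : Set M) (Y : ∀ x : M, Tan m x), IsOpen U → SmoothFieldOn Y U → (∀ x ∈ U, Y x ∈ line x) →
    ∀ x ∈ U, mlieBracket (𝓡 (m + 2)) X Y x ∈ line x

/-- The set of algebra preserving nil-Killing vector fields with respect to `(M, g, λ)`. -/
def LorentzianMetric.algebraPreservingNilKilling [IsManifold (𝓡 (m + 2)) ∞ M]
    (g : LorentzianMetric m M) (line : ∀ x : M, Submodule ℝ (Tan m x)) : Set (Fields m M) :=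
  {X | g.IsNilKilling line X ∧ PreservesLine line X}

end NilKilling

end

/-! Call a frame `u` adapted to `g` and `λ` if `u k ∈ λ`, `g (u k, u z) = η (k, z)` for all `z`, and
`u` carries `η` on `k^⊥` to `g` (`IsAdapted`). The transition maps between adapted frames are
exactly the elements of `GN`. Hence a `GN`-structure to which `g` belongs consists of all adapted
frames, and an infinitesimal automorphism is a field whose flow sends adapted frames to adapted
frames. Both parts of the theorem thus reduce to `HasAdaptedFrames.isInfinitesimalAutomorphism_iff`.

Since `L_X g` is symmetric, it is of type III iff it vanishes on `λ × TM` and on `λ^⊥ × λ^⊥`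
(`isTypeIII_iff`). The link with the flow is `d/ds g(dφ_s a, dφ_s b) = (L_X g)(dφ_s a, dφ_s b)`,
together with its variant `d/ds g(Y, dφ_s b) = (L_X g)(Y, dφ_s b) + g([X, Y], dφ_s b)` for a field
`Y`.

If the flow preserves adapted frames, the relevant products are constant, and differentiating at `s
= 0` gives type III. For a section `Y` of `λ` and `w ∈ λ^⊥` the product `g(Y, dφ_s w)` is
identically zero, so `[X, Y]` is orthogonal to `λ^⊥`, that is, lies in `λ`. This direction needs a
smooth local flow through every point, obtained from the inverse function theorem in a space of
curves (`exists_smooth_local_flow`).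

Conversely, let `Y` span `λ` locally. Then `[X, Y] = μ Y`, and `s ↦ g(Y, dφ_s w)` solves a linear
homogeneous equation, so `dφ_s` preserves `λ^⊥`. Therefore `g` on `λ^⊥` is preserved. Vectors of `λ`
stay null and in `λ^⊥`, hence in `λ`, and then their products with all vectors are preserved too.

Closure under brackets comes from `L_[X,Y] g = L_X L_Y g - L_Y L_X g`, evaluated on adapted frame
fields, and from the Jacobi identity. For a given null distribution, smooth adapted frames come from
completing a local spanning field to a null frame by Gram–Schmidt (`exists_local_null_frame`). -/

noncomputable section

set_option linter.unusedSectionVars false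

namespace NilKilling

/-! ### Smooth dependence of solutions of an ODE on time and initial value. -/

section SmoothFlow

set_option synthInstance.maxHeartbeats 200000

universe u

variable {K : Type*} [TopologicalSpace K] [CompactSpace K]

/-- Pointwise application `C(K, E →L F) × C(K, E) → C(K, F)` as a continuous bilinear map. -/
def pointwiseApply (K : Type*) [TopologicalSpace K] [CompactSpace K] (E F : Type*)
    [NormedAddCommGroup E] [NormedSpace ℝ E] [NormedAddCommGroup F] [NormedSpace ℝ F] :
    C(K, E →L[ℝ] F) →L[ℝ] C(K, E) →L[ℝ] C(K, F) :=
  LinearMap.mkContinuous₂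
    (LinearMap.mk₂ ℝ (fun (A : C(K, E →L[ℝ] F)) (γ : C(K, E)) =>
      (⟨fun k => A k (γ k), by fun_prop⟩ : C(K, F)))
      (fun A B γ => by ext k; simp) (fun c A γ => by ext k; simp)
      (fun A γ δ => by ext k; simp) (fun c A γ => by ext k; simp)) 1
    (fun A γ => by
      rw [ContinuousMap.norm_le _ (by positivity)]
      intro k
      calc ‖A k (γ k)‖ ≤ ‖A k‖ * ‖γ k‖ := (A k).le_opNorm _
        _ ≤ 1 * ‖A‖ * ‖γ‖ := by
          rw [one_mul]
          gcongr
          · exact A.norm_coe_le_norm k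
          · exact γ.norm_coe_le_norm k)

/-- The range of `γ` is compact, so `f'` is uniformly continuous around it. The mean value
inequality then bounds the remainder by `ε ‖h‖` with one radius valid for all points of `K`. -/
lemma hasFDerivAt_continuousMap_comp {E F : Type*} [NormedAddCommGroup E] [NormedSpace ℝ E]
    [NormedAddCommGroup F] [NormedSpace ℝ F] (f : C(E, F)) (f' : C(E, E →L[ℝ] F))
    (hf : ∀ x, HasFDerivAt f (f' x) x) (γ : C(K, E)) :
    HasFDerivAt (fun δ : C(K, E) => f.comp δ) (pointwiseApply K E F (f'.comp γ)) γ := by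
  rw [hasFDerivAt_iff_isLittleO_nhds_zero, Asymptotics.isLittleO_iff]
  intro ε hε
  have hU := (isCompact_range γ.continuous).uniformContinuousAt_of_continuousAt f'
    (fun a _ => f'.continuous.continuousAt) (Metric.dist_mem_uniformity hε)
  obtain ⟨δ, hδ, hδU⟩ := Metric.mem_uniformity_dist.1 hU
  filter_upwards [Metric.ball_mem_nhds (0 : C(K, E)) hδ] with h hh
  rw [ContinuousMap.norm_le _ (by positivity)]
  intro k
  have hk : ‖h k‖ ≤ ‖h‖ := h.norm_coe_le_norm k
  have hhδ : ‖h‖ < δ := by simpa using hh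
  have key := (convex_ball (γ k) δ).norm_image_sub_le_of_norm_hasFDerivWithin_le'
    (f := f) (f' := f') (φ := f' (γ k)) (C := ε) (x := γ k) (y := γ k + h k)
    (fun x _ => (hf x).hasFDerivWithinAt) (fun x hx => by
      have := hδU (a := γ k) (b := x) (by rwa [dist_comm]) (mem_range_self k)
      rw [Set.mem_ofPred_eq, dist_comm, dist_eq_norm] at this
      exact this.le) (Metric.mem_ball_self hδ) (by simpa using hk.trans_lt hhδ)
  simp only [add_sub_cancel_left] at key
  exact key.trans (mul_le_mul_of_nonneg_left hk hε.le)

/-- The derivative of `γ ↦ f ∘ γ` is built linearly from `γ ↦ f' ∘ γ`, a map of the same kind with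
target `E →L[ℝ] F`. Hence the induction leaves `F` general; the common universe keeps `E →L[ℝ] F`
within its scope. -/
lemma contDiff_nat_continuousMap_comp {E : Type u} [NormedAddCommGroup E] [NormedSpace ℝ E]
    (n : ℕ) :
    ∀ {F : Type u} [NormedAddCommGroup F] [NormedSpace ℝ F] (f : C(E, F)), ContDiff ℝ n f →
      ContDiff ℝ n (fun γ : C(K, E) => f.comp γ) := by
  induction n with
  | zero =>
    intro F _ _ f _
    exact contDiff_zero.2 (ContinuousMap.continuous_postcomp f)
  | succ n ih =>
    intro F _ _ f hf
    have hf' : ContDiff ℝ n (fderiv ℝ f) := (contDiff_succ_iff_fderiv.1 (by exact_mod_cast hf)).2.2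
    have hd : Differentiable ℝ f := hf.differentiable (by simp)
    let f' : C(E, E →L[ℝ] F) := ⟨fderiv ℝ f, hf'.continuous⟩
    have := ih f' hf'
    refine (contDiff_succ_iff_hasFDerivAt (n := n)).2
      ⟨fun γ => pointwiseApply K E F (f'.comp γ), ?_, fun γ =>
        hasFDerivAt_continuousMap_comp f f' (fun x => (hd x).hasFDerivAt) γ⟩
    exact (pointwiseApply K E F).contDiff.comp this

/-- Composition with a smooth map is a smooth map between spaces of continuous functions. -/
lemma contDiff_continuousMap_comp {E F : Type u} [NormedAddCommGroup E] [NormedSpace ℝ E]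
    [NormedAddCommGroup F] [NormedSpace ℝ F] (f : C(E, F)) (hf : ContDiff ℝ ∞ f) :
    ContDiff ℝ ∞ (fun γ : C(K, E) => f.comp γ) :=
  contDiff_infty.2 fun n => contDiff_nat_continuousMap_comp n f (contDiff_infty.1 hf n)

variable {E : Type*} [NormedAddCommGroup E] [NormedSpace ℝ E]

/-- The interval `[-1, 1]`. -/
abbrev SymInterval : Type := Icc (-1 : ℝ) 1

/-- Extension of a continuous curve on `[-1, 1]` to the real line by constants. -/
def extendCurve (γ : C(SymInterval, E)) (r : ℝ) : E := γ (projIcc (-1) 1 (by norm_num) r)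

lemma continuous_extendCurve (γ : C(SymInterval, E)) : Continuous (extendCurve γ) :=
  γ.continuous.comp continuous_projIcc

lemma extendCurve_coe (γ : C(SymInterval, E)) (s : SymInterval) : extendCurve γ s = γ s := by
  simp [extendCurve]

variable [CompleteSpace E]

/-- The operator `γ ↦ ∫₀ˢ γ` on continuous curves. -/
def primitive (E : Type*) [NormedAddCommGroup E] [NormedSpace ℝ E] [CompleteSpace E] :
    C(SymInterval, E) →L[ℝ] C(SymInterval, E) :=
  LinearMap.mkContinuous
    { toFun := fun γ => ⟨fun s => ∫ r in (0 : ℝ)..s, extendCurve γ r,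
        (intervalIntegral.continuous_primitive
          (fun a b => (continuous_extendCurve γ).intervalIntegrable a b) 0).comp
            continuous_subtype_val⟩
      map_add' := fun γ δ => by
        ext s
        exact intervalIntegral.integral_add ((continuous_extendCurve γ).intervalIntegrable _ _)
          ((continuous_extendCurve δ).intervalIntegrable _ _)
      map_smul' := fun c γ => by
        ext s
        exact intervalIntegral.integral_smul c _ } 1
    (fun γ => by
      rw [ContinuousMap.norm_le _ (by positivity), one_mul]
      intro s
      have := intervalIntegral.norm_integral_le_of_norm_le_const (a := 0) (b := s)
        (f := extendCurve γ) (C := ‖γ‖) (fun r _ => γ.norm_coe_le_norm _)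
      refine this.trans (mul_le_of_le_one_right (norm_nonneg _) ?_)
      rw [sub_zero, abs_le]
      exact s.2)

/-- The map whose zeros `γ` are the solutions of `γ s = x + t ∫₀ˢ f (γ r) dr`. -/
def flowDefect (f : C(E, E)) (q : (ℝ × E) × C(SymInterval, E)) : C(SymInterval, E) :=
  q.2 - ContinuousMap.const _ q.1.2 - q.1.1 • primitive E (f.comp q.2)

/-- The map `((t, x), γ) ↦ ((t, x), γ - x - t ∫₀ f ∘ γ)`. -/
def flowMap (f : C(E, E)) (q : (ℝ × E) × C(SymInterval, E)) : (ℝ × E) × C(SymInterval, E) :=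
  (q.1, flowDefect f q)

/-- The inclusion of constant curves. -/
def constCurve (E : Type*) [NormedAddCommGroup E] [NormedSpace ℝ E] : E →L[ℝ] C(SymInterval, E) :=
  LinearMap.mkContinuous
    { toFun := fun x => ContinuousMap.const _ x
      map_add' := fun _ _ => rfl
      map_smul' := fun _ _ => rfl } 1
    (fun x => by
      rw [ContinuousMap.norm_le _ (by positivity), one_mul]
      intro s
      rfl)

lemma contDiff_flowMap {E : Type u} [NormedAddCommGroup E] [NormedSpace ℝ E] [CompleteSpace E]
    (f : C(E, E)) (hf : ContDiff ℝ ∞ f) : ContDiff ℝ ∞ (flowMap f) := by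
  refine contDiff_fst.prodMk ((contDiff_snd.sub
    ((constCurve E).contDiff.comp (contDiff_snd.comp contDiff_fst))).sub
    ((contDiff_fst.comp contDiff_fst).smul ((primitive E).contDiff.comp
      ((contDiff_continuousMap_comp f hf).comp contDiff_snd))))

/-- At `t = 0` the equation reads `γ = x`, so the derivative in `γ` is the identity and the whole
derivative is a triangular, hence invertible, operator. -/
lemma exists_hasFDerivAt_flowMap {E : Type u} [NormedAddCommGroup E] [NormedSpace ℝ E]
    [CompleteSpace E] (f : C(E, E)) (hf : ContDiff ℝ ∞ f) (x₀ : E) :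
    ∃ A : ((ℝ × E) × C(SymInterval, E)) ≃L[ℝ] ((ℝ × E) × C(SymInterval, E)),
      HasFDerivAt (flowMap f) (A : ((ℝ × E) × C(SymInterval, E)) →L[ℝ] _)
        ((0, x₀), constCurve E x₀) := by
  -- The value of this derivative is irrelevant: it enters the product rule multiplied by `t = 0`.
  have h1 : HasFDerivAt (fun q : (ℝ × E) × C(SymInterval, E) => primitive E (f.comp q.2))
      (fderiv ℝ (fun q : (ℝ × E) × C(SymInterval, E) => primitive E (f.comp q.2))
        ((0, x₀), constCurve E x₀)) ((0, x₀), constCurve E x₀) :=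
    ((((primitive E).contDiff.comp ((contDiff_continuousMap_comp f hf).comp
      contDiff_snd)).differentiable (by simp)) _).hasFDerivAt
  have h2 : HasFDerivAt (fun q : (ℝ × E) × C(SymInterval, E) => q.1.1)
      ((ContinuousLinearMap.fst ℝ ℝ E).comp (ContinuousLinearMap.fst ℝ _ _))
      ((0, x₀), constCurve E x₀) :=
    ((ContinuousLinearMap.fst ℝ ℝ E).comp (ContinuousLinearMap.fst ℝ (ℝ × E)
      C(SymInterval, E))).hasFDerivAt
  have h3 : HasFDerivAt (fun q : (ℝ × E) × C(SymInterval, E) => constCurve E q.1.2)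
      ((constCurve E).comp ((ContinuousLinearMap.snd ℝ ℝ E).comp (ContinuousLinearMap.fst ℝ _ _)))
      ((0, x₀), constCurve E x₀) :=
    ((constCurve E).comp ((ContinuousLinearMap.snd ℝ ℝ E).comp (ContinuousLinearMap.fst ℝ (ℝ × E)
      C(SymInterval, E)))).hasFDerivAt
  refine ⟨(ContinuousLinearEquiv.refl ℝ (ℝ × E)).skewProd
    (ContinuousLinearEquiv.refl ℝ C(SymInterval, E))
    (-((constCurve E).comp (ContinuousLinearMap.snd ℝ ℝ E)) -
      (ContinuousLinearMap.fst ℝ ℝ E).smulRight (primitive E (f.comp (constCurve E x₀)))), ?_⟩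
  have := hasFDerivAt_fst.prodMk (((hasFDerivAt_snd (𝕜 := ℝ)).sub h3).sub (h2.smul h1))
  refine this.congr_fderiv ?_
  refine ContinuousLinearMap.ext fun q => Prod.ext rfl ?_
  simp [ContinuousLinearEquiv.skewProd]
  abel

lemma flowDefect_eq_zero_iff (f : C(E, E)) (t : ℝ) (x : E) (γ : C(SymInterval, E)) :
    flowDefect f ((t, x), γ) = 0 ↔
      ∀ s : SymInterval, γ s = x + t • ∫ r in (0 : ℝ)..s, f (extendCurve γ r) := by
  have h : ∀ s, flowDefect f ((t, x), γ) s =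
      γ s - x - t • ∫ r in (0 : ℝ)..s, f (extendCurve γ r) := fun _ => rfl
  rw [ContinuousMap.ext_iff]
  refine forall_congr' fun s => ?_
  rw [h, ContinuousMap.zero_apply, sub_sub, sub_eq_zero]

/-- The curve `s ↦ γ (σ s)`. -/
def rescale (σ : SymInterval) (γ : C(SymInterval, E)) : C(SymInterval, E) :=
  γ.comp ⟨fun s => ⟨σ * s, abs_le.1 (by
    rw [abs_mul]; exact mul_le_one₀ (abs_le.2 σ.2) (abs_nonneg _) (abs_le.2 s.2))⟩, by fun_prop⟩

/-- Substituting `r ↦ σ r` in the integral trades a shorter time `σ t` for a slower parametrization.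
With uniqueness this recovers the dependence on `t` from that on the curve parameter. -/
lemma flowDefect_rescale (f : C(E, E)) {t : ℝ} {x : E} {γ : C(SymInterval, E)}
    (h : flowDefect f ((t, x), γ) = 0) (σ : SymInterval) :
    flowDefect f ((σ * t, x), rescale σ γ) = 0 := by
  rw [flowDefect_eq_zero_iff] at h ⊢
  intro s
  have h1 : rescale σ γ s = x + t • ∫ r in (0 : ℝ)..σ * s, f (extendCurve γ r) := h ⟨σ * s, _⟩
  rw [h1, mul_comm (σ : ℝ) t, mul_smul]
  congr 2
  have h2 := intervalIntegral.smul_integral_comp_mul_left (a := 0) (b := (s : ℝ))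
    (fun r => f (extendCurve γ r)) (σ : ℝ)
  rw [mul_zero] at h2
  rw [← h2]
  congr 1
  refine intervalIntegral.integral_congr fun r hr => ?_
  have hr' : r ∈ Icc (-1 : ℝ) 1 := by
    refine (uIcc_subset_Icc ?_ s.2) hr
    norm_num
  have h3 : extendCurve (rescale σ γ) r = extendCurve γ (σ * r) := by
    have e1 := extendCurve_coe (rescale σ γ) ⟨r, hr'⟩
    have e2 := extendCurve_coe γ ⟨σ * r, abs_le.1 (by
      rw [abs_mul]; exact mul_le_one₀ (abs_le.2 σ.2) (abs_nonneg _) (abs_le.2 hr'))⟩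
    simp only at e1 e2
    rw [e1, e2]
    rfl
  simp only [h3]

/-- A smooth vector field on a Banach space has a smooth local flow near each point. -/
theorem exists_smooth_local_flow {E : Type u} [NormedAddCommGroup E] [NormedSpace ℝ E]
    [CompleteSpace E] (f : E → E) (hf : ContDiff ℝ ∞ f) (x₀ : E) :
    ∃ ε > 0, ∃ Φ : ℝ × E → E, ContDiffOn ℝ ∞ Φ (Ioo (-ε) ε ×ˢ Metric.ball x₀ ε) ∧
      (∀ x, x ∈ Metric.ball x₀ ε → Φ (0, x) = x) ∧
      ∀ t ∈ Ioo (-ε) ε, ∀ x ∈ Metric.ball x₀ ε,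
        HasDerivAt (fun τ => Φ (τ, x)) (f (Φ (t, x))) t := by
  let F : C(E, E) := ⟨f, hf.continuous⟩
  have hF : ContDiff ℝ ∞ (flowMap F) := contDiff_flowMap F hf
  obtain ⟨A, hA⟩ := exists_hasFDerivAt_flowMap F hf x₀
  set u₀ : (ℝ × E) × C(SymInterval, E) := ((0, x₀), constCurve E x₀) with hu₀
  -- Solving `flowMap F q = (p, 0)` through this local inverse gives the solution curve as a
  -- function of `p = (t, x)`.
  let e := hF.contDiffAt.toOpenPartialHomeomorph (flowMap F) hA (by simp)
  have he : ∀ q, e q = flowMap F q := fun q => rfl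
  have hsrc : u₀ ∈ e.source := hF.contDiffAt.mem_toOpenPartialHomeomorph_source hA (by simp)
  have hval : e u₀ = ((0, x₀), 0) := by
    rw [he]
    refine Prod.ext rfl ?_
    simp only [flowMap, hu₀, flowDefect, zero_smul, sub_zero]
    exact sub_self _
  have htgt : ((0, x₀), 0) ∈ e.target := hval ▸ e.map_source hsrc
  have hsymm : e.symm ((0, x₀), 0) = u₀ := by rw [← hval, e.left_inv hsrc]
  let G : ℝ × E → C(SymInterval, E) := fun p => (e.symm (p, 0)).2
  have hcont : ContinuousAt (fun p : ℝ × E => e.symm (p, 0)) (0, x₀) :=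
    ContinuousAt.comp (f := fun p : ℝ × E => (p, (0 : C(SymInterval, E))))
      (e.continuousAt_symm htgt)
      (by fun_prop)
  -- Invertibility of the derivative is an open condition; it makes the local inverse smooth on a
  -- whole neighbourhood and not merely at the centre.
  have hinv : ∀ᶠ p in 𝓝 ((0 : ℝ), x₀), fderiv ℝ (flowMap F) (e.symm (p, 0)) ∈
      range ((↑) : (((ℝ × E) × C(SymInterval, E)) ≃L[ℝ] ((ℝ × E) × C(SymInterval, E))) → _) := by
    have h1 : ContinuousAt (fun p : ℝ × E => fderiv ℝ (flowMap F) (e.symm (p, 0))) (0, x₀) :=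
      ContinuousAt.comp (f := fun p : ℝ × E => e.symm (p, 0))
        (hF.continuous_fderiv (by simp)).continuousAt hcont
    apply h1.eventually_mem
    rw [hsymm, hA.fderiv]
    exact A.nhds
  have hmem : ∀ᶠ p in 𝓝 ((0 : ℝ), x₀), (p, (0 : C(SymInterval, E))) ∈ e.target := by
    have : ContinuousAt (fun p : ℝ × E => (p, (0 : C(SymInterval, E)))) (0, x₀) := by fun_prop
    exact this.eventually_mem (e.open_target.mem_nhds htgt)
  obtain ⟨r, hr, hrs⟩ := Metric.mem_nhds_iff.1 (e.open_source.mem_nhds hsrc)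
  have hclose : ∀ᶠ p in 𝓝 ((0 : ℝ), x₀), G p ∈ Metric.ball (constCurve E x₀) r := by
    have h1 : ContinuousAt G (0, x₀) := continuous_snd.continuousAt.comp hcont
    apply h1.eventually_mem
    have : G (0, x₀) = constCurve E x₀ := by simp only [G, hsymm, hu₀]
    rw [this]
    exact Metric.ball_mem_nhds _ hr
  obtain ⟨ε, hε, hεs⟩ := Metric.mem_nhds_iff.1
    ((hinv.and (hmem.and hclose)).and (Metric.ball_mem_nhds _ hr))
  have hbox : ∀ t ∈ Ioo (-ε) ε, ∀ x ∈ Metric.ball x₀ ε, (t, x) ∈ Metric.ball ((0 : ℝ), x₀) ε := by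
    intro t ht x hx
    rw [← ball_prod_same]
    exact ⟨by simpa [abs_lt] using ht, hx⟩
  have hzero : ∀ t ∈ Ioo (-ε) ε, ∀ x ∈ Metric.ball x₀ ε, flowDefect F ((t, x), G (t, x)) = 0 := by
    intro t ht x hx
    have h1 := (hεs (hbox t ht x hx)).1.2.1
    have h2 : flowMap F (e.symm ((t, x), 0)) = ((t, x), 0) := e.right_inv h1
    have h3 : (e.symm ((t, x), 0)).1 = (t, x) := congrArg Prod.fst h2
    have h4 : flowDefect F (e.symm ((t, x), 0)) = 0 := congrArg Prod.snd h2
    rwa [show e.symm ((t, x), 0) = ((t, x), G (t, x)) from Prod.ext h3 rfl] at h4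
  -- Uniqueness comes from injectivity of `e` on its source: both curves solve the equation for `(σ
  -- t, x)`, and the rescaled one stays in the source because rescaling does not increase the sup
  -- distance to a constant curve.
  have hscale : ∀ t ∈ Ioo (-ε) ε, ∀ x ∈ Metric.ball x₀ ε, ∀ σ : SymInterval,
      G (σ * t, x) = rescale σ (G (t, x)) := by
    intro t ht x hx σ
    have hσt : σ * t ∈ Ioo (-ε) ε := by
      rw [mem_Ioo, ← abs_lt] at ht ⊢
      rw [abs_mul]
      exact (mul_le_of_le_one_left (abs_nonneg _) (abs_le.2 σ.2)).trans_lt ht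
    have hb := hbox _ hσt x hx
    have h1 := (hεs hb).1.2.1
    have hc := (hεs (hbox t ht x hx)).1.2.2
    have h2 : ((σ * t, x), rescale σ (G (t, x))) ∈ e.source := by
      apply hrs
      rw [hu₀, ← ball_prod_same]
      refine ⟨(hεs hb).2, ?_⟩
      rw [Metric.mem_ball, dist_eq_norm, ContinuousMap.norm_lt_iff _ hr] at hc ⊢
      exact fun s => hc _
    have h3 : e ((σ * t, x), rescale σ (G (t, x))) = ((σ * t, x), 0) :=
      Prod.ext rfl (flowDefect_rescale F (hzero t ht x hx) σ)
    have h4 := e.left_inv h2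
    rw [h3] at h4
    exact congrArg Prod.snd h4
  have hone : (1 : ℝ) ∈ Icc (-1 : ℝ) 1 := by norm_num
  have hGs : ∀ t ∈ Ioo (-ε) ε, ∀ x ∈ Metric.ball x₀ ε, ∀ σ : SymInterval,
      G (σ * t, x) ⟨1, hone⟩ = G (t, x) σ := by
    intro t ht x hx σ
    rw [hscale t ht x hx σ]
    simp [rescale]
  refine ⟨ε, hε, fun p => G p ⟨1, hone⟩, ?_, ?_, ?_⟩
  · rintro ⟨t, x⟩ ⟨ht, hx⟩
    have h := (hεs (hbox t ht x hx)).1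
    obtain ⟨B, hB⟩ := h.1
    have h1 : ContDiffAt ℝ ∞ e.symm ((t, x), 0) := by
      refine e.contDiffAt_symm (f₀' := B) h.2.1 ?_ hF.contDiffAt
      rw [hB]
      exact (hF.differentiable (by simp) _).hasFDerivAt
    have h2 : ContDiffAt ℝ ∞ (fun p : ℝ × E => e.symm (p, 0)) (t, x) :=
      ContDiffAt.comp (f := fun p : ℝ × E => (p, (0 : C(SymInterval, E)))) _ h1
        (contDiffAt_id.prodMk contDiffAt_const)
    exact ((ContinuousMap.evalCLM ℝ (⟨1, hone⟩ : SymInterval)).contDiff.contDiffAt.comp _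
      (contDiff_snd.contDiffAt.comp _ h2)).contDiffWithinAt
  · intro x hx
    have := (flowDefect_eq_zero_iff F 0 x _).1 (hzero 0 (by simpa using hε) x hx) ⟨1, hone⟩
    simpa using this
  · intro t ht x hx
    -- With `t₁` strictly beyond `|t|`, all times `τ` near `t`, of either sign, are read off the
    -- single curve `G (t₁, x)` at parameter `τ / t₁`; the fundamental theorem of calculus then
    -- applies.
    obtain ⟨t₁, htt, ht₁⟩ := exists_between (abs_lt.2 ht)
    have ht₀ : 0 < t₁ := (abs_nonneg t).trans_lt htt
    have ht₁' : t₁ ∈ Ioo (-ε) ε := ⟨by linarith, ht₁⟩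
    have hbd : ∀ τ, |τ| < t₁ → τ / t₁ ∈ Icc (-1 : ℝ) 1 := fun τ hτ => by
      rw [mem_Icc, ← abs_le, abs_div, abs_of_pos ht₀, div_le_one ht₀]
      exact hτ.le
    have hev : ∀ τ (hτ : |τ| < t₁), G (τ, x) ⟨1, hone⟩ = G (t₁, x) ⟨τ / t₁, hbd τ hτ⟩ := by
      intro τ hτ
      have := hGs t₁ ht₁' x hx ⟨τ / t₁, hbd τ hτ⟩
      simpa [div_mul_cancel₀ _ ht₀.ne'] using this
    have hint := (flowDefect_eq_zero_iff F t₁ x _).1 (hzero t₁ ht₁' x hx)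
    have hcongr : (fun τ => G (τ, x) ⟨1, hone⟩) =ᶠ[𝓝 t] fun τ =>
        x + t₁ • ∫ r in (0 : ℝ)..τ / t₁, F (extendCurve (G (t₁, x)) r) := by
      have : ∀ᶠ τ in 𝓝 t, |τ| < t₁ := continuous_abs.continuousAt.eventually_lt
        continuousAt_const htt
      filter_upwards [this] with τ hτ
      rw [hev τ hτ, hint]
    have hc : Continuous fun r => F (extendCurve (G (t₁, x)) r) :=
      F.continuous.comp (continuous_extendCurve _)
    have hd := intervalIntegral.integral_hasDerivAt_right (hc.intervalIntegrable 0 (t / t₁))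
      (hc.stronglyMeasurableAtFilter _ _) hc.continuousAt
    have hd2 := ((HasDerivAt.scomp t hd ((hasDerivAt_id t).div_const t₁)).const_smul t₁).const_add x
    refine (hd2.congr_deriv ?_).congr_of_eventuallyEq hcongr
    rw [smul_smul, mul_one_div_cancel ht₀.ne', one_smul]
    change _ = F (G (t, x) ⟨1, hone⟩)
    rw [hev t htt]
    have := extendCurve_coe (G (t₁, x)) ⟨t / t₁, hbd t htt⟩
    simp only at this
    rw [this]

end SmoothFlow

/-! ### Linear algebra of Minkowski space in the null basis. -/

section Minkowski

variable {m : ℕ}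

/-- The null vector `l`. -/
def lvec (m : ℕ) : Vec m := Pi.single 1 1

/-- The spacelike basis vectors. -/
def mvec {m : ℕ} (i : Fin m) : Vec m := Pi.single i.succ.succ 1

lemma eta_comm (v w : Vec m) : eta v w = eta w v := by
  simp only [eta, mul_comm]
  ring

lemma eta_add_left (v v' w : Vec m) : eta (v + v') w = eta v w + eta v' w := by
  simp only [eta, Pi.add_apply, add_mul, Finset.sum_add_distrib]
  ring

lemma eta_add_right (v w w' : Vec m) : eta v (w + w') = eta v w + eta v w' := by
  rw [eta_comm, eta_add_left, eta_comm w, eta_comm w']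

lemma eta_smul_right (c : ℝ) (v w : Vec m) : eta v (c • w) = c * eta v w := by
  rw [eta_comm, eta_smul_left, eta_comm]

lemma eta_sub_left (v v' w : Vec m) : eta (v - v') w = eta v w - eta v' w := by
  rw [sub_eq_add_neg, ← neg_one_smul ℝ v', eta_add_left, eta_smul_left]
  ring

lemma eta_sub_right (v w w' : Vec m) : eta v (w - w') = eta v w - eta v w' := by
  rw [eta_comm, eta_sub_left, eta_comm w, eta_comm w']

lemma kvec_one : kvec m 1 = 0 := by simp [kvec]

lemma eta_kvec_left (w : Vec m) : eta (kvec m) w = w 1 := by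
  simp [eta, kvec]

lemma eta_lvec_left (w : Vec m) : eta (lvec m) w = w 0 := by
  have h : ∀ i : Fin m, lvec m i.succ.succ = 0 := fun i => by simp [lvec, Fin.ext_iff]
  simp only [eta, h]
  simp [lvec]

lemma eta_mvec_left (i : Fin m) (w : Vec m) : eta (mvec i) w = w i.succ.succ := by
  have h0 : mvec i (0 : Fin (m + 2)) = 0 := by
    simp [mvec, Fin.ext_iff]
  have h1 : mvec i (1 : Fin (m + 2)) = 0 := by
    simp [mvec, Fin.ext_iff]
  simp only [eta, h0, h1, zero_mul, zero_add]
  simp [mvec, Pi.single_apply]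

lemma vec_decomposition (w : Vec m) :
    w = w 0 • kvec m + w 1 • lvec m + ∑ i : Fin m, w i.succ.succ • mvec i := by
  conv_lhs => rw [pi_eq_sum_univ' w]
  rw [Fin.sum_univ_succ, Fin.sum_univ_succ, ← add_assoc]
  congr 1

lemma eta_nondegenerate {v : Vec m} (h : ∀ w, eta v w = 0) : v = 0 := by
  rw [vec_decomposition v]
  have h0 := h (lvec m)
  have h1 := h (kvec m)
  rw [eta_comm, eta_lvec_left] at h0
  rw [eta_comm, eta_kvec_left] at h1
  have h2 : ∀ i : Fin m, v i.succ.succ = 0 := fun i => by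
    have := h (mvec i)
    rwa [eta_comm, eta_mvec_left] at this
  simp [h0, h1, h2]

/-- A null vector orthogonal to `k` is a multiple of `k`. -/
lemma eq_smul_kvec_of_null {v : Vec m} (h1 : eta (kvec m) v = 0) (h : eta v v = 0) :
    v = v 0 • kvec m := by
  rw [eta_kvec_left] at h1
  have h2 : ∑ i : Fin m, v i.succ.succ * v i.succ.succ = 0 := by
    simpa [eta, h1] using h
  rw [Finset.sum_eq_zero_iff_of_nonneg fun i _ => mul_self_nonneg _] at h2
  have h3 : ∀ i : Fin m, v i.succ.succ = 0 := fun i => mul_self_eq_zero.1 (h2 i (Finset.mem_univ i))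
  conv_lhs => rw [vec_decomposition v]
  simp [h1, h3]

lemma eq_smul_kvec_of_orthogonal {v : Vec m} (h1 : eta (kvec m) v = 0)
    (h : ∀ w, eta (kvec m) w = 0 → eta v w = 0) : v = v 0 • kvec m :=
  eq_smul_kvec_of_null h1 (h v h1)

/-- A linear endomorphism preserving `η` is an automorphism. -/
lemma exists_glVec_of_isometry (f : Vec m →ₗ[ℝ] Vec m) (hf : ∀ v w, eta (f v) (f w) = eta v w) :
    ∃ a : GLVec m, ∀ v, a v = f v := by
  have hinj : Function.Injective f := by
    rw [← LinearMap.ker_eq_bot, LinearMap.ker_eq_bot']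
    intro v hv
    refine eta_nondegenerate fun w => ?_
    rw [← hf, hv]
    simp [eta]
  exact ⟨LinearEquiv.ofInjectiveEndo f hinj, fun v => rfl⟩

/-- The isometries of Minkowski space act transitively on the nonzero null vectors. -/
lemma exists_isometry_map_kvec {y : Vec m} (hy : y ≠ 0) (hnull : eta y y = 0) :
    ∃ a : GLVec m, (∀ v w, eta (a v) (a w) = eta v w) ∧ a (kvec m) = y := by
  by_cases h : eta (kvec m) y = 0
  · have hyk := eq_smul_kvec_of_null h hnull
    set c := y 0 with hc
    have hc0 : c ≠ 0 := by
      rintro h0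
      rw [h0, zero_smul] at hyk
      exact hy hyk
    -- The boost that multiplies `k` by `c` and `l` by `c⁻¹` and fixes the spacelike basis vectors.
    let f : Vec m →ₗ[ℝ] Vec m :=
      { toFun := fun v => v + ((c - 1) * v 0) • kvec m + ((c⁻¹ - 1) * v 1) • lvec m
        map_add' := fun v w => by
          simp only [Pi.add_apply, mul_add, add_smul]
          abel
        map_smul' := fun r v => by
          simp only [Pi.smul_apply, smul_eq_mul, RingHom.id_apply, smul_add, smul_smul]
          ring_nf }
    have hf : ∀ v w, eta (f v) (f w) = eta v w := fun v w => by
      have e : ∀ v, f v = v + ((c - 1) * v 0) • kvec m + ((c⁻¹ - 1) * v 1) • lvec m := fun _ => rfl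
      simp only [e, eta_add_left, eta_add_right, eta_smul_left, eta_smul_right, eta_kvec_left,
        eta_lvec_left, eta_comm v (kvec m), eta_comm v (lvec m), kvec_one]
      simp only [lvec, kvec, Pi.single_eq_same]
      have h01 : (Pi.single 1 1 : Vec m) 0 = 0 := by simp
      rw [h01]
      field_simp
      ring
    obtain ⟨a, ha⟩ := exists_glVec_of_isometry f hf
    refine ⟨a, fun v w => by rw [ha, ha, hf], ?_⟩
    rw [ha, hyk]
    change kvec m + ((c - 1) * kvec m 0) • kvec m + ((c⁻¹ - 1) * kvec m 1) • lvec m = c • kvec m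
    rw [kvec_one]
    simp [kvec, sub_smul]
  -- The reflection in the hyperplane orthogonal to `k - y` exchanges `k` and `y`; it exists because
  -- `η (b, b) = -2 η (k, y)` is nonzero.
  · set b := kvec m - y with hb
    have hbb : eta b b = -2 * eta (kvec m) y := by
      simp only [hb, eta_sub_left, eta_sub_right, hnull, eta_comm y]
      rw [eta_kvec_left, kvec_one]
      ring
    have hbb0 : eta b b ≠ 0 := by
      rw [hbb]
      simpa using h
    let f : Vec m →ₗ[ℝ] Vec m :=
      { toFun := fun v => v - (2 * eta v b / eta b b) • b
        map_add' := fun v w => by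
          rw [eta_add_left, mul_add, add_div, add_smul]
          abel
        map_smul' := fun r v => by
          rw [eta_smul_left, RingHom.id_apply, smul_sub r v, smul_smul r,
            mul_left_comm, mul_div_assoc] }
    have hf : ∀ v w, eta (f v) (f w) = eta v w := fun v w => by
      have e : ∀ v, f v = v - (2 * eta v b / eta b b) • b := fun _ => rfl
      simp only [e, eta_sub_left, eta_sub_right, eta_smul_left, eta_smul_right, eta_comm b w]
      field_simp
      ring
    obtain ⟨a, ha⟩ := exists_glVec_of_isometry f hf
    refine ⟨a, fun v w => by rw [ha, ha, hf], ?_⟩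
    rw [ha]
    change kvec m - (2 * eta (kvec m) b / eta b b) • b = y
    have h1 : eta (kvec m) b = - eta (kvec m) y := by
      rw [hb, eta_sub_right, eta_kvec_left (kvec m), kvec_one, zero_sub]
    rw [h1, hbb, show 2 * -eta (kvec m) y / (-2 * eta (kvec m) y) = 1 by field_simp, one_smul, hb,
      sub_sub_cancel]

end Minkowski

/-! ### Adapted frames at a point and the type III condition. -/

section Adapted

variable {m : ℕ} {M : Type*} [TopologicalSpace M] [ChartedSpace (Mod m) M]
  [IsManifold (𝓡 (m + 2)) ∞ M] (g : LorentzianMetric m M)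

lemma finrank_tan (x : M) : Module.finrank ℝ (Tan m x) = m + 2 := by
  have : Module.finrank ℝ (Mod m) = m + 2 := by simp
  exact this

instance (x : M) : FiniteDimensional ℝ (Tan m x) :=
  inferInstanceAs (FiniteDimensional ℝ (Mod m))

/-- A map `ℝⁿ → T_x M` with the defining properties of the elements of the `GN`-structure
associated with the metric `g` and a field of lines. -/
structure IsAdapted (line : ∀ x : M, Submodule ℝ (Tan m x)) (x : M) (S : Vec m → Tan m x) :
    Prop where
  mem : S (kvec m) ∈ line x
  kvec_left : ∀ z, g.val x (S (kvec m)) (S z) = eta (kvec m) z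
  perp : ∀ w w', eta (kvec m) w = 0 → eta (kvec m) w' = 0 → g.val x (S w) (S w') = eta w w'

variable {g} {line : ∀ x : M, Submodule ℝ (Tan m x)} {x : M}

lemma IsAdapted.of_isometry {S : Vec m → Tan m x} (h : S (kvec m) ∈ line x)
    (h' : ∀ v w, g.val x (S v) (S w) = eta v w) : IsAdapted g line x S :=
  ⟨h, fun _ => h' _ _, fun _ _ _ _ => h' _ _⟩

/-- A vector of the kernel is orthogonal to `k`, then to all of `k^⊥`, so it is a multiple of `k`;
pairing with the image of `l` shows that the factor is zero. -/
lemma IsAdapted.injective {S : Vec m →ₗ[ℝ] Tan m x} (h : IsAdapted g line x S) :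
    Function.Injective S := by
  rw [← LinearMap.ker_eq_bot, LinearMap.ker_eq_bot']
  intro v hv
  have h1 : eta (kvec m) v = 0 := by rw [← h.kvec_left, hv, map_zero]
  have h2 : v = v 0 • kvec m := eq_smul_kvec_of_orthogonal h1 fun w hw => by
    rw [← h.perp v w h1 hw, hv, map_zero]
    rfl
  have h3 : v 0 = 0 := by
    have h4 := h.kvec_left (lvec m)
    rw [eta_kvec_left] at h4
    have h5 : v 0 * g.val x (S (kvec m)) (S (lvec m)) = 0 := by
      have : g.val x (S v) (S (lvec m)) = 0 := by rw [hv, map_zero]; rfl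
      rw [h2, map_smul, map_smul] at this
      simpa using this
    rw [h4] at h5
    simpa [lvec] using h5
  rw [h2, h3, zero_smul]

/-- An adapted linear map is a linear frame. -/
lemma IsAdapted.exists_frame {S : Vec m →ₗ[ℝ] Tan m x} (h : IsAdapted g line x S) :
    ∃ u : Frame m x, ∀ z, u z = S z := by
  have e : Module.finrank ℝ (Vec m) = Module.finrank ℝ (Tan m x) := by
    rw [finrank_tan]; simp
  exact ⟨LinearEquiv.ofInjectiveOfFinrankEq S h.injective e, fun _ => rfl⟩

lemma line_eq_span (hline : Module.finrank ℝ (line x) = 1) {y : Tan m x} (hy : y ∈ line x)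
    (hy0 : y ≠ 0) : line x = Submodule.span ℝ {y} := by
  symm
  apply Submodule.eq_of_le_of_finrank_eq
  · rwa [Submodule.span_singleton_le_iff_mem]
  · rw [hline, finrank_span_singleton hy0]

lemma frame_kvec_ne_zero (u : Frame m x) : u (kvec m) ≠ 0 := fun h =>
  kvec_ne_zero m ((map_eq_zero_iff u u.injective).1 h)

lemma IsAdapted.line_eq {u : Frame m x} (h : IsAdapted g line x u)
    (hline : Module.finrank ℝ (line x) = 1) : line x = Submodule.span ℝ {u (kvec m)} :=
  line_eq_span hline h.mem (frame_kvec_ne_zero u)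

lemma mem_perp_span_iff {y w : Tan m x} :
    w ∈ g.perp x (Submodule.span ℝ {y}) ↔ g.val x y w = 0 := by
  constructor
  · intro h
    exact h y (Submodule.mem_span_singleton_self y)
  · intro h v hv
    obtain ⟨c, rfl⟩ := Submodule.mem_span_singleton.1 hv
    rw [map_smul]
    simp [h]

lemma IsAdapted.mem_perp_iff {u : Frame m x} (h : IsAdapted g line x u)
    (hline : Module.finrank ℝ (line x) = 1) (z : Vec m) :
    u z ∈ g.perp x (line x) ↔ eta (kvec m) z = 0 := by
  rw [h.line_eq hline, mem_perp_span_iff, h.kvec_left]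

/-- A null vector orthogonal to the null line lies on the line. -/
lemma IsAdapted.mem_line_of_null {u : Frame m x} (h : IsAdapted g line x u)
    (hline : Module.finrank ℝ (line x) = 1) {w : Tan m x} (hw : w ∈ g.perp x (line x))
    (hnull : g.val x w w = 0) : w ∈ line x := by
  obtain ⟨z, rfl⟩ := u.surjective w
  rw [h.mem_perp_iff hline] at hw
  rw [h.perp z z hw hw] at hnull
  rw [eq_smul_kvec_of_null hw hnull, map_smul]
  exact Submodule.smul_mem _ _ h.mem

lemma IsAdapted.trans {u : Frame m x} (h : IsAdapted g line x u) {a : GLVec m} (ha : a ∈ GN m) :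
    IsAdapted g line x (a.trans u : Frame m x) := by
  obtain ⟨⟨c, hc⟩, h2, h3⟩ := ha
  have key : ∀ z, g.val x (u (a (kvec m))) (u (a z)) = eta (kvec m) z := fun z => by
    rw [hc, map_smul, map_smul, ← h3, hc, eta_smul_left, ← h.kvec_left]
    rfl
  have hperp : ∀ w, eta (kvec m) w = 0 → eta (kvec m) (a w) = 0 := fun w hw => by
    have := h3 w
    rw [hc, eta_smul_left, hw] at this
    exact (mul_eq_zero.1 this).resolve_left (ne_zero_of_map_kvec hc)
  refine ⟨?_, key, fun w w' hw hw' => ?_⟩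
  · change u (a (kvec m)) ∈ line x
    rw [hc, map_smul]
    exact Submodule.smul_mem _ _ h.mem
  · change g.val x (u (a w)) (u (a w')) = _
    rw [h.perp _ _ (hperp w hw) (hperp w' hw'), h2 w w' hw hw']

/-- Both frames pull `g` back to the same data, namely the products with `k` and the form on `k^⊥`.
The transition map therefore preserves exactly what `GN` is required to preserve; the products of
`l` with `l` and with the spacelike vectors stay free. -/
lemma IsAdapted.transitive {u v : Frame m x} (hu : IsAdapted g line x u)
    (hv : IsAdapted g line x v) (hline : Module.finrank ℝ (line x) = 1) :
    ∃ a ∈ GN m, v = a.trans u := by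
  have happ : ∀ z, u ((v.trans u.symm) z) = v z := fun z => u.apply_symm_apply _
  obtain ⟨c, hc⟩ : ∃ c : ℝ, (v.trans u.symm) (kvec m) = c • kvec m := by
    have := hv.mem
    rw [hu.line_eq hline] at this
    obtain ⟨c, hc⟩ := Submodule.mem_span_singleton.1 this
    refine ⟨c, u.injective ?_⟩
    rw [happ, map_smul, hc]
  have hk : ∀ z, eta ((v.trans u.symm) (kvec m)) ((v.trans u.symm) z) = eta (kvec m) z := by
    intro z
    rw [hc, eta_smul_left, ← hu.kvec_left, happ, ← hv.kvec_left, ← happ (kvec m), hc, map_smul,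
      map_smul]
    rfl
  have hperp : ∀ w, eta (kvec m) w = 0 → eta (kvec m) ((v.trans u.symm) w) = 0 := fun w hw => by
    have := hk w
    rw [hc, eta_smul_left, hw] at this
    exact (mul_eq_zero.1 this).resolve_left (ne_zero_of_map_kvec hc)
  refine ⟨v.trans u.symm, ⟨⟨c, hc⟩, fun w w' hw hw' => ?_, hk⟩, ?_⟩
  · rw [← hu.perp _ _ (hperp w hw) (hperp w' hw'), happ, happ, hv.perp w w' hw hw']
  · ext1 z
    exact (happ z).symm

/-- Expansion in the basis; the one product absent from the list of frame conditions, `g (u k, u k)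
= 0`, comes from nullity of the line. -/
lemma mem_adaptedFrames_iff (hline : Module.finrank ℝ (line x) = 1)
    (hnull : ∀ v ∈ line x, g.val x v v = 0) (u : Frame m x) :
    u ∈ g.adaptedFrames line x ↔ IsAdapted g line x u := by
  constructor
  · rintro ⟨h1, h2, h3, h4⟩
    have hkk := hnull _ h1
    change g.val x (u (kvec m)) (u (lvec m)) = 1 at h2
    have h3' : ∀ i : Fin m, g.val x (u (kvec m)) (u (mvec i)) = 0 := fun i => h3 i _ h1
    have h4' : ∀ i j : Fin m, g.val x (u (mvec i)) (u (mvec j)) = if i = j then 1 else 0 := h4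
    have h5 : ∀ z, g.val x (u (kvec m)) (u z) = eta (kvec m) z := fun z => by
      rw [eta_kvec_left]
      conv_lhs => rw [vec_decomposition z]
      simp [map_add, map_smul, map_sum, hkk, h2, h3']
    refine ⟨h1, h5, fun w w' hw hw' => ?_⟩
    rw [eta_kvec_left] at hw hw'
    have h6 : ∀ i, g.val x (u (mvec i)) (u (kvec m)) = 0 := fun i => by rw [g.symm, h3']
    conv_lhs => rw [vec_decomposition w, vec_decomposition w']
    simp [map_add, map_smul, map_sum, hkk, h3', h4', h6, hw, hw', eta, mul_comm]
  · intro h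
    refine ⟨h.mem, ?_, fun i => ?_, fun i j => ?_⟩
    · rw [h.kvec_left, eta_kvec_left]
      simp
    · refine (h.mem_perp_iff hline (mvec i)).2 ?_
      rw [eta_comm, eta_mvec_left]
      simp [kvec]
    · have hp : ∀ i : Fin m, eta (kvec m) (mvec i) = 0 := fun i => by
        rw [eta_comm, eta_mvec_left]
        simp [kvec]
      refine (h.perp (mvec i) (mvec j) (hp i) (hp j)).trans ?_
      rw [eta_mvec_left]
      simp [mvec, Pi.single_apply]

/-- Each nonzero null vector is the image of `k` under some null frame. -/
lemma exists_null_frame {y : Tan m x} (hy : y ≠ 0) (hnull : g.val x y y = 0) :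
    ∃ u : Frame m x, (∀ v w, g.val x (u v) (u w) = eta v w) ∧ u (kvec m) = y := by
  obtain ⟨u, hu⟩ := g.signature x
  obtain ⟨y, rfl⟩ := u.surjective y
  rw [hu] at hnull
  obtain ⟨a, ha, hak⟩ := exists_isometry_map_kvec (y := y) (by rintro rfl; simp at hy) hnull
  exact ⟨a.trans u, fun v w => by simp [hu, ha], by simp [hak]⟩

/-- Every vector is `g(y, v) l` plus an element of `λ^⊥`. If `B` vanishes on `λ^⊥ × λ^⊥`, expanding
both arguments writes it as `y♭ ⊗ B(l, ·) + (B(l, ·) - B(l, l) y♭) ⊗ y♭`, where `y♭ = g(y, ·)` kills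
`λ^⊥` and `B(l, ·)` kills `λ`. -/
lemma isTypeIII_iff {L : Submodule ℝ (Tan m x)} {y l : Tan m x} (hL : L = Submodule.span ℝ {y})
    (hyy : g.val x y y = 0) (hyl : g.val x y l = 1)
    (B : TangentSpace (𝓡 (m + 2)) x →L[ℝ] TangentSpace (𝓡 (m + 2)) x →L[ℝ] ℝ)
    (hB : ∀ v w, B v w = B w v) :
    g.IsTypeIII x L B ↔ (∀ v ∈ L, ∀ z, B v z = 0) ∧
      ∀ w ∈ g.perp x L, ∀ w' ∈ g.perp x L, B w w' = 0 := by
  have hLp : ∀ v ∈ L, v ∈ g.perp x L := fun v hv => by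
    rw [hL] at hv ⊢
    obtain ⟨c, rfl⟩ := Submodule.mem_span_singleton.1 hv
    rw [mem_perp_span_iff, map_smul, hyy, smul_zero]
  constructor
  · intro h
    -- The generators of the span are not symmetric, so the vanishing on `L` is carried through the
    -- induction in both arguments.
    have h' : (∀ v ∈ L, ∀ z, B v z = 0 ∧ B z v = 0) ∧
        ∀ w ∈ g.perp x L, ∀ w' ∈ g.perp x L, B w w' = 0 := by
      refine Submodule.span_induction (p := fun B _ => (∀ v ∈ L, ∀ z, B v z = 0 ∧ B z v = 0) ∧
        ∀ w ∈ g.perp x L, ∀ w' ∈ g.perp x L, B w w' = 0) ?_ ?_ ?_ ?_ h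
      · rintro T ⟨α, β, hα, hβ, rfl | rfl⟩
        · refine ⟨fun v hv z => ⟨?_, ?_⟩, fun w hw w' hw' => ?_⟩
          · simp [hα v (hLp v hv)]
          · simp [hβ v hv]
          · simp [hα w hw]
        · refine ⟨fun v hv z => ⟨?_, ?_⟩, fun w hw w' hw' => ?_⟩
          · simp [hβ v hv]
          · simp [hα v (hLp v hv)]
          · simp [hα w' hw']
      · exact ⟨fun _ _ _ => ⟨rfl, rfl⟩, fun _ _ _ _ => rfl⟩
      · rintro S T _ _ ⟨hS, hS'⟩ ⟨hT, hT'⟩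
        refine ⟨fun v hv z => ⟨?_, ?_⟩, fun w hw w' hw' => ?_⟩
        · simp [(hS v hv z).1, (hT v hv z).1]
        · simp [(hS v hv z).2, (hT v hv z).2]
        · simp [hS' w hw w' hw', hT' w hw w' hw']
      · rintro c S _ ⟨hS, hS'⟩
        refine ⟨fun v hv z => ⟨?_, ?_⟩, fun w hw w' hw' => ?_⟩
        · simp [(hS v hv z).1]
        · simp [(hS v hv z).2]
        · simp [hS' w hw w' hw']
    exact ⟨fun v hv z => (h'.1 v hv z).1, h'.2⟩
  · rintro ⟨h1, h2⟩
    have hy : y ∈ L := hL ▸ Submodule.mem_span_singleton_self y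
    have hα : ∀ w ∈ g.perp x L, g.val x y w = 0 := fun w hw => hw y hy
    have hdec : B = (g.val x y).smulRight (B l) +
        (B l - B l l • g.val x y).smulRight (g.val x y) := by
      ext v w
      have hp : ∀ v, v - g.val x y v • l ∈ g.perp x L := fun v => by
        rw [hL, mem_perp_span_iff, map_sub, map_smul, hyl]
        simp
      have := h2 _ (hp v) _ (hp w)
      simp only [map_sub, map_smul, _root_.sub_apply, _root_.smul_apply,
        smul_eq_mul] at this
      simp only [_root_.add_apply, ContinuousLinearMap.smulRight_apply,
        _root_.smul_apply, smul_eq_mul, _root_.sub_apply]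
      linear_combination this + g.val x y w * hB v l
    rw [hdec]
    refine Submodule.add_mem _
      (Submodule.subset_span ⟨g.val x y, B l, hα, fun v hv => ?_, Or.inl rfl⟩)
      (Submodule.subset_span ⟨g.val x y, B l - B l l • g.val x y, hα, fun v hv => ?_,
        Or.inr rfl⟩)
    · rw [hB, h1 v hv]
    · simp only [_root_.sub_apply, _root_.smul_apply, hB l v, h1 v hv,
        hα v (hLp v hv), smul_zero, sub_zero]

end Adapted

/-! ### Smooth local null frames. -/

section LocalFrames

variable {m : ℕ} {M : Type*} [TopologicalSpace M] [ChartedSpace (Mod m) M]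
  [IsManifold (𝓡 (m + 2)) ∞ M] (g : LorentzianMetric m M)

/-- The vector field `Y` is smooth at `x`. -/
def SmoothFieldAt (Y : ∀ x : M, Tan m x) (x : M) : Prop :=
  ContMDiffAt (𝓡 (m + 2)) (𝓡 (m + 2)).tangent ∞
    (fun x => (⟨x, Y x⟩ : TangentBundle (𝓡 (m + 2)) M)) x

/-- The function `f` is smooth at `x`. -/
def SmoothFunctionAt (m : ℕ) {M : Type*} [TopologicalSpace M] [ChartedSpace (Mod m) M]
    (f : M → ℝ) (x : M) : Prop := ContMDiffAt (𝓡 (m + 2)) 𝓘(ℝ, ℝ) ∞ f x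

variable {g} {Y Z : ∀ x : M, Tan m x} {x : M} {U : Set M}

lemma SmoothFieldOn.smoothFieldAt (h : SmoothFieldOn Y U) (hU : IsOpen U) (hx : x ∈ U) :
    SmoothFieldAt Y x := ContMDiffOn.contMDiffAt h (hU.mem_nhds hx)

lemma SmoothFieldAt.fieldDiffAt (h : SmoothFieldAt Y x) : FieldDiffAt Y x :=
  ContMDiffAt.mdifferentiableAt h (by simp)

lemma SmoothFieldAt.congr (h : SmoothFieldAt Y x) (h' : ∀ᶠ y in 𝓝 x, Z y = Y y) :
    SmoothFieldAt Z x :=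
  ContMDiffAt.congr_of_eventuallyEq h (h'.mono fun y hy => congrArg (TotalSpace.mk' (Mod m) y) hy)

lemma SmoothFieldAt.sub (hY : SmoothFieldAt Y x) (hZ : SmoothFieldAt Z x) :
    SmoothFieldAt (fun y => Y y - Z y) x := ContMDiffAt.sub_section hY hZ

lemma SmoothFieldAt.add (hY : SmoothFieldAt Y x) (hZ : SmoothFieldAt Z x) :
    SmoothFieldAt (fun y => Y y + Z y) x := ContMDiffAt.add_section hY hZ

lemma SmoothFieldAt.smul {f : M → ℝ} (hf : SmoothFunctionAt m f x) (hY : SmoothFieldAt Y x) :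
    SmoothFieldAt (fun y => f y • Y y) x := ContMDiffAt.smul_section hf hY

lemma SmoothFieldAt.const_smul (c : ℝ) (hY : SmoothFieldAt Y x) :
    SmoothFieldAt (fun y => c • Y y) x := ContMDiffAt.const_smul_section hY

lemma SmoothFieldAt.metric_apply (hY : SmoothFieldAt Y x) (hZ : SmoothFieldAt Z x) :
    SmoothFunctionAt m (fun y => g.val y (Y y) (Z y)) x := by
  have : ContMDiffAt (𝓡 (m + 2)) ((𝓡 (m + 2)).prod 𝓘(ℝ)) ∞
      (fun y => TotalSpace.mk' ℝ (E := Bundle.Trivial M ℝ) y (g.val y (Y y) (Z y))) x := by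
    apply ContMDiffAt.clm_bundle_apply₂ (F₁ := Mod m) (F₂ := Mod m)
    · exact g.contMDiff.contMDiffAt
    · exact hY
    · exact hZ
  rw [Bundle.contMDiffAt_totalSpace] at this
  exact this.2

lemma eventually_smoothFieldAt_extend (v : Tan m x) :
    ∀ᶠ y in 𝓝 x, SmoothFieldAt (FiberBundle.extend (Mod m) v) y := by
  obtain ⟨s, hs, h⟩ := FiberBundle.exists_contMDiffOn_extend (k := ∞) (𝓡 (m + 2)) (Mod m) v
  filter_upwards [eventually_mem_nhds_iff.2 hs] with y hy
  exact h.contMDiffAt hy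

lemma SmoothFunctionAt.inv {f : M → ℝ} (hf : SmoothFunctionAt m f x) (h : f x ≠ 0) :
    SmoothFunctionAt m (fun y => (f y)⁻¹) x :=
  ContMDiffAt.comp (I' := 𝓘(ℝ, ℝ)) x ((contDiffAt_inv ℝ h).contMDiffAt) hf

lemma SmoothFunctionAt.sqrt {f : M → ℝ} (hf : SmoothFunctionAt m f x) (h : f x ≠ 0) :
    SmoothFunctionAt m (fun y => √(f y)) x :=
  ContMDiffAt.comp (I' := 𝓘(ℝ, ℝ)) x ((Real.contDiffAt_sqrt h).contMDiffAt) hf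

lemma SmoothFunctionAt.const_mul {f : M → ℝ} (c : ℝ) (hf : SmoothFunctionAt m f x) :
    SmoothFunctionAt m (fun y => c * f y) x :=
  ContMDiffAt.comp (I' := 𝓘(ℝ, ℝ)) x ((contDiff_const.mul contDiff_id).contDiffAt.contMDiffAt) hf

/-- One step of the Gram–Schmidt process for local vector fields orthogonal to `K` and `L`. -/
lemma gramSchmidt_step {p : M} {K L : ∀ x : M, Tan m x} (Z : Fin m → ∀ x : M, Tan m x) (a : Fin m)
    (hZ : ∀ i, ∀ᶠ y in 𝓝 p, SmoothFieldAt (Z i) y)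
    (hp : ∀ i j, g.val p (Z i p) (Z j p) = if i = j then 1 else 0)
    (hKL : ∀ᶠ y in 𝓝 p, ∀ i, g.val y (K y) (Z i y) = 0 ∧ g.val y (L y) (Z i y) = 0)
    (hon : ∀ᶠ y in 𝓝 p, ∀ i j, i < a → g.val y (Z i y) (Z j y) = if i = j then 1 else 0) :
    ∃ Z' : Fin m → ∀ x : M, Tan m x, (∀ i, ∀ᶠ y in 𝓝 p, SmoothFieldAt (Z' i) y) ∧
      (∀ i, Z' i p = Z i p) ∧
      (∀ᶠ y in 𝓝 p, ∀ i, g.val y (K y) (Z' i y) = 0 ∧ g.val y (L y) (Z' i y) = 0) ∧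
      ∀ᶠ y in 𝓝 p, ∀ i j, i ≤ a → g.val y (Z' i y) (Z' j y) = if i = j then 1 else 0 := by
  set f : M → ℝ := fun y => g.val y (Z a y) (Z a y) with hf
  have hfp : f p = 1 := by simpa using hp a a
  have hf0 : ∀ᶠ y in 𝓝 p, 0 < f y := by
    have : ContinuousAt f p :=
      ((hZ a).self_of_nhds.metric_apply (hZ a).self_of_nhds).continuousAt
    exact this.eventually (lt_mem_nhds (by rw [hfp]; exact one_pos))
  set W : ∀ x : M, Tan m x := fun y => (√(f y))⁻¹ • Z a y with hW
  have hWs : ∀ᶠ y in 𝓝 p, SmoothFieldAt W y := by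
    filter_upwards [hf0, hZ a] with y hy hZy
    exact SmoothFieldAt.smul
      (((hZy.metric_apply hZy).sqrt hy.ne').inv (Real.sqrt_ne_zero'.2 hy)) hZy
  have hWp : W p = Z a p := by simp [hW, hfp]
  have hWW : ∀ᶠ y in 𝓝 p, g.val y (W y) (W y) = 1 := by
    filter_upwards [hf0] with y hy
    simp only [hW, map_smul, _root_.smul_apply, smul_eq_mul]
    change (√(f y))⁻¹ * ((√(f y))⁻¹ * f y) = 1
    have h2 := Real.mul_self_sqrt hy.le
    have h3 : √(f y) ≠ 0 := Real.sqrt_ne_zero'.2 hy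
    field_simp
    nlinarith [h2]
  -- Fields with index below `a` are already orthogonal to `W` near `p`, so for them the correction
  -- is zero; at `p` itself nothing changes.
  refine ⟨fun j y => if j = a then W y else Z j y - g.val y (Z j y) (W y) • W y,
    fun j => ?_, fun j => ?_, ?_, ?_⟩
  · by_cases h : j = a
    · simpa [h] using hWs
    · simp only [h, if_false]
      filter_upwards [hZ j, hWs] with y h1 h2
      exact h1.sub (SmoothFieldAt.smul (h1.metric_apply h2) h2)
  · by_cases h : j = a
    · simp [h, hWp]
    · simp [h, hWp, hp]
  · filter_upwards [hKL] with y hy i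
    by_cases h : i = a
    · simp [h, hW, hy]
    · simp [h, hW, hy]
  · filter_upwards [hon, hWW] with y hy hWy i j hi
    have hjW : ∀ j, g.val y (W y) (Z j y - g.val y (Z j y) (W y) • W y) = 0 := fun j => by
      rw [map_sub (g.val y (W y)), map_smul (g.val y (W y)), hWy, g.symm y (Z j y)]
      simp
    by_cases h : i = a
    · by_cases h' : j = a
      · simp [h, h', hWy]
      · simp only [h, h', if_true, if_false, hjW, Ne.symm h']
    · have hia : i < a := lt_of_le_of_ne hi h
      have hiW : g.val y (Z i y) (W y) = 0 := by
        simp [hW, hy i a hia, h]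
      by_cases h' : j = a
      · simp [h, h', hiW]
      · simp [h, h', hiW, hy i j hia]

/-- Induction on the number of fields already orthonormalized against all the others. The values at
`p` are kept fixed so that each next field still has norm one at `p` and can be normalized nearby.
-/
lemma exists_orthonormal_fields {p : M} {K L : ∀ x : M, Tan m x} (Z : Fin m → ∀ x : M, Tan m x)
    (hZ : ∀ i, ∀ᶠ y in 𝓝 p, SmoothFieldAt (Z i) y)
    (hp : ∀ i j, g.val p (Z i p) (Z j p) = if i = j then 1 else 0)
    (hKL : ∀ᶠ y in 𝓝 p, ∀ i, g.val y (K y) (Z i y) = 0 ∧ g.val y (L y) (Z i y) = 0) :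
    ∃ Z' : Fin m → ∀ x : M, Tan m x, (∀ i, ∀ᶠ y in 𝓝 p, SmoothFieldAt (Z' i) y) ∧
      (∀ᶠ y in 𝓝 p, ∀ i, g.val y (K y) (Z' i y) = 0 ∧ g.val y (L y) (Z' i y) = 0) ∧
      ∀ᶠ y in 𝓝 p, ∀ i j, g.val y (Z' i y) (Z' j y) = if i = j then 1 else 0 := by
  have key : ∀ n, n ≤ m → ∃ Z' : Fin m → ∀ x : M, Tan m x,
      (∀ i, ∀ᶠ y in 𝓝 p, SmoothFieldAt (Z' i) y) ∧ (∀ i, Z' i p = Z i p) ∧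
      (∀ᶠ y in 𝓝 p, ∀ i, g.val y (K y) (Z' i y) = 0 ∧ g.val y (L y) (Z' i y) = 0) ∧
      ∀ᶠ y in 𝓝 p, ∀ i j : Fin m, i.val < n →
        g.val y (Z' i y) (Z' j y) = if i = j then 1 else 0 := by
    intro n
    induction n with
    | zero => exact fun _ => ⟨Z, hZ, fun _ => rfl, hKL, .of_forall fun y i j h => by simp at h⟩
    | succ n ih =>
      intro hn
      obtain ⟨Z₁, h1, h2, h3, h4⟩ := ih (by omega)
      obtain ⟨Z₂, k1, k2, k3, k4⟩ := gramSchmidt_step Z₁ ⟨n, by omega⟩ h1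
        (fun i j => by rw [h2, h2, hp]) h3 h4
      exact ⟨Z₂, k1, fun i => (k2 i).trans (h2 i), k3, k4.mono fun y hy i j hi =>
        hy i j (Nat.lt_succ_iff.1 hi)⟩
  obtain ⟨Z', h1, -, h3, h4⟩ := key m le_rfl
  exact ⟨Z', h1, h3, h4.mono fun y hy i j => hy i j i.2⟩

/-- A nowhere vanishing local null vector field is the first member of a smooth local null frame. -/
theorem exists_local_null_frame {p : M} {K : ∀ x : M, Tan m x}
    (hK : ∀ᶠ y in 𝓝 p, SmoothFieldAt K y) (hKp : K p ≠ 0)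
    (hnull : ∀ᶠ y in 𝓝 p, g.val y (K y) (K y) = 0) :
    ∃ U : Set M, IsOpen U ∧ p ∈ U ∧ ∃ s : ∀ x : M, Frame m x,
      (∀ x ∈ U, s x (kvec m) = K x ∧ ∀ v w, g.val x (s x v) (s x w) = eta v w) ∧
      ∀ v, SmoothFieldOn (fun x => s x v) U := by
  -- A null frame at the single point `p` provides the initial values; extending them arbitrarily,
  -- every correction below is trivial at `p`, and the nonvanishing needed for divisions persists
  -- nearby.
  obtain ⟨u, hu, huk⟩ := exists_null_frame hKp hnull.self_of_nhds
  set L₀ : ∀ x : M, Tan m x := FiberBundle.extend (Mod m) (u (lvec m)) with hL₀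
  have hL₀p : L₀ p = u (lvec m) := FiberBundle.extend_apply_self _ _
  have hL₀s : ∀ᶠ y in 𝓝 p, SmoothFieldAt L₀ y := eventually_smoothFieldAt_extend _
  have hkl : g.val p (K p) (L₀ p) = 1 := by
    rw [← huk, hL₀p, hu, eta_kvec_left]
    simp [lvec]
  have hKL₀ : ∀ᶠ y in 𝓝 p, g.val y (K y) (L₀ y) ≠ 0 := by
    have : ContinuousAt (fun y => g.val y (K y) (L₀ y)) p :=
      (hK.self_of_nhds.metric_apply hL₀s.self_of_nhds).continuousAt
    exact this.eventually_ne (by rw [hkl]; exact one_ne_zero)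
  set L₁ : ∀ x : M, Tan m x := fun y => (g.val y (K y) (L₀ y))⁻¹ • L₀ y with hL₁
  have hL₁s : ∀ᶠ y in 𝓝 p, SmoothFieldAt L₁ y := by
    filter_upwards [hK, hL₀s, hKL₀] with y h1 h2 h3
    exact SmoothFieldAt.smul ((h1.metric_apply h2).inv h3) h2
  have hL₁p : L₁ p = u (lvec m) := by
    simp only [hL₁, hkl]
    rw [inv_one, one_smul, hL₀p]
  have hKL₁ : ∀ᶠ y in 𝓝 p, g.val y (K y) (L₁ y) = 1 := by
    filter_upwards [hKL₀] with y hy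
    simp [hL₁, hy]
  -- Subtracting `½ g(L₁, L₁) K` makes the field null without changing its product with the null
  -- field `K`.
  set L : ∀ x : M, Tan m x := fun y => L₁ y - (1 / 2 * g.val y (L₁ y) (L₁ y)) • K y with hL
  have hLs : ∀ᶠ y in 𝓝 p, SmoothFieldAt L y := by
    filter_upwards [hK, hL₁s] with y h1 h2
    exact h2.sub (SmoothFieldAt.smul ((h2.metric_apply h2).const_mul _) h1)
  have hLp : L p = u (lvec m) := by
    simp only [hL, hL₁p, hu, eta_lvec_left]
    simp [lvec]
  have hKL : ∀ᶠ y in 𝓝 p, g.val y (K y) (L y) = 1 := by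
    filter_upwards [hKL₁, hnull] with y h1 h2
    simp [hL, h1, h2]
  have hLL : ∀ᶠ y in 𝓝 p, g.val y (L y) (L y) = 0 := by
    filter_upwards [hKL₁, hnull] with y h1 h2
    simp only [hL, map_sub, map_smul, _root_.sub_apply, _root_.smul_apply, smul_eq_mul, h1, h2,
      g.symm y (L₁ y) (K y)]
    ring
  set B : Fin m → ∀ x : M, Tan m x := fun i => FiberBundle.extend (Mod m) (u (mvec i)) with hB
  have hBp : ∀ i, B i p = u (mvec i) := fun i => FiberBundle.extend_apply_self _ _
  have hBs : ∀ i, ∀ᶠ y in 𝓝 p, SmoothFieldAt (B i) y := fun i => eventually_smoothFieldAt_extend _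
  set Z : Fin m → ∀ x : M, Tan m x := fun i y =>
    B i y - g.val y (B i y) (L y) • K y - g.val y (B i y) (K y) • L y with hZ
  have hZs : ∀ i, ∀ᶠ y in 𝓝 p, SmoothFieldAt (Z i) y := by
    intro i
    filter_upwards [hBs i, hK, hLs] with y h1 h2 h3
    exact (h1.sub (SmoothFieldAt.smul (h1.metric_apply h3) h2)).sub
      (SmoothFieldAt.smul (h1.metric_apply h2) h3)
  have hZp : ∀ i, Z i p = u (mvec i) := by
    intro i
    simp only [hZ, hBp, hLp, ← huk, hu, eta_mvec_left]
    simp [lvec, kvec, Fin.ext_iff]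
  obtain ⟨Z', h1, h2, h3⟩ := exists_orthonormal_fields (K := K) (L := L) Z hZs
    (fun i j => by
      rw [hZp, hZp, hu, eta_mvec_left]
      simp [mvec, Pi.single_apply])
    (by
      filter_upwards [hKL, hLL, hnull] with y k1 k2 k3 i
      constructor
      · simp only [hZ, map_sub, map_smul, smul_eq_mul, k1, k3, g.symm y (B i y) (K y)]
        ring
      · simp only [hZ, map_sub, map_smul, smul_eq_mul, g.symm y (L y) (K y), k1, k2,
          g.symm y (B i y) (L y)]
        ring)
  let S : ∀ x : M, Vec m →ₗ[ℝ] Tan m x := fun x =>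
    (LinearMap.proj 0).smulRight (K x) + (LinearMap.proj 1).smulRight (L x) +
      ∑ i : Fin m, (LinearMap.proj (R := ℝ) (φ := fun _ : Fin (m + 2) => ℝ) i.succ.succ).smulRight
        (Z' i x)
  have hS : ∀ x v, S x v = v 0 • K x + v 1 • L x + ∑ i : Fin m, v i.succ.succ • Z' i x := by
    intro x v
    simp [S]
  have hiso : ∀ᶠ y in 𝓝 p, ∀ v w, g.val y (S y v) (S y w) = eta v w := by
    filter_upwards [hKL, hLL, hnull, h2, h3] with y k1 k2 k3 k4 k5 v w
    have k6 : ∀ i, g.val y (Z' i y) (K y) = 0 := fun i => by rw [g.symm, (k4 i).1]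
    have k7 : ∀ i, g.val y (Z' i y) (L y) = 0 := fun i => by rw [g.symm, (k4 i).2]
    rw [hS, hS]
    simp [k1, k2, k3, k4, k5, k6, k7, g.symm y (L y) (K y), eta, mul_comm]
  have hSs : ∀ᶠ y in 𝓝 p, ∀ v, SmoothFieldAt (fun x => S x v) y := by
    filter_upwards [hK, hLs, Filter.eventually_all.2 h1] with y k1 k2 k3 v
    simp only [hS]
    exact ((k1.const_smul _).add (k2.const_smul _)).add
      (ContMDiffAt.sum_section fun i _ => (k3 i).const_smul _)
  obtain ⟨U, hU, hUo, hpU⟩ := eventually_nhds_iff.1 (hiso.and hSs)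
  have hframe : ∀ x : M, ∃ v : Frame m x, x ∈ U → ∀ z, v z = S x z := by
    intro x
    by_cases hx : x ∈ U
    -- Only the injectivity and the dimension count for adapted maps are wanted, so the line
    -- condition is made void by taking the whole tangent space.
    · obtain ⟨v, hv⟩ := (IsAdapted.of_isometry (line := fun _ => ⊤) Submodule.mem_top
        (hU x hx).1).exists_frame
      exact ⟨v, fun _ => hv⟩
    · exact ⟨(g.signature x).choose, fun h => absurd h hx⟩
  choose s hs using hframe
  refine ⟨U, hUo, hpU, s, fun x hx => ⟨?_, fun v w => ?_⟩, fun v x hx => ?_⟩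
  · rw [hs x hx, hS, kvec_one]
    simp [kvec]
  · rw [hs x hx, hs x hx, (hU x hx).1]
  · refine ContMDiffAt.contMDiffWithinAt (SmoothFieldAt.congr ((hU x hx).2 v) ?_)
    filter_upwards [hUo.mem_nhds hx] with y hy
    exact hs y hy v

end LocalFrames

/-! ### Lie derivatives of functions and of the metric. -/

section LieDerivative

variable {m : ℕ} {M : Type*} [TopologicalSpace M] [ChartedSpace (Mod m) M]
  [IsManifold (𝓡 (m + 2)) ∞ M] {g : LorentzianMetric m M}
  {X Y V Z : ∀ x : M, Tan m x} {x : M} {U : Set M}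

lemma Fields.smoothFieldAt (X : Fields m M) (x : M) : SmoothFieldAt X x := X.contMDiff.contMDiffAt

lemma SmoothFieldAt.mlieBracket (hX : SmoothFieldAt X x) (hY : SmoothFieldAt Y x) :
    SmoothFieldAt (mlieBracket (𝓡 (m + 2)) X Y) x :=
  have : IsManifold (𝓡 (m + 2)) (((⊤ : ℕ∞) : WithTop ℕ∞) + 1) M :=
    inferInstanceAs (IsManifold (𝓡 (m + 2)) ∞ M)
  ContMDiffAt.mlieBracket_vectorField (m := ⊤) (n := ⊤) hX hY (by simp)

lemma SmoothFunctionAt.mdifferentiableAt {f : M → ℝ} (h : SmoothFunctionAt m f x) :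
    MDifferentiableAt (𝓡 (m + 2)) 𝓘(ℝ, ℝ) f x :=
  ContMDiffAt.mdifferentiableAt h (by simp)

lemma jacobi_mlieBracket (hX : SmoothFieldAt X x) (hY : SmoothFieldAt Y x)
    (hZ : SmoothFieldAt Z x) :
    mlieBracket (𝓡 (m + 2)) X (mlieBracket (𝓡 (m + 2)) Y Z) x =
      mlieBracket (𝓡 (m + 2)) (mlieBracket (𝓡 (m + 2)) X Y) Z x +
        mlieBracket (𝓡 (m + 2)) Y (mlieBracket (𝓡 (m + 2)) X Z) x :=
  leibniz_identity_mlieBracket_apply (ContMDiffAt.of_le hX two_le_infty)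
    (ContMDiffAt.of_le hY two_le_infty) (ContMDiffAt.of_le hZ two_le_infty)

/-- The derivative of the function `f` along the vector field `X`. -/
def dirDeriv (X : ∀ x : M, Tan m x) (f : M → ℝ) (x : M) : ℝ := mvfderiv (𝓡 (m + 2)) f x (X x)

lemma mlieBracket_smul_field {f : M → ℝ} (hf : SmoothFunctionAt m f x) (hY : SmoothFieldAt Y x) :
    mlieBracket (𝓡 (m + 2)) X (fun y => f y • Y y) x =
      dirDeriv X f x • Y x + f x • mlieBracket (𝓡 (m + 2)) X Y x :=
  mlieBracket_smul_right hf.mdifferentiableAt hY.fieldDiffAt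

lemma mlieBracket_add_field (hY : SmoothFieldAt Y x) (hZ : SmoothFieldAt Z x) :
    mlieBracket (𝓡 (m + 2)) X (fun y => Y y + Z y) x =
      mlieBracket (𝓡 (m + 2)) X Y x + mlieBracket (𝓡 (m + 2)) X Z x :=
  mlieBracket_add_right hY.fieldDiffAt hZ.fieldDiffAt

lemma mlieBracket_congr_right (h : ∀ᶠ y in 𝓝 x, Y y = Z y) :
    mlieBracket (𝓡 (m + 2)) X Y x = mlieBracket (𝓡 (m + 2)) X Z x :=
  Filter.EventuallyEq.mlieBracket_vectorField_eq .rfl h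

/-- The identity `[X, f W] - f [X, W] = (X f) W` recovers `X f` after pairing with a field `L` for
which `g(W, L)` does not vanish, so smoothness of brackets is enough. -/
lemma smoothFunctionAt_dirDeriv (g : LorentzianMetric m M) {f : M → ℝ} (hX : SmoothFieldAt X x)
    (hf : ∀ᶠ y in 𝓝 x, SmoothFunctionAt m f y) : SmoothFunctionAt m (dirDeriv X f) x := by
  obtain ⟨u, hu⟩ := g.signature x
  set W : ∀ x : M, Tan m x := FiberBundle.extend (Mod m) (u (kvec m))
  set L : ∀ x : M, Tan m x := FiberBundle.extend (Mod m) (u (lvec m))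
  have hW := eventually_smoothFieldAt_extend (u (kvec m))
  have hL := eventually_smoothFieldAt_extend (u (lvec m))
  have h1 : g.val x (W x) (L x) = 1 := by
    simp only [W, L, FiberBundle.extend_apply_self, hu, eta_kvec_left]
    simp [lvec]
  have hWL : SmoothFunctionAt m (fun y => g.val y (W y) (L y)) x :=
    hW.self_of_nhds.metric_apply hL.self_of_nhds
  have h2 : ∀ᶠ y in 𝓝 x, g.val y (W y) (L y) ≠ 0 :=
    (ContMDiffAt.continuousAt hWL).eventually_ne (by rw [h1]; exact one_ne_zero)
  have h3 : SmoothFunctionAt m (fun y => g.val y (mlieBracket (𝓡 (m + 2)) X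
      (fun y => f y • W y) y - f y • mlieBracket (𝓡 (m + 2)) X W y) (L y) *
        (g.val y (W y) (L y))⁻¹) x := by
    refine ContMDiffAt.mul ?_ (hWL.inv h2.self_of_nhds)
    refine SmoothFieldAt.metric_apply ?_ hL.self_of_nhds
    exact (hX.mlieBracket (SmoothFieldAt.smul hf.self_of_nhds hW.self_of_nhds)).sub
      (SmoothFieldAt.smul hf.self_of_nhds (hX.mlieBracket hW.self_of_nhds))
  refine ContMDiffAt.congr_of_eventuallyEq h3 ?_
  filter_upwards [h2, hf, hW] with y k1 k2 k3
  rw [mlieBracket_smul_field k2 k3, add_sub_cancel_right, map_smul, _root_.smul_apply, smul_eq_mul,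
    mul_inv_cancel_right₀ k1]

/-- The Lie bracket acts on functions as the commutator. -/
lemma dirDeriv_mlieBracket (g : LorentzianMetric m M) {f : M → ℝ}
    (hX : ∀ᶠ y in 𝓝 x, SmoothFieldAt X y) (hY : ∀ᶠ y in 𝓝 x, SmoothFieldAt Y y)
    (hf : ∀ᶠ y in 𝓝 x, SmoothFunctionAt m f y) :
    dirDeriv (mlieBracket (𝓡 (m + 2)) X Y) f x =
      dirDeriv X (dirDeriv Y f) x - dirDeriv Y (dirDeriv X f) x := by
  obtain ⟨u, hu⟩ := g.signature x
  set W : ∀ x : M, Tan m x := FiberBundle.extend (Mod m) (u (kvec m))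
  have hWx : W x = u (kvec m) := FiberBundle.extend_apply_self _ _
  have hW : ∀ᶠ y in 𝓝 x, SmoothFieldAt W y := eventually_smoothFieldAt_extend (u (kvec m))
  have hX' := hX.self_of_nhds
  have hY' := hY.self_of_nhds
  have hW' := hW.self_of_nhds
  have hf' := hf.self_of_nhds
  have key : ∀ X Y : ∀ x : M, Tan m x, (∀ᶠ y in 𝓝 x, SmoothFieldAt Y y) →
      mlieBracket (𝓡 (m + 2)) X (mlieBracket (𝓡 (m + 2)) Y (fun y => f y • W y)) x =
        (dirDeriv X (dirDeriv Y f) x • W x + dirDeriv Y f x • mlieBracket (𝓡 (m + 2)) X W x) +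
        (dirDeriv X f x • mlieBracket (𝓡 (m + 2)) Y W x +
          f x • mlieBracket (𝓡 (m + 2)) X (mlieBracket (𝓡 (m + 2)) Y W) x) := by
    intro X Y hY
    have h1 : ∀ᶠ y in 𝓝 x, mlieBracket (𝓡 (m + 2)) Y (fun y => f y • W y) y =
        dirDeriv Y f y • W y + f y • mlieBracket (𝓡 (m + 2)) Y W y := by
      filter_upwards [hf, hW] with y k1 k2
      exact mlieBracket_smul_field k1 k2
    have h2 := smoothFunctionAt_dirDeriv g hY.self_of_nhds hf
    have h3 := hY.self_of_nhds.mlieBracket hW'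
    rw [mlieBracket_congr_right h1, mlieBracket_add_field (SmoothFieldAt.smul h2 hW')
      (SmoothFieldAt.smul hf' h3), mlieBracket_smul_field h2 hW', mlieBracket_smul_field hf' h3]
  -- Expanding the Jacobi identity for `X, Y, f W` and removing `f` times the one for `X, Y, W`
  -- leaves the commutator formula as the coefficient of `W`, which is nonzero at `x`.
  have j1 := jacobi_mlieBracket hX' hY' (SmoothFieldAt.smul hf' hW')
  have j2 := jacobi_mlieBracket hX' hY' hW'
  rw [key X Y hY, key Y X hX, mlieBracket_smul_field hf' hW', j2] at j1
  have h : (dirDeriv (mlieBracket (𝓡 (m + 2)) X Y) f x -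
      (dirDeriv X (dirDeriv Y f) x - dirDeriv Y (dirDeriv X f) x)) • W x = 0 := by
    rw [sub_smul, sub_smul, sub_eq_zero]
    have j3 := sub_eq_zero.2 j1
    rw [eq_sub_iff_add_eq, ← sub_eq_zero, ← neg_eq_zero, ← j3]
    rw [smul_add]
    abel
  rw [hWx] at h
  exact sub_eq_zero.1 ((smul_eq_zero.1 h).resolve_right (frame_kvec_ne_zero u))

lemma lieDerivAux_eq (X : ∀ x : M, Tan m x) (x : M) (V Z : ∀ x : M, Tan m x) :
    g.lieDerivAux X x V Z = dirDeriv X (fun y => g.val y (V y) (Z y)) x -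
      g.val x (mlieBracket (𝓡 (m + 2)) X V x) (Z x) -
      g.val x (V x) (mlieBracket (𝓡 (m + 2)) X Z x) := rfl

lemma dirDeriv_congr {f f' : M → ℝ} (h : ∀ᶠ y in 𝓝 x, f y = f' y) :
    dirDeriv X f x = dirDeriv X f' x := by
  have h' : f =ᶠ[𝓝 x] f' := h
  simp only [dirDeriv, mvfderiv, h'.mfderiv_eq]
  rfl

lemma dirDeriv_add {f f' : M → ℝ} (hf : SmoothFunctionAt m f x) (hf' : SmoothFunctionAt m f' x) :
    dirDeriv X (fun y => f y + f' y) x = dirDeriv X f x + dirDeriv X f' x := by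
  have := mvfderiv_add hf.mdifferentiableAt hf'.mdifferentiableAt
  exact congrArg (fun T : TangentSpace (𝓡 (m + 2)) x →L[ℝ] ℝ => T (X x)) this

/-- The Lie derivative along a bracket vanishes on `(V, Z)` if the Lie derivatives along the two
fields vanish on `(V, Z)` and on the pairs obtained by one further bracket. -/
lemma lieDerivAux_mlieBracket_eq_zero
    (hX : ∀ᶠ y in 𝓝 x, SmoothFieldAt X y) (hY : ∀ᶠ y in 𝓝 x, SmoothFieldAt Y y)
    (hV : ∀ᶠ y in 𝓝 x, SmoothFieldAt V y) (hZ : ∀ᶠ y in 𝓝 x, SmoothFieldAt Z y)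
    (h1 : ∀ᶠ y in 𝓝 x, g.lieDerivAux X y V Z = 0) (h2 : ∀ᶠ y in 𝓝 x, g.lieDerivAux Y y V Z = 0)
    (h3 : g.lieDerivAux X x (mlieBracket (𝓡 (m + 2)) Y V) Z = 0)
    (h4 : g.lieDerivAux X x V (mlieBracket (𝓡 (m + 2)) Y Z) = 0)
    (h5 : g.lieDerivAux Y x (mlieBracket (𝓡 (m + 2)) X V) Z = 0)
    (h6 : g.lieDerivAux Y x V (mlieBracket (𝓡 (m + 2)) X Z) = 0) :
    g.lieDerivAux (mlieBracket (𝓡 (m + 2)) X Y) x V Z = 0 := by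
  have hX' := hX.self_of_nhds
  have hY' := hY.self_of_nhds
  have hV' := hV.self_of_nhds
  have hZ' := hZ.self_of_nhds
  -- Because `(L_Y g)(V, Z)` vanishes near `x`, and not only at `x`, the Leibniz formula for `Y g(V,
  -- Z)` may be differentiated along `X`.
  have key : ∀ X Y : ∀ x : M, Tan m x, SmoothFieldAt Y x →
      (∀ᶠ y in 𝓝 x, g.lieDerivAux Y y V Z = 0) →
      dirDeriv X (dirDeriv Y fun y => g.val y (V y) (Z y)) x =
        dirDeriv X (fun y => g.val y (mlieBracket (𝓡 (m + 2)) Y V y) (Z y)) x +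
        dirDeriv X (fun y => g.val y (V y) (mlieBracket (𝓡 (m + 2)) Y Z y)) x := by
    intro X Y hY h
    rw [← dirDeriv_add ((hY.mlieBracket hV').metric_apply hZ')
      (hV'.metric_apply (hY.mlieBracket hZ'))]
    refine dirDeriv_congr ?_
    filter_upwards [h] with y hy
    rw [lieDerivAux_eq] at hy
    linarith
  have hf : ∀ᶠ y in 𝓝 x, SmoothFunctionAt m (fun y => g.val y (V y) (Z y)) y := by
    filter_upwards [hV, hZ] with y k1 k2
    exact k1.metric_apply k2
  rw [lieDerivAux_eq] at h3 h4 h5 h6 ⊢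
  rw [dirDeriv_mlieBracket g hX hY hf, key X Y hY' h2, key Y X hX' h1]
  have j1 := congrArg (fun v => g.val x v (Z x)) (jacobi_mlieBracket hX' hY' hV')
  have j2 := congrArg (fun v => g.val x (V x) v) (jacobi_mlieBracket hX' hY' hZ')
  simp only [map_add, _root_.add_apply] at j1 j2
  linear_combination h3 + h4 - h5 - h6 + j1 + j2

lemma lieDeriv_eq (hV : SmoothFieldAt V x) (hZ : SmoothFieldAt Z x) :
    g.lieDeriv X x (V x) (Z x) = g.lieDerivAux X x V Z :=
  g.lieDeriv_apply X x hV.fieldDiffAt hZ.fieldDiffAt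

lemma exists_extension (v : Tan m x) :
    ∃ V : ∀ x : M, Tan m x, (∀ᶠ y in 𝓝 x, SmoothFieldAt V y) ∧ V x = v :=
  ⟨FiberBundle.extend (Mod m) v, eventually_smoothFieldAt_extend v,
    FiberBundle.extend_apply_self _ _⟩

lemma lieDeriv_symm (v w : Tan m x) : g.lieDeriv X x v w = g.lieDeriv X x w v := by
  obtain ⟨V, hV, rfl⟩ := exists_extension v
  obtain ⟨W, hW, rfl⟩ := exists_extension w
  rw [lieDeriv_eq hV.self_of_nhds hW.self_of_nhds, lieDeriv_eq hW.self_of_nhds hV.self_of_nhds,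
    g.lieDerivAux_symm]

lemma lieDeriv_add (hX : SmoothFieldAt X x) (hY : SmoothFieldAt Y x) (v w : Tan m x) :
    g.lieDeriv (fun y => X y + Y y) x v w = g.lieDeriv X x v w + g.lieDeriv Y x v w := by
  obtain ⟨V, hV, rfl⟩ := exists_extension v
  obtain ⟨W, hW, rfl⟩ := exists_extension w
  have hV := hV.self_of_nhds
  have hW := hW.self_of_nhds
  have e : ∀ Z : ∀ x : M, Tan m x, mlieBracket (𝓡 (m + 2)) (fun y => X y + Y y) Z x =
      mlieBracket (𝓡 (m + 2)) X Z x + mlieBracket (𝓡 (m + 2)) Y Z x :=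
    fun Z => mlieBracket_add_left hX.fieldDiffAt hY.fieldDiffAt
  simp only [lieDeriv_eq hV hW, lieDerivAux_eq, e, dirDeriv, map_add, _root_.add_apply]
  ring

lemma lieDeriv_smul (c : ℝ) (hX : SmoothFieldAt X x) (v w : Tan m x) :
    g.lieDeriv (fun y => c • X y) x v w = c * g.lieDeriv X x v w := by
  obtain ⟨V, hV, rfl⟩ := exists_extension v
  obtain ⟨W, hW, rfl⟩ := exists_extension w
  have hV := hV.self_of_nhds
  have hW := hW.self_of_nhds
  have e : ∀ Z : ∀ x : M, Tan m x, mlieBracket (𝓡 (m + 2)) (fun y => c • X y) Z x =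
      c • mlieBracket (𝓡 (m + 2)) X Z x :=
    fun Z => mlieBracket_const_smul_left hX.fieldDiffAt
  simp only [lieDeriv_eq hV hW, lieDerivAux_eq, e, dirDeriv, map_smul, _root_.smul_apply,
    smul_eq_mul]
  ring

end LieDerivative

/-! ### The algebra preserving nil-Killing fields form a Lie algebra. -/

section LieSubalgebra

variable {m : ℕ} {M : Type*} [TopologicalSpace M] [ChartedSpace (Mod m) M]
  [IsManifold (𝓡 (m + 2)) ∞ M] {g : LorentzianMetric m M}
  {line : ∀ x : M, Submodule ℝ (Tan m x)}

/-- The field of subspaces `line` is a field of lines, and near each point there is a smooth local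
frame field that is adapted to the metric and to `line`. -/
structure HasAdaptedFrames (g : LorentzianMetric m M) (line : ∀ x : M, Submodule ℝ (Tan m x)) :
    Prop where
  finrank_eq_one : ∀ x, Module.finrank ℝ (line x) = 1
  exists_frame : ∀ p : M, ∃ U : Set M, IsOpen U ∧ p ∈ U ∧ ∃ s : ∀ x : M, Frame m x,
    (∀ x ∈ U, IsAdapted g line x (s x)) ∧ ∀ v, SmoothFieldOn (fun x => s x v) U

lemma HasAdaptedFrames.isNilKilling_iff (h : HasAdaptedFrames g line) (X : Fields m M) :
    g.IsNilKilling line X ↔ ∀ x, (∀ v ∈ line x, ∀ z, g.lieDeriv X x v z = 0) ∧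
      ∀ w ∈ g.perp x (line x), ∀ w' ∈ g.perp x (line x), g.lieDeriv X x w w' = 0 := by
  refine forall_congr' fun x => ?_
  obtain ⟨U, -, hx, s, hs, -⟩ := h.exists_frame x
  have hsx := hs x hx
  refine isTypeIII_iff (hsx.line_eq (h.finrank_eq_one x)) ?_ (l := s x (lvec m)) ?_ _
    fun v w => lieDeriv_symm v w
  · rw [hsx.kvec_left, eta_kvec_left, kvec_one]
  · rw [hsx.kvec_left, eta_kvec_left]
    simp [lvec]

/-- An algebra preserving nil-Killing field preserves the orthogonal complement of the line. -/
lemma HasAdaptedFrames.mlieBracket_mem_perp (h : HasAdaptedFrames g line) {X : Fields m M}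
    (hX : X ∈ g.algebraPreservingNilKilling line) {U : Set M} {W : ∀ x : M, Tan m x}
    (hU : IsOpen U) (hW : SmoothFieldOn W U) (hWp : ∀ x ∈ U, W x ∈ g.perp x (line x)) {x : M}
    (hx : x ∈ U) : mlieBracket (𝓡 (m + 2)) X W x ∈ g.perp x (line x) := by
  obtain ⟨U', hU', hx', s, hs, hsm⟩ := h.exists_frame x
  have hsx := hs x hx'
  rw [hsx.line_eq (h.finrank_eq_one x), mem_perp_span_iff]
  have hK := (hsm (kvec m)).smoothFieldAt hU' hx'
  have hW' := hW.smoothFieldAt hU hx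
  have h1 := ((h.isNilKilling_iff X).1 hX.1 x).1 _ hsx.mem (W x)
  rw [lieDeriv_eq (V := fun x => s x (kvec m)) hK hW', lieDerivAux_eq] at h1
  have h2 : dirDeriv X (fun y => g.val y (s y (kvec m)) (W y)) x = 0 := by
    rw [dirDeriv_congr (f' := fun _ => (0 : ℝ))]
    · simp only [dirDeriv, mvfderiv_const]
      rfl
    · filter_upwards [hU.mem_nhds hx, hU'.mem_nhds hx'] with y hy hy'
      exact hWp y hy _ (hs y hy').mem
  -- In `(L_X g)(K, W) = 0` the product `g(K, W)` is locally zero and `[X, K] ∈ λ` is orthogonal to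
  -- `W`; what remains is `g(K, [X, W]) = 0`.
  have h3 := hX.2 U' (fun x => s x (kvec m)) hU' (hsm _) (fun y hy => (hs y hy).mem) x hx'
  have h4 := hWp x hx _ h3
  rw [h2, h4] at h1
  linarith

lemma SmoothFieldOn.bracket {X : Fields m M} {Y : ∀ x : M, Tan m x} {U : Set M} (hU : IsOpen U)
    (hY : SmoothFieldOn Y U) : SmoothFieldOn (mlieBracket (𝓡 (m + 2)) X Y) U := fun x hx =>
  ContMDiffAt.contMDiffWithinAt ((X.smoothFieldAt x).mlieBracket (hY.smoothFieldAt hU hx))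

/-- Tested on adapted frame fields, all terms of `L_X L_Y g - L_Y L_X g` vanish: bracketing with `X`
or `Y` keeps sections of `λ` in `λ` and sections of `λ^⊥` in `λ^⊥`, so the arguments never leave the
pairs on which `L_X g` and `L_Y g` are zero. Invariance of `λ` under the bracket is the Jacobi
identity. -/
lemma HasAdaptedFrames.bracket_mem (h : HasAdaptedFrames g line) {X Y : Fields m M}
    (hX : X ∈ g.algebraPreservingNilKilling line) (hY : Y ∈ g.algebraPreservingNilKilling line) :
    ⁅X, Y⁆ ∈ g.algebraPreservingNilKilling line := by
  have hX1 := (h.isNilKilling_iff X).1 hX.1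
  have hY1 := (h.isNilKilling_iff Y).1 hY.1
  constructor
  · rw [h.isNilKilling_iff]
    intro x
    obtain ⟨U, hU, hx, s, hs, hsm⟩ := h.exists_frame x
    have hline := h.finrank_eq_one x
    have hev : ∀ᶠ y in 𝓝 x, y ∈ U := hU.mem_nhds hx
    have hsev : ∀ v, ∀ᶠ y in 𝓝 x, SmoothFieldAt (fun x => s x v) y := fun v => by
      filter_upwards [hev] with y hy
      exact (hsm v).smoothFieldAt hU hy
    have main : ∀ v w : Vec m,
        (∀ X ∈ g.algebraPreservingNilKilling line, ∀ y ∈ U,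
          g.lieDerivAux X y (fun x => s x v) (fun x => s x w) = 0) →
        (∀ X ∈ g.algebraPreservingNilKilling line, ∀ Y ∈ g.algebraPreservingNilKilling line,
          g.lieDerivAux X x (mlieBracket (𝓡 (m + 2)) Y fun x => s x v) (fun x => s x w) = 0 ∧
          g.lieDerivAux X x (fun x => s x v) (mlieBracket (𝓡 (m + 2)) Y fun x => s x w) = 0) →
        g.lieDeriv (⁅X, Y⁆ : Fields m M) x (s x v) (s x w) = 0 := by
      intro v w h1 h2
      rw [lieDeriv_eq (V := fun x => s x v) (Z := fun x => s x w) (hsev v).self_of_nhds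
        (hsev w).self_of_nhds, coe_bracket]
      exact lieDerivAux_mlieBracket_eq_zero (.of_forall X.smoothFieldAt)
        (.of_forall Y.smoothFieldAt) (hsev v) (hsev w) (hev.mono (h1 X hX)) (hev.mono (h1 Y hY))
        (h2 X hX Y hY).1 (h2 X hX Y hY).2 (h2 Y hY X hX).1 (h2 Y hY X hX).2
    constructor
    · intro v hv z
      rw [(hs x hx).line_eq hline] at hv
      obtain ⟨c, rfl⟩ := Submodule.mem_span_singleton.1 hv
      obtain ⟨z, rfl⟩ := (s x).surjective z
      rw [map_smul, _root_.smul_apply, main (kvec m) z, smul_zero]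
      · intro X hX y hy
        rw [← lieDeriv_eq (V := fun x => s x (kvec m)) (Z := fun x => s x z)
          ((hsm _).smoothFieldAt hU hy) ((hsm _).smoothFieldAt hU hy)]
        exact ((h.isNilKilling_iff X).1 hX.1 y).1 _ (hs y hy).mem _
      · intro X hX Y hY
        have k1 := (hsev (kvec m)).self_of_nhds
        have k2 := (hsev z).self_of_nhds
        have hX1 := (h.isNilKilling_iff X).1 hX.1 x
        rw [← lieDeriv_eq ((Y.smoothFieldAt x).mlieBracket k1) k2,
          ← lieDeriv_eq k1 ((Y.smoothFieldAt x).mlieBracket k2)]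
        exact ⟨hX1.1 _ (hY.2 U _ hU (hsm _) (fun y hy => (hs y hy).mem) x hx) _,
          hX1.1 _ (hs x hx).mem _⟩
    · intro w hw w' hw'
      obtain ⟨w, rfl⟩ := (s x).surjective w
      obtain ⟨w', rfl⟩ := (s x).surjective w'
      rw [(hs x hx).mem_perp_iff hline] at hw hw'
      have hp : ∀ w, eta (kvec m) w = 0 → ∀ y ∈ U, s y w ∈ g.perp y (line y) := fun w hw y hy =>
        ((hs y hy).mem_perp_iff (h.finrank_eq_one y) w).2 hw
      refine main w w' ?_ ?_
      · intro X hX y hy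
        rw [← lieDeriv_eq (V := fun x => s x w) (Z := fun x => s x w')
          ((hsm _).smoothFieldAt hU hy) ((hsm _).smoothFieldAt hU hy)]
        exact ((h.isNilKilling_iff X).1 hX.1 y).2 _ (hp w hw y hy) _ (hp w' hw' y hy)
      · intro X hX Y hY
        have k1 := (hsev w).self_of_nhds
        have k2 := (hsev w').self_of_nhds
        have hX1 := (h.isNilKilling_iff X).1 hX.1 x
        rw [← lieDeriv_eq ((Y.smoothFieldAt x).mlieBracket k1) k2,
          ← lieDeriv_eq k1 ((Y.smoothFieldAt x).mlieBracket k2)]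
        exact ⟨hX1.2 _ (h.mlieBracket_mem_perp hY hU (hsm w) (hp w hw) hx) _ (hp w' hw' x hx),
          hX1.2 _ (hp w hw x hx) _ (h.mlieBracket_mem_perp hY hU (hsm w') (hp w' hw') hx)⟩
  · intro U V hU hV hVl x hx
    have hj := jacobi_mlieBracket (X.smoothFieldAt x) (Y.smoothFieldAt x) (hV.smoothFieldAt hU hx)
    rw [coe_bracket, ← add_sub_cancel_right (mlieBracket _ (mlieBracket _ X Y) V x)
      (mlieBracket (𝓡 (m + 2)) Y (mlieBracket (𝓡 (m + 2)) X V) x), ← hj]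
    exact Submodule.sub_mem _
      (hX.2 U _ hU (hV.bracket hU) (fun y hy => hY.2 U V hU hV hVl y hy) x hx)
      (hY.2 U _ hU (hV.bracket hU) (fun y hy => hX.2 U V hU hV hVl y hy) x hx)

/-- The Lie algebra of algebra preserving nil-Killing fields. -/
def nilKillingSubalgebra (h : HasAdaptedFrames g line) : LieSubalgebra ℝ (Fields m M) where
  carrier := g.algebraPreservingNilKilling line
  zero_mem' := by
    refine ⟨(h.isNilKilling_iff _).2 fun x => ?_, fun U Y hU hY hYl x hx => ?_⟩
    · have : ∀ v w : Tan m x, g.lieDeriv (0 : Fields m M) x v w = 0 := fun v w => by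
        have := lieDeriv_smul (g := g) (0 : ℝ) ((0 : Fields m M).smoothFieldAt x) v w
        rw [zero_mul] at this
        rw [← this]
        congr 3
        ext y
        simp
      exact ⟨fun v _ z => this v z, fun w _ w' _ => this w w'⟩
    · rw [ContMDiffSection.coe_zero, mlieBracket_zero_left]
      exact Submodule.zero_mem _
  add_mem' := by
    rintro X Y ⟨hX, hX'⟩ ⟨hY, hY'⟩
    rw [h.isNilKilling_iff] at hX hY
    refine ⟨(h.isNilKilling_iff _).2 fun x => ?_, fun U V hU hV hVl x hx => ?_⟩
    · have : ∀ v w : Tan m x, g.lieDeriv (X + Y : Fields m M) x v w =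
          g.lieDeriv X x v w + g.lieDeriv Y x v w :=
        lieDeriv_add (X.smoothFieldAt x) (Y.smoothFieldAt x)
      exact ⟨fun v hv z => by rw [this, (hX x).1 v hv, (hY x).1 v hv, add_zero],
        fun w hw w' hw' => by rw [this, (hX x).2 w hw w' hw', (hY x).2 w hw w' hw', add_zero]⟩
    · have e : mlieBracket (𝓡 (m + 2)) (X + Y : Fields m M) V x =
          mlieBracket (𝓡 (m + 2)) X V x + mlieBracket (𝓡 (m + 2)) Y V x :=
        mlieBracket_add_left X.mdifferentiableAt Y.mdifferentiableAt
      rw [e]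
      exact Submodule.add_mem _ (hX' U V hU hV hVl x hx) (hY' U V hU hV hVl x hx)
  smul_mem' := by
    rintro c X ⟨hX, hX'⟩
    rw [h.isNilKilling_iff] at hX
    refine ⟨(h.isNilKilling_iff _).2 fun x => ?_, fun U V hU hV hVl x hx => ?_⟩
    · have : ∀ v w : Tan m x, g.lieDeriv (c • X : Fields m M) x v w = c * g.lieDeriv X x v w :=
        lieDeriv_smul c (X.smoothFieldAt x)
      exact ⟨fun v hv z => by rw [this, (hX x).1 v hv, mul_zero],
        fun w hw w' hw' => by rw [this, (hX x).2 w hw w' hw', mul_zero]⟩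
    · have e : mlieBracket (𝓡 (m + 2)) (c • X : Fields m M) V x =
          c • mlieBracket (𝓡 (m + 2)) X V x := mlieBracket_const_smul_left X.mdifferentiableAt
      rw [e]
      exact Submodule.smul_mem _ _ (hX' U V hU hV hVl x hx)
  lie_mem' := h.bracket_mem

end LieSubalgebra

/-! ### Chart formulas for brackets and for derivatives along integral curves. -/

section Coordinates

variable {m : ℕ} {M : Type*} [TopologicalSpace M] [ChartedSpace (Mod m) M]
  [IsManifold (𝓡 (m + 2)) ∞ M] {g : LorentzianMetric m M}

instance : IsManifold (𝓡 (m + 2)) 1 M := IsManifold.of_le (n := ∞) (by simp)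

instance : IsManifold (𝓡 (m + 2)) 2 M :=
  IsManifold.of_le (n := ∞) (WithTop.coe_le_coe.2 (le_top : (2 : ℕ∞) ≤ ⊤))

/-- The representation of the vector field `X` in the preferred chart at `p`. -/
def chartField (p : M) (X : ∀ x : M, TangentSpace (𝓡 (m + 2)) x) : Mod m → Mod m :=
  mpullbackWithin 𝓘(ℝ, Mod m) (𝓡 (m + 2)) (extChartAt (𝓡 (m + 2)) p).symm X (range (𝓡 (m + 2)))

/-- The coordinates of tangent vectors at `y` with respect to the preferred chart at `p`. -/
def coordVec (p y : M) : TangentSpace (𝓡 (m + 2)) y →L[ℝ] Mod m :=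
  mfderiv (𝓡 (m + 2)) 𝓘(ℝ, Mod m) (extChartAt (𝓡 (m + 2)) p) y

/-- The field with constant coordinates `a` in the preferred chart at `p`. -/
def coordField (p : M) (a : Mod m) (y : M) : TangentSpace (𝓡 (m + 2)) y :=
  (trivializationAt (Mod m) (TangentSpace (𝓡 (m + 2))) p).symmL ℝ y a

lemma coordVec_self (p : M) (v : TangentSpace (𝓡 (m + 2)) p) : coordVec p p v = v := by
  rw [coordVec, mfderiv_extChartAt_self]
  rfl

lemma coordVec_eq {p y : M} (hy : y ∈ (chartAt (Mod m) p).source) :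
    coordVec p y =
      (trivializationAt (Mod m) (TangentSpace (𝓡 (m + 2))) p).continuousLinearMapAt ℝ y :=
  (TangentBundle.continuousLinearMapAt_trivializationAt hy).symm

lemma coordField_coordVec {p y : M} (hy : y ∈ (chartAt (Mod m) p).source)
    (v : TangentSpace (𝓡 (m + 2)) y) : coordField p (coordVec p y v) y = v := by
  rw [coordVec_eq hy]
  exact Trivialization.symmL_continuousLinearMapAt _ (by simpa using hy) v

lemma coordVec_coordField {p y : M} (hy : y ∈ (chartAt (Mod m) p).source) (a : Mod m) :
    coordVec p y (coordField p a y) = a := by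
  rw [coordVec_eq hy]
  exact Trivialization.continuousLinearMapAt_symmL _ (by simpa using hy) a

lemma coordField_self (p : M) (a : Mod m) : coordField p a p = a := by
  rw [← coordVec_self p (coordField p a p), coordVec_coordField (mem_chart_source _ p)]

lemma eventually_smoothFieldAt_coordField (p : M) (a : Mod m) :
    ∀ᶠ y in 𝓝 p, SmoothFieldAt (coordField p a) y := by
  have h := eventually_smoothFieldAt_extend (m := m) (x := p) a
  have hp := coordVec_self p a
  rw [coordVec_eq (mem_chart_source _ p), Trivialization.continuousLinearMapAt_apply,
    Trivialization.coe_linearMapAt_of_mem _ (FiberBundle.mem_baseSet_trivializationAt' p)] at hp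
  have hp' : (trivializationAt (Mod m) (TangentSpace (𝓡 (m + 2))) p
    (⟨p, a⟩ : TangentBundle (𝓡 (m + 2)) M)).2 = a := hp
  have hs := (chartAt (Mod m) p).open_source.mem_nhds (mem_chart_source _ p)
  filter_upwards [h, eventually_mem_nhds_iff.2 hs] with y h1 h2
  refine h1.congr ?_
  filter_upwards [h2] with z hz
  rw [coordField, Trivialization.symmL_apply _ (by simpa using hz)]
  exact congrArg ((trivializationAt (Mod m) (TangentSpace (𝓡 (m + 2))) p).symm z) hp'.symm

lemma chartField_of_mem_target {p : M} {z : Mod m} (hz : z ∈ (extChartAt (𝓡 (m + 2)) p).target)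
    (X : ∀ x : M, TangentSpace (𝓡 (m + 2)) x) :
    chartField p X z = coordVec p ((extChartAt (𝓡 (m + 2)) p).symm z)
      (X ((extChartAt (𝓡 (m + 2)) p).symm z)) := by
  have h := mfderivWithin_extChartAt_symm_comp_mfderiv_extChartAt (I := 𝓡 (m + 2)) hz
  obtain ⟨e, he⟩ := isInvertible_mfderivWithin_extChartAt_symm (I := 𝓡 (m + 2)) hz
  have h1 := DFunLike.congr_fun h (X ((extChartAt (𝓡 (m + 2)) p).symm z))
  rw [chartField, mpullbackWithin_apply]
  rw [← he] at h1 ⊢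
  rw [ContinuousLinearMap.inverse_equiv]
  exact (e.symm_apply_eq).2 h1.symm

lemma chartField_apply {p y : M} (hy : y ∈ (chartAt (Mod m) p).source)
    (X : ∀ x : M, TangentSpace (𝓡 (m + 2)) x) :
    chartField p X (extChartAt (𝓡 (m + 2)) p y) = coordVec p y (X y) := by
  have hy' : y ∈ (extChartAt (𝓡 (m + 2)) p).source := by rwa [extChartAt_source]
  have h := chartField_of_mem_target ((extChartAt (𝓡 (m + 2)) p).map_source hy') X
  rwa [(extChartAt (𝓡 (m + 2)) p).left_inv hy'] at h

lemma differentiableAt_chartField {p : M} {X : ∀ x : M, TangentSpace (𝓡 (m + 2)) x}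
    (hX : FieldDiffAt X p) : DifferentiableAt ℝ (chartField p X) (extChartAt (𝓡 (m + 2)) p p) := by
  have := MDifferentiableWithinAt.differentiableWithinAt_mpullbackWithin_vectorField (s := univ)
    (mdifferentiableWithinAt_univ.2 hX)
  rw [preimage_univ, univ_inter] at this
  refine differentiableWithinAt_univ.1 ?_
  rw [← ModelWithCorners.range_eq_univ (𝓡 (m + 2))]
  exact this

/-- At its centre the preferred chart has the identity as derivative, so the bracket there is the
flat formula `DY(X) - DX(Y)` with no transformation of the result. -/
lemma mlieBracket_eq_chartField (p : M) (X Y : ∀ x : M, TangentSpace (𝓡 (m + 2)) x) :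
    (mlieBracket (𝓡 (m + 2)) X Y p : Mod m) =
      fderiv ℝ (chartField p Y) (extChartAt (𝓡 (m + 2)) p p) (X p) -
      fderiv ℝ (chartField p X) (extChartAt (𝓡 (m + 2)) p p) (Y p) := by
  have hinv : ∀ v : Mod m, (ContinuousLinearMap.id ℝ (Mod m)).inverse v = v := by simp
  have h1 := chartField_apply (mem_chart_source _ p) X
  have h2 := chartField_apply (mem_chart_source _ p) Y
  rw [coordVec_self] at h1 h2
  rw [← mlieBracketWithin_univ, mlieBracketWithin_apply, mfderiv_extChartAt_self]
  refine (hinv _).trans ?_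
  rw [← h1, ← h2, preimage_univ, univ_inter, ← fderivWithin_univ, ← fderivWithin_univ,
    ← ModelWithCorners.range_eq_univ (𝓡 (m + 2))]
  rfl

lemma mlieBracket_coordField (p : M) (X : ∀ x : M, TangentSpace (𝓡 (m + 2)) x) (a : Mod m) :
    (mlieBracket (𝓡 (m + 2)) X (coordField p a) p : Mod m) =
      -fderiv ℝ (chartField p X) (extChartAt (𝓡 (m + 2)) p p) a := by
  have : chartField p (coordField p a) =ᶠ[𝓝 (extChartAt (𝓡 (m + 2)) p p)] fun _ => a := by
    filter_upwards [extChartAt_target_mem_nhds (I := 𝓡 (m + 2)) p] with z hz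
    have h1 := (extChartAt (𝓡 (m + 2)) p).map_target hz
    have h2 := (extChartAt (𝓡 (m + 2)) p).right_inv hz
    rw [extChartAt_source] at h1
    rw [← h2, chartField_apply h1, coordVec_coordField h1]
  rw [mlieBracket_eq_chartField, coordField_self, this.fderiv_eq, fderiv_fun_const]
  exact zero_sub (_ : Mod m)

/-- Bilinear forms in terms of the standard basis. -/
lemma bilin_eq_sum (B : Mod m →L[ℝ] Mod m →L[ℝ] ℝ) (v w : Mod m) :
    B v w = ∑ i, ∑ j, v i * w j * B (EuclideanSpace.single i 1) (EuclideanSpace.single j 1) := by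
  have h : ∀ v : Mod m, v = ∑ i, v i • EuclideanSpace.single i (1 : ℝ) := fun v => by
    conv_lhs => rw [← (EuclideanSpace.basisFun (Fin (m + 2)) ℝ).sum_repr v]
    simp
  conv_lhs => rw [h v, h w]
  simp only [map_sum, map_smul, _root_.smul_apply, _root_.sum_apply, smul_eq_mul, Finset.mul_sum]
  rw [Finset.sum_comm]
  refine Finset.sum_congr rfl fun i _ => Finset.sum_congr rfl fun j _ => ?_
  ring

/-- The product rule for `∑ aⁱ bʲ γᵢⱼ`. The hypothesis on `γ` is what the definition of `L_X g`
gives for constant coordinate fields, whose bracket with `X` is minus the derivative `D` of `X`; the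
`D` terms are then absorbed into the derivatives of `a` and `b`. -/
lemma hasDerivAt_bilin_coordinates {s₀ : ℝ} {a b : ℝ → Mod m} {a' b' : Mod m}
    (ha : HasDerivAt a a' s₀) (hb : HasDerivAt b b' s₀) (L G : Mod m →L[ℝ] Mod m →L[ℝ] ℝ)
    (D : Mod m →L[ℝ] Mod m) {γ : Fin (m + 2) → Fin (m + 2) → ℝ → ℝ}
    (hγ₀ : ∀ i j, γ i j s₀ = G (EuclideanSpace.single i 1) (EuclideanSpace.single j 1))
    (hγ : ∀ i j, HasDerivAt (γ i j) (L (EuclideanSpace.single i 1) (EuclideanSpace.single j 1) -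
      G (D (EuclideanSpace.single i 1)) (EuclideanSpace.single j 1) -
      G (EuclideanSpace.single i 1) (D (EuclideanSpace.single j 1))) s₀) :
    HasDerivAt (fun s => ∑ i, ∑ j, a s i * b s j * γ i j s)
      (L (a s₀) (b s₀) + G (a' - D (a s₀)) (b s₀) + G (a s₀) (b' - D (b s₀))) s₀ := by
  have hcoord : ∀ {a : ℝ → Mod m} {a' : Mod m}, HasDerivAt a a' s₀ → ∀ i,
      HasDerivAt (fun s => a s i) (a' i) s₀ := fun {a a'} h i =>
    ((EuclideanSpace.proj i : Mod m →L[ℝ] ℝ).hasFDerivAt).comp_hasDerivAt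
      s₀ h
  refine (HasDerivAt.fun_sum fun i _ => HasDerivAt.fun_sum fun j _ =>
    ((hcoord ha i).mul (hcoord hb j)).mul (hγ i j)).congr_deriv ?_
  have h1 := bilin_eq_sum L (a s₀) (b s₀)
  have h2 := bilin_eq_sum G a' (b s₀)
  have h3 := bilin_eq_sum G (a s₀) b'
  have h4 := bilin_eq_sum (G.comp D) (a s₀) (b s₀)
  have h5 := bilin_eq_sum (G.bilinearComp (.id ℝ _) D) (a s₀) (b s₀)
  have h6 : L (a s₀) (b s₀) + G (a' - D (a s₀)) (b s₀) + G (a s₀) (b' - D (b s₀)) =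
      L (a s₀) (b s₀) + (G a' (b s₀) - (G.comp D) (a s₀) (b s₀)) +
        (G (a s₀) b' - (G.bilinearComp (.id ℝ _) D) (a s₀) (b s₀)) := by
    simp
  rw [h6, h1, h2, h3, h4, h5]
  simp only [← Finset.sum_sub_distrib, ← Finset.sum_add_distrib]
  refine Finset.sum_congr rfl fun i _ => Finset.sum_congr rfl fun j _ => ?_
  simp [hγ₀]
  ring

variable {X Y : ∀ x : M, TangentSpace (𝓡 (m + 2)) x} {c : ℝ → M} {s₀ : ℝ}

lemma hasDerivAt_comp_integralCurve {f : M → ℝ}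
    (hc : HasMFDerivAt 𝓘(ℝ, ℝ) (𝓡 (m + 2)) c s₀ ((1 : ℝ →L[ℝ] ℝ).smulRight (X (c s₀))))
    (hf : SmoothFunctionAt m f (c s₀)) :
    HasDerivAt (fun s => f (c s)) (dirDeriv X f (c s₀)) s₀ := by
  let T : Mod m →L[ℝ] ℝ := mfderiv (𝓡 (m + 2)) 𝓘(ℝ, ℝ) f (c s₀)
  let w : Mod m := X (c s₀)
  have h : HasFDerivAt (fun s => f (c s)) (T.comp ((1 : ℝ →L[ℝ] ℝ).smulRight w)) s₀ :=
    (hf.mdifferentiableAt.hasMFDerivAt.comp s₀ hc).hasFDerivAt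
  refine h.hasDerivAt.congr_deriv ?_
  have : T ((1 : ℝ) • w) = dirDeriv X f (c s₀) := by
    rw [one_smul]
    rfl
  exact this

/-- The derivative of the scalar product of two vector fields along an integral curve of `X`. -/
lemma hasDerivAt_metric_along
    (hc : HasMFDerivAt 𝓘(ℝ, ℝ) (𝓡 (m + 2)) c s₀ ((1 : ℝ →L[ℝ] ℝ).smulRight (X (c s₀))))
    {V W : ∀ s, TangentSpace (𝓡 (m + 2)) (c s)} {V' W' : Mod m}
    (hV : HasDerivAt (fun s => coordVec (c s₀) (c s) (V s)) V' s₀)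
    (hW : HasDerivAt (fun s => coordVec (c s₀) (c s) (W s)) W' s₀)
    {v w : TangentSpace (𝓡 (m + 2)) (c s₀)}
    (hv : v = V' - fderiv ℝ (chartField (c s₀) X) (extChartAt (𝓡 (m + 2)) (c s₀) (c s₀)) (V s₀))
    (hw : w = W' - fderiv ℝ (chartField (c s₀) X) (extChartAt (𝓡 (m + 2)) (c s₀) (c s₀)) (W s₀)) :
    HasDerivAt (fun s => g.val (c s) (V s) (W s))
      (g.lieDeriv X (c s₀) (V s₀) (W s₀) + g.val (c s₀) v (W s₀) + g.val (c s₀) (V s₀) w) s₀ := by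
  let D : Mod m →L[ℝ] Mod m :=
    fderiv ℝ (chartField (c s₀) X) (extChartAt (𝓡 (m + 2)) (c s₀) (c s₀))
  let G : Mod m →L[ℝ] Mod m →L[ℝ] ℝ := g.val (c s₀)
  let L : Mod m →L[ℝ] Mod m →L[ℝ] ℝ := g.lieDeriv X (c s₀)
  have he : ∀ a : Mod m, SmoothFieldAt (coordField (c s₀) a) (c s₀) := fun a =>
    (eventually_smoothFieldAt_coordField (c s₀) a).self_of_nhds
  have hsrc : ∀ᶠ s in 𝓝 s₀, c s ∈ (chartAt (Mod m) (c s₀)).source :=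
    hc.continuousAt.preimage_mem_nhds
      ((chartAt (Mod m) (c s₀)).open_source.mem_nhds (mem_chart_source _ (c s₀)))
  have hexp : ∀ᶠ s in 𝓝 s₀, g.val (c s) (V s) (W s) = ∑ i, ∑ j,
      coordVec (c s₀) (c s) (V s) i * coordVec (c s₀) (c s) (W s) j *
        g.val (c s) (coordField (c s₀) (EuclideanSpace.single i 1) (c s))
          (coordField (c s₀) (EuclideanSpace.single j 1) (c s)) := by
    filter_upwards [hsrc] with s hs
    let T : Mod m →L[ℝ] Mod m :=
      (trivializationAt (Mod m) (TangentSpace (𝓡 (m + 2))) (c s₀)).symmL ℝ (c s)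
    let G' : Mod m →L[ℝ] Mod m →L[ℝ] ℝ := g.val (c s)
    have := bilin_eq_sum (G'.bilinearComp T T) (coordVec (c s₀) (c s) (V s))
      (coordVec (c s₀) (c s) (W s))
    conv_lhs => rw [← coordField_coordVec hs (V s), ← coordField_coordVec hs (W s)]
    exact this
  refine HasDerivAt.congr_of_eventuallyEq ((hasDerivAt_bilin_coordinates hV hW L G D
    ?_ ?_).congr_deriv
    ?_) hexp
  · intro i j
    rw [coordField_self, coordField_self]
    rfl
  · intro i j
    refine (hasDerivAt_comp_integralCurve hc (SmoothFieldAt.metric_apply (g := g)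
      (he (EuclideanSpace.single i 1)) (he (EuclideanSpace.single j 1)))).congr_deriv ?_
    have h := lieDeriv_eq (g := g) (X := X) (he (EuclideanSpace.single i 1))
      (he (EuclideanSpace.single j 1))
    rw [lieDerivAux_eq, mlieBracket_coordField, mlieBracket_coordField, coordField_self,
      coordField_self] at h
    have h' : L (EuclideanSpace.single i 1) (EuclideanSpace.single j 1) = dirDeriv X _ _ -
      G (-(D (EuclideanSpace.single i 1))) (EuclideanSpace.single j 1) -
      G (EuclideanSpace.single i 1) (-(D (EuclideanSpace.single j 1))) := h
    simp only [map_neg, _root_.neg_apply] at h'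
    linarith
  · rw [coordVec_self, coordVec_self, hv, hw]
    rfl

lemma hasDerivAt_chart_comp {p : M} (hp : c s₀ ∈ (chartAt (Mod m) p).source)
    (hc : HasMFDerivAt 𝓘(ℝ, ℝ) (𝓡 (m + 2)) c s₀ ((1 : ℝ →L[ℝ] ℝ).smulRight (X (c s₀)))) :
    HasDerivAt (fun s => extChartAt (𝓡 (m + 2)) p (c s)) (coordVec p (c s₀) (X (c s₀))) s₀ := by
  let T : Mod m →L[ℝ] Mod m := coordVec p (c s₀)
  let w : Mod m := X (c s₀)
  have h : HasFDerivAt (fun s => extChartAt (𝓡 (m + 2)) p (c s))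
      (T.comp ((1 : ℝ →L[ℝ] ℝ).smulRight w)) s₀ :=
    ((mdifferentiableAt_extChartAt hp).hasMFDerivAt.comp s₀ hc).hasFDerivAt
  refine h.hasDerivAt.congr_deriv ?_
  have : T ((1 : ℝ) • w) = T w := by rw [one_smul]
  exact this

lemma hasDerivAt_coordVec_field (hY : SmoothFieldAt Y (c s₀))
    (hc : HasMFDerivAt 𝓘(ℝ, ℝ) (𝓡 (m + 2)) c s₀ ((1 : ℝ →L[ℝ] ℝ).smulRight (X (c s₀)))) :
    HasDerivAt (fun s => coordVec (c s₀) (c s) (Y (c s)))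
      (fderiv ℝ (chartField (c s₀) Y) (extChartAt (𝓡 (m + 2)) (c s₀) (c s₀)) (X (c s₀))) s₀ := by
  have hsrc : ∀ᶠ s in 𝓝 s₀, c s ∈ (chartAt (Mod m) (c s₀)).source :=
    hc.continuousAt.preimage_mem_nhds
      ((chartAt (Mod m) (c s₀)).open_source.mem_nhds (mem_chart_source _ (c s₀)))
  have h := (differentiableAt_chartField hY.fieldDiffAt).hasFDerivAt.comp_hasDerivAt s₀
    (hasDerivAt_chart_comp (mem_chart_source _ (c s₀)) hc)
  rw [coordVec_self] at h
  refine HasDerivAt.congr_of_eventuallyEq h ?_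
  filter_upwards [hsrc] with s hs
  exact (chartField_apply hs Y).symm

/-- If the curves `s ↦ F (s, r)` are integral curves of a vector field, then the variation field
`∂F/∂r` solves the linearized equation. -/
lemma hasDerivAt_variation {E : Type*} [NormedAddCommGroup E] [NormedSpace ℝ E] {F : ℝ × ℝ → E}
    {s₀ : ℝ} (hF : ContDiffAt ℝ 2 F (s₀, 0)) {A : E → E} (hA : DifferentiableAt ℝ A (F (s₀, 0)))
    (h : ∀ᶠ r in 𝓝 (0 : ℝ), HasDerivAt (fun s => F (s, r)) (A (F (s₀, r))) s₀) {V : ℝ → E}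
    (hV : ∀ᶠ s in 𝓝 s₀, HasDerivAt (fun r => F (s, r)) (V s) 0) :
    HasDerivAt V (fderiv ℝ A (F (s₀, 0)) (V s₀)) s₀ := by
  have hdiff : ∀ᶠ q in 𝓝 (s₀, (0 : ℝ)), DifferentiableAt ℝ F q :=
    (hF.eventually (by simp)).mono fun q hq => hq.differentiableAt (by simp)
  -- Equality of mixed partial derivatives is the whole content: `∂_s ∂_r F = ∂_r ∂_s F = ∂_r (A ∘
  -- F)`.
  have hsymm := hF.isSymmSndFDerivAt (by simp)
  have hF' : DifferentiableAt ℝ (fderiv ℝ F) (s₀, 0) :=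
    (hF.fderiv_right (m := 1) (by norm_num)).differentiableAt (by simp)
  have hl : ∀ r, HasDerivAt (fun s : ℝ => (s, r)) ((1 : ℝ), (0 : ℝ)) s₀ := fun r =>
    (hasDerivAt_id s₀).prodMk (hasDerivAt_const s₀ r)
  have hr : ∀ s, HasDerivAt (fun r : ℝ => (s, r)) ((0 : ℝ), (1 : ℝ)) 0 := fun s =>
    (hasDerivAt_const 0 s).prodMk (hasDerivAt_id 0)
  have e1 : ∀ᶠ s in 𝓝 s₀, V s = fderiv ℝ F (s, 0) (0, 1) := by
    have : Filter.Tendsto (fun s : ℝ => (s, (0 : ℝ))) (𝓝 s₀) (𝓝 (s₀, 0)) :=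
      (hl 0).continuousAt
    filter_upwards [hV, this.eventually hdiff] with s h1 h2
    exact h1.unique (h2.hasFDerivAt.comp_hasDerivAt 0 (hr s))
  have e2 : ∀ᶠ r in 𝓝 (0 : ℝ), A (F (s₀, r)) = fderiv ℝ F (s₀, r) (1, 0) := by
    have : Filter.Tendsto (fun r : ℝ => (s₀, r)) (𝓝 0) (𝓝 (s₀, 0)) := (hr s₀).continuousAt
    filter_upwards [h, this.eventually hdiff] with r h1 h2
    exact h1.unique (h2.hasFDerivAt.comp_hasDerivAt s₀ (hl r))
  have d1 : HasDerivAt V (fderiv ℝ (fderiv ℝ F) (s₀, 0) (1, 0) (0, 1)) s₀ := by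
    refine HasDerivAt.congr_of_eventuallyEq ?_ e1
    exact (ContinuousLinearMap.apply ℝ E ((0 : ℝ), (1 : ℝ))).hasFDerivAt.comp_hasDerivAt s₀
      (hF'.hasFDerivAt.comp_hasDerivAt s₀ (hl 0))
  have d2 : HasDerivAt (fun r => A (F (s₀, r)))
      (fderiv ℝ (fderiv ℝ F) (s₀, 0) (0, 1) (1, 0)) 0 := by
    refine HasDerivAt.congr_of_eventuallyEq ?_ e2
    exact (ContinuousLinearMap.apply ℝ E ((1 : ℝ), (0 : ℝ))).hasFDerivAt.comp_hasDerivAt 0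
      (hF'.hasFDerivAt.comp_hasDerivAt 0 (hr s₀))
  have d3 : HasDerivAt (fun r => A (F (s₀, r))) (fderiv ℝ A (F (s₀, 0)) (V s₀)) 0 :=
    hA.hasFDerivAt.comp_hasDerivAt 0 hV.self_of_nhds
  rw [← d2.unique d3, ← hsymm.eq (1, 0) (0, 1)]
  exact d1

/-! ### Derivatives along the flow. -/

section Flow

variable {X : Fields m M} {D : Set (ℝ × M)} {φ : ℝ → M → M} {x : M}

lemma IsLocalFlow.hasMFDerivAt (h : IsLocalFlow X D φ) {t : ℝ} (hx : (t, x) ∈ D) :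
    HasMFDerivAt 𝓘(ℝ, ℝ) (𝓡 (m + 2)) (fun t => φ t x) t
      ((1 : ℝ →L[ℝ] ℝ).smulRight (X (φ t x))) := by
  refine (h.integral x t hx).hasMFDerivAt ?_
  exact (h.isOpen.preimage (by fun_prop : Continuous fun t : ℝ => (t, x))).mem_nhds hx

lemma IsLocalFlow.contMDiffAt (h : IsLocalFlow X D φ) {t : ℝ} (hx : (t, x) ∈ D) :
    ContMDiffAt (𝓘(ℝ, ℝ).prod (𝓡 (m + 2))) (𝓡 (m + 2)) ∞ (fun p : ℝ × M => φ p.1 p.2) (t, x) :=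
  h.smooth.contMDiffAt (h.isOpen.mem_nhds hx)

lemma IsLocalFlow.mdifferentiableAt (h : IsLocalFlow X D φ) {t : ℝ} (hx : (t, x) ∈ D) :
    MDifferentiableAt (𝓡 (m + 2)) (𝓡 (m + 2)) (φ t) x :=
  ((h.contMDiffAt hx).comp x (contMDiffAt_const.prodMk contMDiffAt_id)).mdifferentiableAt (by simp)

/-- The derivative of the flow solves the linearized equation. -/
lemma IsLocalFlow.hasDerivAt_mfderiv (h : IsLocalFlow X D φ) (hx : (s₀, x) ∈ D)
    (a : TangentSpace (𝓡 (m + 2)) x) :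
    HasDerivAt (fun s => coordVec (φ s₀ x) (φ s x) (mfderiv (𝓡 (m + 2)) (𝓡 (m + 2)) (φ s) x a))
      (fderiv ℝ (chartField (φ s₀ x) X) (extChartAt (𝓡 (m + 2)) (φ s₀ x) (φ s₀ x))
        (mfderiv (𝓡 (m + 2)) (𝓡 (m + 2)) (φ s₀) x a)) s₀ := by
  set p := φ s₀ x with hp
  let b : Mod m := a
  -- A curve through `x` with velocity `a`, which turns `dφ_s(a)` into the partial derivative in `r`
  -- of `φ_s (γ r)`.
  let γ : ℝ → M := fun r => (extChartAt (𝓡 (m + 2)) x).symm (extChartAt (𝓡 (m + 2)) x x + r • b)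
  have hγ0 : γ 0 = x := by simp [γ]
  have hχ : ContMDiffAt 𝓘(ℝ, Mod m) (𝓡 (m + 2)) ∞ (extChartAt (𝓡 (m + 2)) x).symm
      (extChartAt (𝓡 (m + 2)) x x) :=
    (contMDiffOn_extChartAt_symm x).contMDiffAt (extChartAt_target_mem_nhds x)
  have hlin : ContDiff ℝ ∞ fun r : ℝ => extChartAt (𝓡 (m + 2)) x x + r • b := by fun_prop
  have hγs : ContMDiffAt 𝓘(ℝ, ℝ) (𝓡 (m + 2)) ∞ γ 0 :=
    ContMDiffAt.comp_of_eq hχ hlin.contMDiff.contMDiffAt (by simp)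
  have hγd : HasMFDerivAt 𝓘(ℝ, ℝ) (𝓡 (m + 2)) γ 0 ((1 : ℝ →L[ℝ] ℝ).smulRight b) := by
    have h1 := (hχ.mdifferentiableAt (by simp)).hasMFDerivAt
    have h2 := mfderivWithin_range_extChartAt_symm (I := 𝓡 (m + 2)) (x := x)
    rw [ModelWithCorners.range_eq_univ, mfderivWithin_univ] at h2
    rw [h2] at h1
    have h3 : HasFDerivAt (fun r : ℝ => extChartAt (𝓡 (m + 2)) x x + r • b)
        ((1 : ℝ →L[ℝ] ℝ).smulRight b) 0 :=
      ((ContinuousLinearMap.smulRight (1 : ℝ →L[ℝ] ℝ) b).hasFDerivAt).const_add _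
    have h4 : HasMFDerivAt 𝓘(ℝ, Mod m) (𝓡 (m + 2)) (extChartAt (𝓡 (m + 2)) x).symm
      (extChartAt (𝓡 (m + 2)) x x + (0 : ℝ) • b) (ContinuousLinearMap.id ℝ (Mod m)) := by
      rw [zero_smul, add_zero]
      exact h1
    exact h4.comp 0 h3.hasMFDerivAt
  let F : ℝ × ℝ → Mod m := fun q => extChartAt (𝓡 (m + 2)) p (φ q.1 (γ q.2))
  have hF0 : F (s₀, 0) = extChartAt (𝓡 (m + 2)) p p := by simp only [F, hγ0, hp]
  have hpair : ContMDiffAt 𝓘(ℝ, ℝ × ℝ) (𝓘(ℝ, ℝ).prod (𝓡 (m + 2))) ∞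
      (fun q : ℝ × ℝ => (q.1, γ q.2)) (s₀, 0) :=
    contDiff_fst.contMDiff.contMDiffAt.prodMk
      (ContMDiffAt.comp (I' := 𝓘(ℝ, ℝ)) (g := γ) (s₀, (0 : ℝ)) hγs
        contDiff_snd.contMDiff.contMDiffAt)
  have hφγ : ContMDiffAt 𝓘(ℝ, ℝ × ℝ) (𝓡 (m + 2)) ∞ (fun q : ℝ × ℝ => φ q.1 (γ q.2)) (s₀, 0) :=
    ContMDiffAt.comp_of_eq (h.contMDiffAt hx) hpair (by simp [hγ0])
  have hF : ContDiffAt ℝ ∞ F (s₀, 0) :=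
    (ContMDiffAt.comp_of_eq (contMDiffAt_extChartAt (x := p)) hφγ (by simp [hγ0, hp])).contDiffAt
  have hmem : ∀ᶠ q in 𝓝 (s₀, (0 : ℝ)), (q.1, γ q.2) ∈ D ∧
      φ q.1 (γ q.2) ∈ (chartAt (Mod m) p).source := by
    refine (hpair.continuousAt.eventually_mem ?_).and (hφγ.continuousAt.eventually_mem ?_)
    · exact h.isOpen.mem_nhds (by simpa [hγ0] using hx)
    · refine (chartAt (Mod m) p).open_source.mem_nhds ?_
      simp [hγ0, ← hp]
  have := hasDerivAt_variation (hF.of_le (WithTop.coe_le_coe.2 (le_top : (2 : ℕ∞) ≤ ⊤)))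
    (A := chartField p X)
    (V := fun s => coordVec p (φ s x) (mfderiv (𝓡 (m + 2)) (𝓡 (m + 2)) (φ s) x a))
    (by rw [hF0]; exact differentiableAt_chartField (X.smoothFieldAt p).fieldDiffAt) ?_ ?_
  · rw [hF0, ← hp, coordVec_self] at this
    exact this
  · have hr : Filter.Tendsto (fun r : ℝ => (s₀, r)) (𝓝 0) (𝓝 (s₀, 0)) :=
      (Continuous.prodMk_right s₀).tendsto 0
    filter_upwards [hr.eventually hmem] with r hr
    have := hasDerivAt_chart_comp (X := X) hr.2 (h.hasMFDerivAt hr.1)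
    rwa [← chartField_apply hr.2 X] at this
  · have hl : Filter.Tendsto (fun s : ℝ => (s, (0 : ℝ))) (𝓝 s₀) (𝓝 (s₀, 0)) :=
      (Continuous.prodMk_left (0 : ℝ)).tendsto s₀
    filter_upwards [hl.eventually hmem] with s hs
    simp only [hγ0] at hs
    let T : Mod m →L[ℝ] Mod m := mfderiv (𝓡 (m + 2)) (𝓡 (m + 2)) (φ s) x
    let S : Mod m →L[ℝ] Mod m := coordVec p (φ s x)
    have h1 : HasMFDerivAt (𝓡 (m + 2)) 𝓘(ℝ, Mod m) (fun y => extChartAt (𝓡 (m + 2)) p (φ s y)) (γ 0)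
        (S.comp T) := by
      rw [hγ0]
      exact (mdifferentiableAt_extChartAt hs.2).hasMFDerivAt.comp x
        (h.mdifferentiableAt hs.1).hasMFDerivAt
    have h2 : HasFDerivAt (fun r => F (s, r)) ((S.comp T).comp ((1 : ℝ →L[ℝ] ℝ).smulRight b)) 0 :=
      (h1.comp 0 hγd).hasFDerivAt
    refine h2.hasDerivAt.congr_deriv ?_
    have : S (T ((1 : ℝ) • b)) = S (T b) := by rw [one_smul]
    exact this

/-- The derivative of the pulled back metric along the flow is the Lie derivative. -/
theorem IsLocalFlow.hasDerivAt_metric_mfderiv (h : IsLocalFlow X D φ) (hx : (s₀, x) ∈ D)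
    (a b : TangentSpace (𝓡 (m + 2)) x) :
    HasDerivAt (fun s => g.val (φ s x) (mfderiv (𝓡 (m + 2)) (𝓡 (m + 2)) (φ s) x a)
        (mfderiv (𝓡 (m + 2)) (𝓡 (m + 2)) (φ s) x b))
      (g.lieDeriv X (φ s₀ x) (mfderiv (𝓡 (m + 2)) (𝓡 (m + 2)) (φ s₀) x a)
        (mfderiv (𝓡 (m + 2)) (𝓡 (m + 2)) (φ s₀) x b)) s₀ := by
  -- Vectors carried by the flow satisfy the linearized equation, so both correction vectors are
  -- zero.
  refine (hasDerivAt_metric_along (g := g) (c := fun s => φ s x) (v := 0) (w := 0)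
    (h.hasMFDerivAt hx) (h.hasDerivAt_mfderiv hx a) (h.hasDerivAt_mfderiv hx b)
    (sub_self (_ : Mod m)).symm (sub_self (_ : Mod m)).symm).congr_deriv ?_
  rw [map_zero, map_zero, _root_.zero_apply, add_zero, add_zero]

/-- The derivative of the scalar product of a vector field with vectors carried along by the
flow. -/
theorem IsLocalFlow.hasDerivAt_metric_field_mfderiv (h : IsLocalFlow X D φ) (hx : (s₀, x) ∈ D)
    {Y : ∀ x : M, TangentSpace (𝓡 (m + 2)) x} (hY : SmoothFieldAt Y (φ s₀ x))
    (b : TangentSpace (𝓡 (m + 2)) x) :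
    HasDerivAt (fun s => g.val (φ s x) (Y (φ s x)) (mfderiv (𝓡 (m + 2)) (𝓡 (m + 2)) (φ s) x b))
      (g.lieDeriv X (φ s₀ x) (Y (φ s₀ x)) (mfderiv (𝓡 (m + 2)) (𝓡 (m + 2)) (φ s₀) x b) +
        g.val (φ s₀ x) (mlieBracket (𝓡 (m + 2)) X Y (φ s₀ x))
          (mfderiv (𝓡 (m + 2)) (𝓡 (m + 2)) (φ s₀) x b)) s₀ := by
  -- For the field `Y` the correction vector is `DY(X) - DX(Y) = [X, Y]`; for the carried vector it
  -- is zero.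
  refine (hasDerivAt_metric_along (g := g) (c := fun s => φ s x) (w := 0)
    (h.hasMFDerivAt hx) (hasDerivAt_coordVec_field (c := fun s => φ s x) hY (h.hasMFDerivAt hx))
    (h.hasDerivAt_mfderiv hx b)
    (mlieBracket_eq_chartField _ _ _) (sub_self (_ : Mod m)).symm).congr_deriv ?_
  rw [map_zero, add_zero]

end Flow

end Coordinates

/-! ### Existence of local flows on the manifold. -/

section LocalFlow

variable {m : ℕ} {M : Type*} [TopologicalSpace M] [ChartedSpace (Mod m) M]
  [IsManifold (𝓡 (m + 2)) ∞ M] (X : Fields m M) (p : M)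

lemma contDiffOn_chartField :
    ContDiffOn ℝ ∞ (chartField p X) (extChartAt (𝓡 (m + 2)) p).target := by
  intro z hz
  set χ := extChartAt (𝓡 (m + 2)) p
  set e := trivializationAt (Mod m) (TangentSpace (𝓡 (m + 2)) : M → Type _) p
  have hsrc' : ∀ z ∈ χ.target, χ.symm z ∈ (chartAt (Mod m) p).source := fun z hz => by
    have := χ.map_target hz
    rwa [extChartAt_source] at this
  have hsrc : ∀ z ∈ χ.target, χ.symm z ∈ e.baseSet := fun z hz => by
    simpa [e] using hsrc' z hz
  have h1 : ContMDiffAt (𝓡 (m + 2)) 𝓘(ℝ, Mod m) ∞ (fun y => (e ⟨y, X y⟩).2) (χ.symm z) :=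
    (e.contMDiffAt_section_iff (hsrc z hz)).1 X.contMDiff.contMDiffAt
  have h2 : ContMDiffWithinAt 𝓘(ℝ, Mod m) (𝓡 (m + 2)) ∞ χ.symm χ.target z :=
    contMDiffOn_extChartAt_symm p z hz
  refine ContDiffWithinAt.congr (ContMDiffAt.comp_contMDiffWithinAt z h1 h2).contDiffWithinAt
    (fun w hw => ?_) ?_
  · rw [chartField_of_mem_target hw, coordVec_eq (hsrc' w hw),
      Trivialization.continuousLinearMapAt_apply,
      Trivialization.coe_linearMapAt_of_mem _ (hsrc w hw)]
    rfl
  · rw [chartField_of_mem_target hz, coordVec_eq (hsrc' z hz),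
      Trivialization.continuousLinearMapAt_apply,
      Trivialization.coe_linearMapAt_of_mem _ (hsrc z hz)]
    rfl

/-- The flow theorem is stated for fields smooth on all of the model space; multiplying by a bump
function supported inside the chart target supplies such a field with the same germ. -/
lemma exists_bump_chartField : ∃ B : Mod m → Mod m, ContDiff ℝ ∞ B ∧
    ∀ᶠ z in 𝓝 (extChartAt (𝓡 (m + 2)) p p), B z = chartField p X z := by
  obtain ⟨r, hr, hball⟩ := Metric.isOpen_iff.1 (isOpen_extChartAt_target (I := 𝓡 (m + 2)) p) _
    (mem_extChartAt_target p)
  let f : ContDiffBump (extChartAt (𝓡 (m + 2)) p p) := ⟨r / 4, r / 2, by positivity, by linarith⟩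
  refine ⟨fun z => f z • chartField p X z, contDiff_iff_contDiffAt.2 fun z => ?_, ?_⟩
  · by_cases hz : z ∈ Metric.ball (extChartAt (𝓡 (m + 2)) p p) r
    · exact f.contDiffAt.smul ((contDiffOn_chartField X p).contDiffAt
        ((isOpen_extChartAt_target p).mem_nhds (hball hz)))
    · refine ContDiffAt.congr_of_eventuallyEq (contDiffAt_const (c := 0)) ?_
      have : z ∈ (tsupport f)ᶜ := by
        rw [f.tsupport_eq]
        intro h
        exact hz (Metric.closedBall_subset_ball (by change r / 2 < r; linarith) h)
      filter_upwards [(isClosed_tsupport f).isOpen_compl.mem_nhds this] with w hw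
      rw [image_eq_zero_of_notMem_tsupport hw, zero_smul]
  · filter_upwards [f.eventuallyEq_one] with z hz
    rw [hz]
    simp

variable {X p}

lemma contMDiffOn_chart_flow {Φ : ℝ × Mod m → Mod m} {S : Set (ℝ × Mod m)} {T : Set (ℝ × M)}
    (hΦ : ContDiffOn ℝ ∞ Φ S)
    (hT : ∀ q ∈ T, q.2 ∈ (extChartAt (𝓡 (m + 2)) p).source ∧
      (q.1, extChartAt (𝓡 (m + 2)) p q.2) ∈ S ∧
      Φ (q.1, extChartAt (𝓡 (m + 2)) p q.2) ∈ (extChartAt (𝓡 (m + 2)) p).target) :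
    ContMDiffOn (𝓘(ℝ, ℝ).prod (𝓡 (m + 2))) (𝓡 (m + 2)) ∞ (fun q : ℝ × M =>
      (extChartAt (𝓡 (m + 2)) p).symm (Φ (q.1, extChartAt (𝓡 (m + 2)) p q.2))) T := by
  have h0 : ContMDiffOn (𝓘(ℝ, ℝ).prod (𝓡 (m + 2))) 𝓘(ℝ, Mod m) ∞
      (fun q : ℝ × M => extChartAt (𝓡 (m + 2)) p q.2) T :=
    ContMDiffOn.comp (I' := 𝓡 (m + 2)) (contMDiffOn_extChartAt (x := p)) contMDiffOn_snd
      fun q hq => by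
        have := (hT q hq).1
        rwa [extChartAt_source] at this
  have h1 : ContMDiffOn (𝓘(ℝ, ℝ).prod (𝓡 (m + 2))) 𝓘(ℝ, ℝ × Mod m) ∞
      (fun q : ℝ × M => (q.1, extChartAt (𝓡 (m + 2)) p q.2)) T :=
    ContMDiffOn.prodMk_space contMDiffOn_fst h0
  have h2 : ContMDiffOn (𝓘(ℝ, ℝ).prod (𝓡 (m + 2))) 𝓘(ℝ, Mod m) ∞
      (fun q : ℝ × M => Φ (q.1, extChartAt (𝓡 (m + 2)) p q.2)) T :=
    ContMDiffOn.comp (I' := 𝓘(ℝ, ℝ × Mod m)) hΦ.contMDiffOn h1 fun q hq => (hT q hq).2.1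
  exact ContMDiffOn.comp (I' := 𝓘(ℝ, Mod m)) (contMDiffOn_extChartAt_symm p) h2
    fun q hq => (hT q hq).2.2

lemma hasMFDerivAt_chart_symm_comp {γ : ℝ → Mod m} {t : ℝ}
    (ht : γ t ∈ (extChartAt (𝓡 (m + 2)) p).target) (hγ : HasDerivAt γ (chartField p X (γ t)) t) :
    HasMFDerivAt 𝓘(ℝ, ℝ) (𝓡 (m + 2)) (fun t => (extChartAt (𝓡 (m + 2)) p).symm (γ t)) t
      ((1 : ℝ →L[ℝ] ℝ).smulRight (X ((extChartAt (𝓡 (m + 2)) p).symm (γ t)))) := by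
  have hs := (((contMDiffOn_extChartAt_symm (I := 𝓡 (m + 2)) (n := ∞) p).contMDiffAt
    ((isOpen_extChartAt_target p).mem_nhds ht)).mdifferentiableAt (by simp)).hasMFDerivAt
  have h := mfderivWithin_extChartAt_symm_comp_mfderiv_extChartAt (I := 𝓡 (m + 2)) ht
  rw [ModelWithCorners.range_eq_univ, mfderivWithin_univ] at h
  let T : Mod m →L[ℝ] Mod m := mfderiv 𝓘(ℝ, Mod m) (𝓡 (m + 2)) (extChartAt (𝓡 (m + 2)) p).symm (γ t)
  let w : Mod m := X ((extChartAt (𝓡 (m + 2)) p).symm (γ t))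
  have hT : T (chartField p X (γ t)) = w := by
    rw [chartField_of_mem_target ht]
    exact DFunLike.congr_fun h (X ((extChartAt (𝓡 (m + 2)) p).symm (γ t)))
  have h2 : T.comp (ContinuousLinearMap.toSpanSingleton ℝ (chartField p X (γ t))) =
      (1 : ℝ →L[ℝ] ℝ).smulRight w := by
    ext1
    simp [hT]
  exact (hs.comp t hγ.hasFDerivAt.hasMFDerivAt).congr_mfderiv h2

variable (X p)

/-- Every smooth vector field has a local flow near every point. -/
theorem exists_isLocalFlow :
    ∃ (D : Set (ℝ × M)) (φ : ℝ → M → M), IsLocalFlow X D φ ∧ (0, p) ∈ D := by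
  obtain ⟨B, hB, hBX⟩ := exists_bump_chartField X p
  set χ := extChartAt (𝓡 (m + 2)) p with hχ
  obtain ⟨ε, hε, Φ, hΦ, hΦ0, hΦd⟩ := exists_smooth_local_flow B hB (χ p)
  have h0 : ((0 : ℝ), χ p) ∈ Ioo (-ε) ε ×ˢ Metric.ball (χ p) ε :=
    ⟨⟨by linarith, hε⟩, Metric.mem_ball_self hε⟩
  have hopen : IsOpen (Ioo (-ε) ε ×ˢ Metric.ball (χ p) ε) := isOpen_Ioo.prod Metric.isOpen_ball
  have hcont : ContinuousAt Φ (0, χ p) := hΦ.continuousOn.continuousAt (hopen.mem_nhds h0)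
  have hgood : ∀ᶠ z in 𝓝 (Φ (0, χ p)), B z = chartField p X z ∧ z ∈ χ.target := by
    rw [hΦ0 _ h0.2]
    exact hBX.and ((isOpen_extChartAt_target p).mem_nhds (mem_extChartAt_target p))
  -- The box is shrunk until its trajectories remain in the chart and in the region where the
  -- cut-off field agrees with `X`.
  obtain ⟨δ, hδ, hΦδ⟩ : ∃ δ > 0, ∀ q ∈ Ioo (-δ) δ ×ˢ Metric.ball (χ p) δ,
      q ∈ Ioo (-ε) ε ×ˢ Metric.ball (χ p) ε ∧ B (Φ q) = chartField p X (Φ q) ∧ Φ q ∈ χ.target := by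
    obtain ⟨δ, hδ, h⟩ := Metric.eventually_nhds_iff_ball.1
      ((hopen.eventually_mem h0).and (hcont.eventually hgood))
    refine ⟨δ, hδ, fun q hq => h q ?_⟩
    rw [← ball_prod_same, Real.ball_eq_Ioo, zero_sub, zero_add]
    exact hq
  have hχo : IsOpen (χ.source ∩ χ ⁻¹' Metric.ball (χ p) δ) :=
    isOpen_extChartAt_preimage' p Metric.isOpen_ball
  refine ⟨Ioo (-δ) δ ×ˢ (χ.source ∩ χ ⁻¹' Metric.ball (χ p) δ), fun t y => χ.symm (Φ (t, χ y)),
    ⟨isOpen_Ioo.prod hχo, ?_, ?_, ?_, ?_⟩, ⟨⟨by linarith, hδ⟩, mem_extChartAt_source p,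
      Metric.mem_ball_self hδ⟩⟩
  · rintro t x ⟨ht, hx⟩ s hs
    have h0 : (0 : ℝ) ∈ Ioo (-δ) δ := ⟨by linarith, hδ⟩
    exact ⟨ordConnected_Ioo.uIcc_subset h0 ht hs, hx⟩
  · exact contMDiffOn_chart_flow hΦ fun q hq =>
      ⟨hq.2.1, (hΦδ (q.1, χ q.2) ⟨hq.1, hq.2.2⟩).1, (hΦδ (q.1, χ q.2) ⟨hq.1, hq.2.2⟩).2.2⟩
  · rintro x ⟨-, hx⟩
    have := (hΦδ (0, χ x) ⟨⟨by linarith, hδ⟩, hx.2⟩).1.2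
    change χ.symm (Φ (0, χ x)) = x
    rw [hΦ0 _ this, χ.left_inv hx.1]
  · rintro x t ⟨ht, hx⟩
    obtain ⟨h1, h2, h3⟩ := hΦδ (t, χ x) ⟨ht, hx.2⟩
    have hd := hΦd t h1.1 (χ x) h1.2
    rw [h2] at hd
    exact (hasMFDerivAt_chart_symm_comp h3 hd).hasMFDerivWithinAt

end LocalFlow

/-! ### Infinitesimal automorphisms and nil-Killing fields. -/

section Automorphisms

variable {m : ℕ} {M : Type*} [TopologicalSpace M] [ChartedSpace (Mod m) M]
  [IsManifold (𝓡 (m + 2)) ∞ M] {g : LorentzianMetric m M}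
  {line : ∀ x : M, Submodule ℝ (Tan m x)} {x : M}

/-- The derivative of the map `φ` at `x`. -/
abbrev tanMap (φ : M → M) (x : M) :
    TangentSpace (𝓡 (m + 2)) x →L[ℝ] TangentSpace (𝓡 (m + 2)) (φ x) :=
  mfderiv (𝓡 (m + 2)) (𝓡 (m + 2)) φ x

lemma HasAdaptedFrames.exists_adapted (h : HasAdaptedFrames g line) (x : M) :
    ∃ u : Frame m x, IsAdapted g line x u := by
  obtain ⟨U, -, hx, s, hs, -⟩ := h.exists_frame x
  exact ⟨s x, hs x hx⟩

lemma HasAdaptedFrames.line_le_perp (h : HasAdaptedFrames g line) {v : Tan m x}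
    (hv : v ∈ line x) : v ∈ g.perp x (line x) ∧ g.val x v v = 0 := by
  obtain ⟨u, hu⟩ := h.exists_adapted x
  have hl := h.finrank_eq_one x
  rw [hu.line_eq hl] at hv
  obtain ⟨c, rfl⟩ := Submodule.mem_span_singleton.1 hv
  rw [← map_smul]
  have : eta (kvec m) (c • kvec m) = 0 := by rw [eta_kvec_left, Pi.smul_apply, kvec_one, smul_zero]
  refine ⟨(hu.mem_perp_iff hl _).2 this, ?_⟩
  rw [hu.perp _ _ this this, eta_smul_left, this, mul_zero]

/-- The line is the orthogonal complement of its orthogonal complement. -/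
lemma HasAdaptedFrames.mem_line_of_orthogonal (h : HasAdaptedFrames g line) {v : Tan m x}
    (hv : ∀ w ∈ g.perp x (line x), g.val x v w = 0) : v ∈ line x := by
  obtain ⟨u, hu⟩ := h.exists_adapted x
  have hl := h.finrank_eq_one x
  obtain ⟨z, rfl⟩ := u.surjective v
  have hz : eta (kvec m) z = 0 := by
    rw [← hu.kvec_left, g.symm]
    exact hv _ (h.line_le_perp hu.mem).1
  have : z = z 0 • kvec m := eq_smul_kvec_of_orthogonal hz fun w hw => by
    rw [← hu.perp z w hz hw]
    exact hv _ ((hu.mem_perp_iff hl w).2 hw)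
  rw [this, map_smul]
  exact Submodule.smul_mem _ _ hu.mem

variable {X : Fields m M} {D : Set (ℝ × M)} {φ : ℝ → M → M}

/-- At time zero the flow and its derivative are the identity. -/
lemma IsLocalFlow.apply_zero {C : Sort*} (hφ : IsLocalFlow X D φ) (hx : (0, x) ∈ D)
    (B : ∀ y : M, Tan m y → Tan m y → C) (a b : Tan m x) :
    B (φ 0 x) (tanMap (φ 0) x a) (tanMap (φ 0) x b) = B x a b := by
  have hev : φ 0 =ᶠ[𝓝 x] id := by
    have : Continuous fun y : M => ((0 : ℝ), y) := by fun_prop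
    filter_upwards [(hφ.isOpen.preimage this).mem_nhds hx] with y hy
    exact hφ.zero y hy
  have hid : ∀ a : Mod m, (tanMap (φ 0) x a : Mod m) = a := fun a => by
    rw [tanMap, hev.mfderiv_eq, mfderiv_id]
    rfl
  -- The tangent spaces at `φ 0 x` and at `x` belong to points that are only provably equal; with
  -- the point and the vectors made variables, the equalities can be substituted.
  have key : ∀ (y : M) (a' b' : Mod m), y = x → a' = a → b' = b → B y a' b' = B x a b := by
    rintro y a' b' rfl rfl rfl
    rfl
  exact key _ _ _ (hφ.zero x hx) (hid a) (hid b)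

lemma IsLocalFlow.eventually_mem (hφ : IsLocalFlow X D φ) {t : ℝ} (hx : (t, x) ∈ D) :
    ∀ᶠ s in 𝓝 t, (s, x) ∈ D :=
  (hφ.isOpen.preimage (by fun_prop : Continuous fun s : ℝ => (s, x))).mem_nhds hx

/-- Fields whose local flows map adapted frames to adapted frames are nil-Killing. -/
lemma HasAdaptedFrames.isNilKilling_of_flow (h : HasAdaptedFrames g line)
    (hφ : ∀ x : M, ∃ D φ, IsLocalFlow X D φ ∧ (0, x) ∈ D ∧ ∀ t, (t, x) ∈ D → ∀ u : Frame m x,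
      IsAdapted g line x u → ∃ v : Frame m (φ t x), IsAdapted g line (φ t x) v ∧
        ∀ z, v z = tanMap (φ t) x (u z)) :
    X ∈ g.algebraPreservingNilKilling line := by
  have key : ∀ (D : Set (ℝ × M)) (φ : ℝ → M → M) (x : M) (a b : Tan m x) (c : ℝ),
      IsLocalFlow X D φ → (0, x) ∈ D → (∀ t, (t, x) ∈ D →
        g.val (φ t x) (tanMap (φ t) x a) (tanMap (φ t) x b) = c) → g.lieDeriv X x a b = 0 := by
    intro D φ x a b c hφ hx hc
    have h1 := hφ.hasDerivAt_metric_mfderiv (g := g) hx a b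
    have h2 : HasDerivAt (fun s => g.val (φ s x) (tanMap (φ s) x a) (tanMap (φ s) x b)) 0 0 :=
      (hasDerivAt_const (0 : ℝ) c).congr_of_eventuallyEq
        ((hφ.eventually_mem hx).mono fun t ht => hc t ht)
    rw [← hφ.apply_zero hx (fun y v w => g.lieDeriv X y v w)]
    exact h1.unique h2
  have hnil : ∀ x, (∀ v ∈ line x, ∀ z, g.lieDeriv X x v z = 0) ∧
      ∀ w ∈ g.perp x (line x), ∀ w' ∈ g.perp x (line x), g.lieDeriv X x w w' = 0 := by
    intro x
    obtain ⟨D, φ, hφ, hx, hP⟩ := hφ x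
    obtain ⟨u, hu⟩ := h.exists_adapted x
    have hl := h.finrank_eq_one x
    constructor
    · intro v hv z
      rw [hu.line_eq hl] at hv
      obtain ⟨c, rfl⟩ := Submodule.mem_span_singleton.1 hv
      obtain ⟨z, rfl⟩ := u.surjective z
      rw [map_smul, _root_.smul_apply, key D φ x _ _ (eta (kvec m) z) hφ hx, smul_zero]
      intro t ht
      obtain ⟨v, hv, hvu⟩ := hP t ht u hu
      rw [← hvu, ← hvu, hv.kvec_left]
    · intro w hw w' hw'
      obtain ⟨w, rfl⟩ := u.surjective w
      obtain ⟨w', rfl⟩ := u.surjective w'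
      rw [hu.mem_perp_iff hl] at hw hw'
      refine key D φ x _ _ (eta w w') hφ hx fun t ht => ?_
      obtain ⟨v, hv, hvu⟩ := hP t ht u hu
      rw [← hvu, ← hvu, hv.perp w w' hw hw']
  refine ⟨(h.isNilKilling_iff X).2 hnil, fun U Y hU hY hYl x hxU => ?_⟩
  obtain ⟨D, φ, hφ, hx, hP⟩ := hφ x
  obtain ⟨u, hu⟩ := h.exists_adapted x
  -- As `λ` is the orthogonal complement of `λ^⊥`, it suffices to pair `[X, Y]` with `w ∈ λ^⊥`. The
  -- flow keeps `w` in `λ^⊥`, so `g(Y, dφ_s w)` vanishes identically and its derivative at zero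
  -- leaves only that pairing.
  refine h.mem_line_of_orthogonal fun w hw => ?_
  have hx0 : φ 0 x = x := hφ.zero x hx
  have h1 := hφ.hasDerivAt_metric_field_mfderiv (g := g) hx (Y := Y)
    (by rw [hx0]; exact hY.smoothFieldAt hU hxU) w
  have h2 : HasDerivAt (fun s => g.val (φ s x) (Y (φ s x)) (tanMap (φ s) x w)) 0 0 := by
    refine (hasDerivAt_const (0 : ℝ) (0 : ℝ)).congr_of_eventuallyEq ?_
    have hU' : ∀ᶠ s in 𝓝 (0 : ℝ), φ s x ∈ U :=
      (hφ.hasMFDerivAt hx).continuousAt.eventually_mem (hU.mem_nhds (by rwa [hx0]))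
    filter_upwards [hφ.eventually_mem hx, hU'] with t ht htU
    obtain ⟨v, hv, hvu⟩ := hP t ht u hu
    obtain ⟨w, rfl⟩ := u.surjective w
    rw [hu.mem_perp_iff (h.finrank_eq_one x)] at hw
    rw [← hvu]
    exact ((hv.mem_perp_iff (h.finrank_eq_one _) w).2 hw) _ (hYl _ htU)
  have h3 := h1.unique h2
  have h4 := hφ.apply_zero hx (fun y _ w => g.lieDeriv X y (Y y) w +
    g.val y (mlieBracket (𝓡 (m + 2)) X Y y) w) w w
  rw [h4, (hnil x).1 _ (hYl x hxU), zero_add] at h3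
  exact h3

/-- A solution of a linear homogeneous differential equation vanishes if it vanishes somewhere. -/
lemma eq_zero_of_hasDerivAt_mul {f μ : ℝ → ℝ} {a b : ℝ} {K : NNReal}
    (hf : ∀ s ∈ Ioo a b, HasDerivAt f (μ s * f s) s) (hμ : ∀ s ∈ Ioo a b, ‖μ s‖₊ ≤ K) {s t : ℝ}
    (hs : s ∈ Ioo a b) (ht : t ∈ Ioo a b) (h0 : f s = 0) : f t = 0 := by
  refine ODE_solution_unique_of_mem_Ioo (v := fun s y => μ s * y) (s := fun _ => univ) (K := K)
    (g := fun _ => 0) ?_ hs (fun s hs => ⟨hf s hs, mem_univ _⟩)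
    (fun s _ => ⟨by simpa using hasDerivAt_const s (0 : ℝ), mem_univ _⟩) h0 ht
  intro r hr
  refine LipschitzWith.lipschitzOnWith (LipschitzWith.weaken ?_ (hμ r hr))
  refine LipschitzWith.of_dist_le_mul fun y z => ?_
  rw [Real.dist_eq, Real.dist_eq, ← mul_sub, abs_mul]
  rfl

/-- Along an orbit of an algebra preserving nil-Killing field, vectors carried by the flow remain
orthogonal or not orthogonal to the line. -/
lemma HasAdaptedFrames.eventually_tanMap_mem_perp_iff (h : HasAdaptedFrames g line)
    (hX : X ∈ g.algebraPreservingNilKilling line) (hφ : IsLocalFlow X D φ) {s₀ : ℝ}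
    (hx : (s₀, x) ∈ D) (w : Tan m x) :
    ∀ᶠ s in 𝓝 s₀, tanMap (φ s₀) x w ∈ g.perp (φ s₀ x) (line (φ s₀ x)) ↔
      tanMap (φ s) x w ∈ g.perp (φ s x) (line (φ s x)) := by
  obtain ⟨U, hU, hxU, f, hf, hfs⟩ := h.exists_frame (φ s₀ x)
  have hnil := (h.isNilKilling_iff X).1 hX.1
  set Y : ∀ x : M, Tan m x := fun y => f y (kvec m) with hY
  -- Pairing with the image of `l` extracts the factor in `[X, Y] = μ Y`; written this way, `μ` is
  -- visibly continuous, which yields the local Lipschitz bound.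
  set μ : M → ℝ := fun y => g.val y (mlieBracket (𝓡 (m + 2)) X Y y) (f y (lvec m)) with hμ
  have hbr : ∀ y ∈ U, mlieBracket (𝓡 (m + 2)) X Y y = μ y • Y y := by
    intro y hy
    have h1 := hX.2 U Y hU (hfs _) (fun y hy => (hf y hy).mem) y hy
    rw [(hf y hy).line_eq (h.finrank_eq_one y)] at h1
    obtain ⟨c, hc⟩ := Submodule.mem_span_singleton.1 h1
    have h2 : μ y = c := by
      simp only [hμ, ← hc, map_smul, _root_.smul_apply]
      rw [(hf y hy).kvec_left, eta_kvec_left]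
      simp [lvec]
    rw [h2, ← hc]
  have hμc : ContinuousAt μ (φ s₀ x) := by
    have := (hfs (kvec m)).smoothFieldAt hU hxU
    exact (SmoothFieldAt.metric_apply (g := g) ((X.smoothFieldAt _).mlieBracket this)
      ((hfs (lvec m)).smoothFieldAt hU hxU)).continuousAt
  have hcont : ContinuousAt (fun s => φ s x) s₀ := (hφ.hasMFDerivAt hx).continuousAt
  have hbound : ∀ᶠ s in 𝓝 s₀, ‖μ (φ s x)‖₊ ≤ ‖μ (φ s₀ x)‖₊ + 1 := by
    have : ContinuousAt (fun s => ‖μ (φ s x)‖₊) s₀ :=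
      (ContinuousAt.comp' (g := μ) (f := fun s => φ s x) hμc hcont).nnnorm
    filter_upwards [this.eventually_lt_const (lt_add_one _)] with s hs using hs.le
  obtain ⟨a, b, hab, hI⟩ := mem_nhds_iff_exists_Ioo_subset.1
    ((hbound.and (hφ.eventually_mem hx)).and (hcont.eventually_mem (hU.mem_nhds hxU)))
  have hperp : ∀ s ∈ Ioo a b, tanMap (φ s) x w ∈ g.perp (φ s x) (line (φ s x)) ↔
      g.val (φ s x) (Y (φ s x)) (tanMap (φ s) x w) = 0 := by
    intro s hs
    rw [(hf _ (hI hs).2).line_eq (h.finrank_eq_one _), mem_perp_span_iff]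
  filter_upwards [Ioo_mem_nhds hab.1 hab.2] with s hs
  rw [hperp s₀ hab, hperp s hs]
  set f' : ℝ → ℝ := fun s => g.val (φ s x) (Y (φ s x)) (tanMap (φ s) x w) with hf'
  -- The term `(L_X g)(Y, ·)` drops out because `Y ∈ λ`, and `[X, Y] = μ Y` makes the equation
  -- linear and homogeneous.
  have hder : ∀ r ∈ Ioo a b, HasDerivAt f' (μ (φ r x) * f' r) r := by
    intro r hr
    have hrU := (hI hr).2
    refine (hφ.hasDerivAt_metric_field_mfderiv (g := g) (hI hr).1.2 (Y := Y)
      ((hfs (kvec m)).smoothFieldAt hU hrU) w).congr_deriv ?_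
    rw [(hnil _).1 _ (hf _ hrU).mem, zero_add, hbr _ hrU, map_smul]
    rfl
  have hμb : ∀ r ∈ Ioo a b, ‖μ (φ r x)‖₊ ≤ ‖μ (φ s₀ x)‖₊ + 1 := fun r hr => (hI hr).1.1
  exact ⟨eq_zero_of_hasDerivAt_mul (f := f') hder hμb hab hs,
    eq_zero_of_hasDerivAt_mul (f := f') hder hμb hs hab⟩

/-- The flow of an algebra preserving nil-Killing field preserves the orthogonal complement of the
line. -/
lemma HasAdaptedFrames.tanMap_mem_perp (h : HasAdaptedFrames g line)
    (hX : X ∈ g.algebraPreservingNilKilling line) (hφ : IsLocalFlow X D φ) {t : ℝ}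
    (hx : (t, x) ∈ D) {w : Tan m x} (hw : w ∈ g.perp x (line x)) :
    tanMap (φ t) x w ∈ g.perp (φ t x) (line (φ t x)) := by
  have hseg := hφ.segment t x hx
  have h0 : tanMap (φ 0) x w ∈ g.perp (φ 0 x) (line (φ 0 x)) := by
    rw [hφ.apply_zero (hseg 0 left_mem_uIcc) (fun y v _ => v ∈ g.perp y (line y)) w w]
    exact hw
  -- The equivalence is known only for nearby times; connectedness of the interval from `0` to `t`,
  -- all of whose points lie in the domain of the flow, spreads it.
  refine (isPreconnected_uIcc.induction₂ (fun s s' =>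
    tanMap (φ s) x w ∈ g.perp (φ s x) (line (φ s x)) ↔
      tanMap (φ s') x w ∈ g.perp (φ s' x) (line (φ s' x)))
    (fun s hs => (h.eventually_tanMap_mem_perp_iff hX hφ (hseg s hs) w).filter_mono
      nhdsWithin_le_nhds) (fun _ _ _ _ _ _ h1 h2 => h1.trans h2) (fun _ _ _ _ h => h.symm)
    left_mem_uIcc right_mem_uIcc).1 h0

/-- The product has zero derivative along the whole segment, so the mean value inequality with
constant `0` makes it equal to its value at time zero. -/
lemma IsLocalFlow.metric_tanMap_eq (hφ : IsLocalFlow X D φ) {t : ℝ} (hx : (t, x) ∈ D)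
    {a b : Tan m x} (hab : ∀ s ∈ uIcc 0 t,
      g.lieDeriv X (φ s x) (tanMap (φ s) x a) (tanMap (φ s) x b) = 0) :
    g.val (φ t x) (tanMap (φ t) x a) (tanMap (φ t) x b) = g.val x a b := by
  have hseg := hφ.segment t x hx
  have h := (convex_uIcc 0 t).norm_image_sub_le_of_norm_hasDerivWithin_le (C := 0)
    (fun s hs => (hφ.hasDerivAt_metric_mfderiv (g := g) (hseg s hs) a b).hasDerivWithinAt)
    (fun s hs => by rw [hab s hs, norm_zero]) left_mem_uIcc right_mem_uIcc
  rw [zero_mul, norm_le_zero_iff, sub_eq_zero,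
    hφ.apply_zero (hseg 0 left_mem_uIcc) (fun y v w => g.val y v w)] at h
  exact h

/-- The flow of an algebra preserving nil-Killing field maps adapted frames to adapted frames. -/
theorem HasAdaptedFrames.isAdapted_tanMap (h : HasAdaptedFrames g line)
    (hX : X ∈ g.algebraPreservingNilKilling line) (hφ : IsLocalFlow X D φ) {t : ℝ}
    (hx : (t, x) ∈ D) {u : Frame m x} (hu : IsAdapted g line x u) :
    ∃ v : Frame m (φ t x), IsAdapted g line (φ t x) v ∧ ∀ z, v z = tanMap (φ t) x (u z) := by
  have hseg := hφ.segment t x hx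
  have hnil := (h.isNilKilling_iff X).1 hX.1
  have hl := h.finrank_eq_one x
  have hperp : ∀ {s} (_ : (s, x) ∈ D) {w w' : Tan m x}, w ∈ g.perp x (line x) →
      w' ∈ g.perp x (line x) →
      g.val (φ s x) (tanMap (φ s) x w) (tanMap (φ s) x w') = g.val x w w' := fun hs w w' hw hw' =>
    hφ.metric_tanMap_eq hs fun r hr => (hnil _).2 _
      (h.tanMap_mem_perp hX hφ (hφ.segment _ x hs r hr) hw) _
      (h.tanMap_mem_perp hX hφ (hφ.segment _ x hs r hr) hw')
  -- The image of `u k` lies in `λ^⊥` and is null, because `g` on `λ^⊥` is preserved; null vectors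
  -- of `λ^⊥` lie in `λ`.
  have hline : ∀ {s}, (s, x) ∈ D → tanMap (φ s) x (u (kvec m)) ∈ line (φ s x) := by
    intro s hs
    obtain ⟨hk, hkk⟩ := h.line_le_perp hu.mem
    obtain ⟨v, hv⟩ := h.exists_adapted (φ s x)
    refine hv.mem_line_of_null (h.finrank_eq_one _) (h.tanMap_mem_perp hX hφ hs hk) ?_
    rw [hperp hs hk hk, hkk]
  let S : Vec m →ₗ[ℝ] Tan m (φ t x) := (tanMap (φ t) x).toLinearMap.comp u.toLinearMap
  have hS : IsAdapted g line (φ t x) S := by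
    refine ⟨hline hx, fun z => ?_, fun w w' hw hw' => ?_⟩
    · rw [← hu.kvec_left]
      exact hφ.metric_tanMap_eq hx fun s hs => (hnil _).1 _ (hline (hseg s hs)) _
    · rw [← hu.perp w w' hw hw']
      exact hperp hx ((hu.mem_perp_iff hl w).2 hw) ((hu.mem_perp_iff hl w').2 hw')
  obtain ⟨v, hv⟩ := hS.exists_frame
  refine ⟨v, ?_, hv⟩
  rw [show (v : Vec m → Tan m (φ t x)) = S from funext hv]
  exact hS

/-- The infinitesimal automorphisms of the structure of adapted frames are the algebra preserving
nil-Killing fields. -/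
theorem HasAdaptedFrames.isInfinitesimalAutomorphism_iff (h : HasAdaptedFrames g line)
    {P : GNStructure m M} (hP : ∀ x u, u ∈ P.fiber x ↔ IsAdapted g line x u) (X : Fields m M) :
    P.IsInfinitesimalAutomorphism X ↔ X ∈ g.algebraPreservingNilKilling line := by
  constructor
  · intro hX
    refine h.isNilKilling_of_flow fun x => ?_
    -- Being an infinitesimal automorphism is a condition on all local flows; a flow defined near
    -- `x` must exist for it to say anything there.
    obtain ⟨D, φ, hφ, hx⟩ := exists_isLocalFlow X x
    refine ⟨D, φ, hφ, hx, fun t ht u hu => ?_⟩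
    obtain ⟨v, hv, hvu⟩ := hX D φ hφ t x ht u ((hP x u).2 hu)
    exact ⟨v, (hP _ v).1 hv, hvu⟩
  · intro hX D φ hφ t x ht u hu
    obtain ⟨v, hv, hvu⟩ := h.isAdapted_tanMap hX hφ ht ((hP x u).1 hu)
    exact ⟨v, (hP _ v).2 hv, hvu⟩

end Automorphisms

/-! ### The `GN`- and `Sim`-structures of a metric and a null distribution. -/

section Structures

variable {m : ℕ} {M : Type*} [TopologicalSpace M] [ChartedSpace (Mod m) M]
  [IsManifold (𝓡 (m + 2)) ∞ M] {g : LorentzianMetric m M}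

/-- Frames in one fibre differ by elements of `GN`, which only rescale `k`, so any one of them
already determines the line. -/
lemma GNStructure.nullDistribution_eq (P : GNStructure m M) {x : M} {u : Frame m x}
    (hu : u ∈ P.fiber x) : P.nullDistribution x = Submodule.span ℝ {u (kvec m)} := by
  apply le_antisymm
  · refine Submodule.span_le.2 ?_
    rintro _ ⟨v, hv, rfl⟩
    obtain ⟨a, ⟨⟨c, hc⟩, -⟩, rfl⟩ := P.transitive x u hu v hv
    rw [LinearEquiv.trans_apply, hc, map_smul]
    exact Submodule.smul_mem _ c (Submodule.mem_span_singleton_self _)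
  · exact Submodule.span_mono (singleton_subset_iff.2 ⟨u, hu, rfl⟩)

/-- A metric belonging to a `GN`-structure has local adapted frames, and the `GN`-structure
consists of the adapted frames. -/
lemma LorentzianMetric.BelongsTo.hasAdaptedFrames {P : GNStructure m M} (h : g.BelongsTo P) :
    HasAdaptedFrames g P.nullDistribution ∧
      ∀ x u, u ∈ P.fiber x ↔ IsAdapted g P.nullDistribution x u := by
  obtain ⟨Q, hQ⟩ := h
  have hQa : ∀ x, ∀ u ∈ Q.fiber x, IsAdapted g P.nullDistribution x u := fun x u hu =>
    IsAdapted.of_isometry (Submodule.subset_span ⟨u, (hQ x).1 hu, rfl⟩) ((hQ x).2 u hu)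
  have hne : ∀ x, ∃ u, u ∈ Q.fiber x := fun x => by
    obtain ⟨U, -, hx, s, hs, -⟩ := Q.exists_local_section x
    exact ⟨s x, hs x hx⟩
  have hl : ∀ x, Module.finrank ℝ (P.nullDistribution x) = 1 := fun x => by
    obtain ⟨u, hu⟩ := hne x
    rw [P.nullDistribution_eq ((hQ x).1 hu), finrank_span_singleton (frame_kvec_ne_zero u)]
  refine ⟨⟨hl, fun p => ?_⟩, fun x v => ⟨fun hv => ?_, fun hv => ?_⟩⟩
  · obtain ⟨U, hU, hp, s, hs, hsm⟩ := Q.exists_local_section p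
    exact ⟨U, hU, hp, s, fun x hx => hQa x _ (hs x hx), hsm⟩
  · obtain ⟨u, hu⟩ := hne x
    obtain ⟨a, ha, rfl⟩ := P.transitive x u ((hQ x).1 hu) v hv
    exact (hQa x u hu).trans ha
  -- An adapted frame differs from a frame in `Q` by an element of `GN`, and `P` is closed under
  -- `GN`.
  · obtain ⟨u, hu⟩ := hne x
    obtain ⟨a, ha, rfl⟩ := (hQa x u hu).transitive hv (hl x)
    exact P.right_mem x u ((hQ x).1 hu) a ha

namespace NullDistribution

variable (lam : NullDistribution g)

lemma exists_local_frame (p : M) : ∃ U : Set M, IsOpen U ∧ p ∈ U ∧ ∃ s : ∀ x : M, Frame m x,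
    (∀ x ∈ U, s x (kvec m) ∈ lam.line x ∧ ∀ v w, g.val x (s x v) (s x w) = eta v w) ∧
    ∀ v, SmoothFieldOn (fun x => s x v) U := by
  obtain ⟨U, hU, hp, Y, hY, hYl⟩ := lam.smooth p
  have hmem : ∀ x ∈ U, Y x ∈ lam.line x := fun x hx => by
    rw [hYl x hx]
    exact Submodule.mem_span_singleton_self _
  have hYp : Y p ≠ 0 := fun h => by
    have := lam.finrank_eq_one p
    rw [hYl p hp, h, Submodule.span_zero_singleton, finrank_bot] at this
    exact zero_ne_one this
  obtain ⟨U', hU', hp', s, hs, hsm⟩ := exists_local_null_frame (g := g) (K := Y)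
    (by filter_upwards [hU.mem_nhds hp] with y hy using hY.smoothFieldAt hU hy) hYp
    (by filter_upwards [hU.mem_nhds hp] with y hy using lam.null y _ (hmem y hy))
  refine ⟨U ∩ U', hU.inter hU', ⟨hp, hp'⟩, s, fun x hx => ⟨?_, (hs x hx.2).2⟩,
    fun v => (hsm v).mono inter_subset_right⟩
  rw [(hs x hx.2).1]
  exact hmem x hx.1

lemma hasAdaptedFrames : HasAdaptedFrames g lam.line := by
  refine ⟨lam.finrank_eq_one, fun p => ?_⟩
  obtain ⟨U, hU, hp, s, hs, hsm⟩ := lam.exists_local_frame p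
  exact ⟨U, hU, hp, s, fun x hx => .of_isometry (hs x hx).1 (hs x hx).2, hsm⟩

lemma mem_adaptedFrames {x : M} {u : Frame m x} :
    u ∈ g.adaptedFrames lam.line x ↔ IsAdapted g lam.line x u :=
  mem_adaptedFrames_iff (lam.finrank_eq_one x) (lam.null x) u

/-- The `GN`-structure of adapted frames. -/
def gnStructure : GNStructure m M where
  fiber := g.adaptedFrames lam.line
  right_mem x u hu a ha := by
    rw [mem_adaptedFrames] at hu ⊢
    exact hu.trans ha
  transitive x u hu v hv := by
    rw [mem_adaptedFrames] at hu hv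
    exact hu.transitive hv (lam.finrank_eq_one x)
  exists_local_section p := by
    obtain ⟨U, hU, hp, s, hs, hsm⟩ := lam.hasAdaptedFrames.exists_frame p
    exact ⟨U, hU, hp, s, fun x hx => lam.mem_adaptedFrames.2 (hs x hx), hsm⟩

/-- The `Sim`-structure of null frames whose first vector spans the null distribution. -/
def simStructure : GStructure (Sim m) M where
  fiber x := {u | u (kvec m) ∈ lam.line x ∧ ∀ v w, g.val x (u v) (u w) = eta v w}
  right_mem x u hu a ha := by
    obtain ⟨h1, c, hc⟩ := ha
    refine ⟨?_, fun v w => ?_⟩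
    · rw [LinearEquiv.trans_apply, hc, map_smul]
      exact Submodule.smul_mem _ c hu.1
    · rw [LinearEquiv.trans_apply, LinearEquiv.trans_apply, hu.2, h1]
  transitive x u hu v hv := by
    -- The transition map of adapted frames rescales `k`; it is moreover an isometry because both
    -- frames are isometric.
    obtain ⟨a, ⟨hc, -⟩, rfl⟩ := (IsAdapted.of_isometry (line := lam.line) hu.1 hu.2).transitive
      (IsAdapted.of_isometry hv.1 hv.2) (lam.finrank_eq_one x)
    refine ⟨a, ⟨fun v w => ?_, hc⟩, rfl⟩
    rw [← hv.2 v w, LinearEquiv.trans_apply, LinearEquiv.trans_apply, hu.2]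
  exists_local_section := lam.exists_local_frame

lemma belongsTo_gnStructure : g.BelongsTo lam.gnStructure :=
  ⟨lam.simStructure, fun _ => ⟨fun _ hu =>
    lam.mem_adaptedFrames.2 (.of_isometry hu.1 hu.2), fun _ hu => hu.2⟩⟩

end NullDistribution

end Structures

end NilKilling

end

theorem mainTheorem2 {m : ℕ} {M : Type*} [TopologicalSpace M] [T2Space M]
    [ChartedSpace (EuclideanSpace ℝ (Fin (m + 2))) M] [IsManifold (𝓡 (m + 2)) ∞ M]
    (g : NilKilling.LorentzianMetric m M) :
    (∀ P : NilKilling.GNStructure m M, g.BelongsTo P → ∀ X : NilKilling.Fields m M,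
      P.IsInfinitesimalAutomorphism X ↔
        g.IsNilKilling P.nullDistribution X ∧ NilKilling.PreservesLine P.nullDistribution X) ∧
    (∀ lam : NilKilling.NullDistribution g, ∃ P : NilKilling.GNStructure m M,
      (∀ x : M, P.fiber x = g.adaptedFrames lam.line x) ∧
      g.BelongsTo P ∧
      ∃ L : LieSubalgebra ℝ (NilKilling.Fields m M),
        (L : Set (NilKilling.Fields m M)) = g.algebraPreservingNilKilling lam.line ∧
        (L : Set (NilKilling.Fields m M)) = P.aut) := by
  refine ⟨fun P hP X => ?_, fun lam => ?_⟩
  · obtain ⟨h, hfib⟩ := hP.hasAdaptedFrames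
    exact h.isInfinitesimalAutomorphism_iff hfib X
  · refine ⟨lam.gnStructure, fun _ => rfl, lam.belongsTo_gnStructure,
      NilKilling.nilKillingSubalgebra lam.hasAdaptedFrames, rfl, ?_⟩
    ext X
    exact (lam.hasAdaptedFrames.isInfinitesimalAutomorphism_iff
      (fun _ _ => lam.mem_adaptedFrames) X).symm
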